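/- For a positive integer $n$ let $\varpi(n)=\log n$ if $n$ is prime and $\varpi(n)=0$ otherwise, and for real $y>0$ and integers $q\ge 1$, $a$ put $$\vartheta^*(y;a,q)=\sum_{\substack{y<n\le 2y\\ n\equiv a\ (\mathrm{mod}\ q)}}\varpi(n).$$ Let $0<\theta<1$ be a constant such that for every fixed $A>0$, as $x\to\infty$, $$\sum_{q\le x^\theta}\ \sup_{0<y\le x}\ \max_{(a,q)=1}\left|\vartheta^*(y;a,q)-\frac{y}{\varphi(q)}\right|\ll_A \frac{x}{(\log x)^A},$$ where $\varphi$ is Euler's function and the implied constant depends only on $A$ (that is, the primes have level of distribution $\theta$). Then, with $p_n$ denoting the $n$th prime, $$\liminf_{n\to\infty}\frac{p_{n+1}-p_n}{\log p_n}\le\max\{0,\,1-2\theta\}.$$ -/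

import Mathlib

open Filter Asymptotics

noncomputable section

/-- `ϖ(n) = log n` if `n` is a prime, and `0` otherwise. -/
def primeLog (n : ℕ) : ℝ :=
  if n.Prime then Real.log n else 0

/-- `ϑ*(y; a, q)`: the sum of `ϖ(n)` over the integers `y < n ≤ 2y` with `n ≡ a (mod q)`,
for a real number `y ≥ 0`. -/
def thetaStar (y : ℝ) (a q : ℕ) : ℝ :=
  ∑ n ∈ Finset.Ioc ⌊y⌋₊ ⌊2 * y⌋₊ with n ≡ a [MOD q], primeLog n

/-- The values `|ϑ*(y; a, q) - y / φ(q)|` for real `0 < y ≤ x` and residues `a` prime to `q`. -/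
def discrepancySet (x : ℝ) (q : ℕ) : Set ℝ :=
  {r | ∃ (y : ℝ) (a : ℕ), 0 < y ∧ y ≤ x ∧ a.Coprime q ∧
    r = |thetaStar y a q - y / (q.totient : ℝ)|}

/-- The maximum (supremum) over `y ≤ x` and over `a` prime to `q` of
`|ϑ*(y; a, q) - y / φ(q)|`. -/
def maxDiscrepancy (x : ℝ) (q : ℕ) : ℝ :=
  sSup (discrepancySet x q)

/-- The primes have level of distribution `θ`: for every fixed `A > 0`,
`∑_{q ≤ x^θ} max_{y ≤ x} max_{(a,q)=1} |ϑ*(y; a, q) - y / φ(q)| ≪ x / (log x)^A`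
as `x → ∞`, with an implied constant depending on `A`. -/
def HasLevelOfDistribution (θ : ℝ) : Prop :=
  ∀ A : ℝ, 0 < A →
    (fun x : ℝ => ∑ q ∈ Finset.Icc 1 ⌊x ^ θ⌋₊, maxDiscrepancy x q)
      =O[atTop] (fun x : ℝ => x / Real.log x ^ A)

/-- The supremum in `maxDiscrepancy` is over a nonempty set. -/
theorem discrepancySet_nonempty {x : ℝ} (hx : 0 < x) (q : ℕ) :
    (discrepancySet x q).Nonempty :=
  ⟨_, x, 1, hx, le_rfl, Nat.coprime_one_left q, rfl⟩

theorem primeLog_nonneg (n : ℕ) : 0 ≤ primeLog n := by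
  unfold primeLog
  split_ifs
  · exact Real.log_natCast_nonneg n
  · exact le_rfl

/-- The supremum in `maxDiscrepancy` is over a bounded set. -/
theorem discrepancySet_bddAbove (x : ℝ) (q : ℕ) : BddAbove (discrepancySet x q) := by
  refine ⟨(∑ n ∈ Finset.Ioc 0 ⌊2 * x⌋₊, primeLog n) + x, ?_⟩
  rintro r ⟨y, a, hy, hyx, -, rfl⟩
  have h0 : 0 ≤ thetaStar y a q := Finset.sum_nonneg fun n _ => primeLog_nonneg n
  have h1 : thetaStar y a q ≤ ∑ n ∈ Finset.Ioc 0 ⌊2 * x⌋₊, primeLog n := by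
    refine Finset.sum_le_sum_of_subset_of_nonneg ?_ fun n _ _ => primeLog_nonneg n
    refine (Finset.filter_subset _ _).trans (Finset.Ioc_subset_Ioc (Nat.zero_le _) ?_)
    exact Nat.floor_le_floor (by linarith)
  have h2 : 0 ≤ y / (q.totient : ℝ) := by positivity
  have h3 : y / (q.totient : ℝ) ≤ x := by
    rcases Nat.eq_zero_or_pos q.totient with h | h
    · rw [h]; simp; linarith
    · have : (1 : ℝ) ≤ q.totient := by exact_mod_cast h
      exact (div_le_self hy.le this).trans hyx
  rw [abs_le]
  constructor <;> linarith

end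

/-! The right-hand side is at least 0, so it is enough to prove bounded gaps: for every level of
distribution `θ > 0` there is a constant `B` such that infinitely many consecutive primes differ by
at most `B`. This is the Maynard–Tao phenomenon, obtained here from a multidimensional Selberg
sieve.

Put `W = D!` and consider `n ≡ 1 mod W` with the shifts `n + iW`, `i < k`. A nonnegative weight `(∑
λ_c)²` is attached to `n`. If at most one shift were prime for each `n`, the sum over `j` of the
weighted prime sums at `n + jW` would be at most `log 2N` times the total weight
(`exists_two_primes`). The sieve contradicts this once `Jθ` is large, where `k = 2^J`.

A vector of pairwise coprime squarefree divisors `d_i ∣ n + iW` is encoded as a colouring `c` of the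
primes in `(D, R]`: the primes of colour `i` are those dividing `d_i`. The local conditions at
different primes are independent, so both main terms are quadratic forms whose matrix is a tensor
product over the primes. Adding positive semidefinite matrices to the factors can only enlarge such
a form (`tensorForm_le_of_gram`), and this replaces exact diagonalization by two inequalities,
`tensorForm_compatDensity_le` and `le_tensorForm_compatDensity`.

The diagonal variables are `∏ G(log d_i)`, cut off at `∑ log d_i ≤ ρ`. With `X = ∑ G(log d)²/d` and
`Y = ∑ G(log d)/d`, the total weight is at most about `N/W · X^k`, and the sum over primes at one
shift is at least a constant times `N/φ(W) · X^(k-1) Y²` (`le_primeForm`). For the step function `G`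
imitating `min(1, ℓ/u)` on a range of `J` dyadic scales, `Y` gains a factor `J` that `X` does not
see (`stepWeight_moments`). With `ℓ = ρ/(200Jk)` the ratio of the two sides, after summing over the
`k` shifts, is a constant times `Jθ` (`exists_form_bounds`, `sieve_main_inequality`).

The errors are at most 1 for each pair of colourings in the count of integers. For primes they are
controlled by the level of distribution, after separating the multiplicities from the discrepancies
(`sum_pow_card_mul_maxDiscrepancy_le`). -/

section TensorForms

/-! ### Quadratic forms with tensor product matrices. -/

variable {ι T L L' : Type*} [Fintype ι] [DecidableEq ι] [Fintype T] [DecidableEq T]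
  [Fintype L] [DecidableEq L] [Fintype L'] [DecidableEq L']

theorem sum_pi_prod (f : ι → T → ℝ) : ∑ c : ι → T, ∏ p, f p (c p) = ∏ p, ∑ t, f p t := by
  rw [Finset.prod_univ_sum, Fintype.piFinset_univ]

/-- The quadratic form on functions of `c : ι → T` whose matrix is the tensor product of the
matrices `B p`. -/
noncomputable def tensorForm (B : ι → T → T → ℝ) (v : (ι → T) → ℝ) : ℝ :=
  ∑ c, ∑ c', v c * v c' * ∏ p, B p (c p) (c' p)

/-- A tensor product of Gram matrices is again a Gram matrix, indexed by the tuples `l` of local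
indices. -/
theorem tensorForm_eq_sum_sq (B : ι → T → T → ℝ) (w : ι → L → ℝ) (u : ι → L → T → ℝ)
    (h : ∀ p s t, B p s t = ∑ l, w p l * (u p l s * u p l t)) (v : (ι → T) → ℝ) :
    tensorForm B v
      = ∑ l : ι → L, (∏ p, w p (l p)) * (∑ c, v c * ∏ p, u p (l p) (c p)) ^ 2 := by
  unfold tensorForm
  have h1 : ∀ c c' : ι → T, v c * v c' * ∏ p, B p (c p) (c' p)
      = ∑ l : ι → L, (∏ p, w p (l p)) * ((v c * ∏ p, u p (l p) (c p)) *
          (v c' * ∏ p, u p (l p) (c' p))) := by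
    intro c c'
    have : ∏ p, B p (c p) (c' p)
        = ∑ l : ι → L, ∏ p, (w p (l p) * (u p (l p) (c p) * u p (l p) (c' p))) := by
      rw [sum_pi_prod (fun p l => w p l * (u p l (c p) * u p l (c' p)))]
      exact Finset.prod_congr rfl fun p _ => h p _ _
    rw [this, Finset.mul_sum]
    refine Finset.sum_congr rfl fun l _ => ?_
    rw [Finset.prod_mul_distrib, Finset.prod_mul_distrib]
    ring
  simp_rw [h1]
  have h2 : ∀ c : ι → T, ∑ c' : ι → T, ∑ l : ι → L, (∏ p, w p (l p)) *
      ((v c * ∏ p, u p (l p) (c p)) * (v c' * ∏ p, u p (l p) (c' p)))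
      = ∑ l : ι → L, ∑ c' : ι → T, (∏ p, w p (l p)) *
      ((v c * ∏ p, u p (l p) (c p)) * (v c' * ∏ p, u p (l p) (c' p))) :=
    fun c => Finset.sum_comm
  simp_rw [h2]
  rw [Finset.sum_comm]
  refine Finset.sum_congr rfl fun l _ => ?_
  rw [sq, Finset.sum_mul_sum, Finset.mul_sum]
  refine Finset.sum_congr rfl fun c _ => ?_
  rw [Finset.mul_sum]

/-- A tensor product of positive semidefinite matrices grows when positive semidefinite matrices
are added to the factors. -/
theorem tensorForm_le_of_gram (A B : ι → T → T → ℝ) (w : ι → L → ℝ) (u : ι → L → T → ℝ)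
    (w' : ι → L' → ℝ) (u' : ι → L' → T → ℝ) (hw : ∀ p l, 0 ≤ w p l) (hw' : ∀ p l, 0 ≤ w' p l)
    (hA : ∀ p s t, A p s t = ∑ l, w p l * (u p l s * u p l t))
    (hB : ∀ p s t, B p s t = A p s t + ∑ l, w' p l * (u' p l s * u' p l t))
    (v : (ι → T) → ℝ) : tensorForm A v ≤ tensorForm B v := by
  rw [tensorForm_eq_sum_sq A w u hA v,
    tensorForm_eq_sum_sq (L := L ⊕ L') B (fun p => Sum.elim (w p) (w' p))
      (fun p => Sum.elim (u p) (u' p))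
      (by intro p s t; rw [hB, hA, Fintype.sum_sum_type]; rfl) v]
  -- Tuples with all entries in the left summand reproduce the form of `A`; every other tuple adds a
  -- nonnegative square.
  have hinj : Function.Injective (fun (l : ι → L) (p : ι) => (Sum.inl (l p) : L ⊕ L')) := by
    intro a b hab
    funext p
    exact Sum.inl_injective (congrFun hab p)
  calc _ = ∑ l ∈ Finset.univ.map ⟨_, hinj⟩, (∏ p, Sum.elim (w p) (w' p) (l p)) *
        (∑ c, v c * ∏ p, (Sum.elim (u p) (u' p) (l p) : T → ℝ) (c p)) ^ 2 := by
        rw [Finset.sum_map]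
        rfl
    _ ≤ _ := by
        refine Finset.sum_le_sum_of_subset_of_nonneg (Finset.subset_univ _) fun l _ _ => ?_
        refine mul_nonneg (Finset.prod_nonneg fun p _ => ?_) (sq_nonneg _)
        cases l p with
        | inl a => exact hw p a
        | inr a => exact hw' p a

/-- Push-forward of a product weight under a coordinatewise map. -/
theorem sum_comp_mul_prod (φ : ι → T → T) (w : ι → T → ℝ) (F : (ι → T) → ℝ) :
    ∑ r : ι → T, F (fun p => φ p (r p)) * ∏ p, w p (r p)
      = ∑ s : ι → T, F s * ∏ p, ∑ t, if φ p t = s p then w p t else 0 := by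
  simp_rw [← sum_pi_prod (fun p t => if φ p t = _ then w p t else 0), Finset.mul_sum]
  rw [Finset.sum_comm]
  refine Finset.sum_congr rfl fun r _ => ?_
  rw [Finset.sum_eq_single (fun p => φ p (r p))]
  · simp
  · intro s _ hs
    have : ∃ p, φ p (r p) ≠ s p := by
      by_contra! h
      exact hs (funext fun p => (h p).symm)
    obtain ⟨p, hp⟩ := this
    rw [Finset.prod_eq_zero (Finset.mem_univ p) (if_neg hp), mul_zero]
  · simp

end TensorForms

/-! ### Selberg diagonalization: upper bound for the sieve form. -/

section SieveForms

variable {ι α : Type*} [Fintype ι] [DecidableEq ι] [Fintype α] [DecidableEq α]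

/-- The density of the integers subject to two conditions at a prime, where the events of the
different colours are disjoint and of density `1 / q` each. -/
noncomputable def compatDensity (q : ℝ) : Option α → Option α → ℝ
  | none, none => 1
  | none, some _ => 1 / q
  | some _, none => 1 / q
  | some i, some j => if i = j then 1 / q else 0

/-- The linear forms that diagonalize the sieve. -/
noncomputable def diagVec (q : ℝ) : Option α → Option α → ℝ
  | none, none => 1
  | none, some _ => 1 / q
  | some _, none => 0
  | some i, some j => if i = j then 1 else 0

/-- The local factor of the passage from the diagonal variables to the sieve weights. -/
noncomputable def moebiusFactor (q : ℝ) : Option α → Option α → ℝ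
  | none, none => 1
  | none, some _ => 1 / q
  | some _, none => 0
  | some i, some j => if i = j then -1 else 0

/-- The sieve weights with diagonal variables `y`. -/
noncomputable def sieveWeight (q : ι → ℝ) (y : (ι → Option α) → ℝ) (c : ι → Option α) : ℝ :=
  ∑ r, y r * ∏ p, moebiusFactor (q p) (c p) (r p)

/-- The product of `x p` over the coloured `p`. -/
noncomputable def colorProd (x : ι → ℝ) (c : ι → Option α) : ℝ :=
  ∏ p, if c p = none then 1 else x p

theorem sum_sieveWeight_mul_prod (q : ι → ℝ) (y : (ι → Option α) → ℝ)
    (f : ι → Option α → ℝ) :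
    ∑ c, sieveWeight q y c * ∏ p, f p (c p)
      = ∑ r, y r * ∏ p, ∑ s, moebiusFactor (q p) s (r p) * f p s := by
  unfold sieveWeight
  simp_rw [Finset.sum_mul]
  rw [Finset.sum_comm]
  refine Finset.sum_congr rfl fun r _ => ?_
  rw [← sum_pi_prod (fun p s => moebiusFactor (q p) s (r p) * f p s), Finset.mul_sum]
  refine Finset.sum_congr rfl fun c _ => ?_
  rw [Finset.prod_mul_distrib]
  ring

/-- Up to sign, `moebiusFactor` inverts `diagVec`. Hence evaluating the diagonal forms at
`sieveWeight q y` returns `±y`. -/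
theorem sum_moebiusFactor_mul_diagVec (q : ℝ) (l t : Option α) :
    ∑ s, moebiusFactor q s t * diagVec q l s
      = if l = t then (if l = none then 1 else -1) else 0 := by
  rw [Fintype.sum_option]
  cases l <;> cases t <;> simp [moebiusFactor, diagVec, eq_comm]

/-- Local probability space: an integer is in state `none` with probability `1 - k/q` and in state
`l` with probability `1/q`, and the vectors are the indicators of "condition `s` holds in state
`l`". -/
theorem compatDensity_gram (q : ℝ) (s t : Option α) :
    compatDensity q s t = ∑ l : Option α, (if l = none then 1 - Fintype.card α / q else 1 / q) *
      ((if s = none ∨ s = l then 1 else 0) * (if t = none ∨ t = l then 1 else 0)) := by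
  rw [Fintype.sum_option]
  cases s <;> cases t <;> simp [compatDensity, div_eq_mul_inv, eq_comm]

/-- The sieve form is bounded by a diagonal one. -/
theorem tensorForm_compatDensity_le (q : ι → ℝ) (hq : ∀ p, 0 < q p)
    (hk : ∀ p, (Fintype.card α : ℝ) ≤ q p) (y : (ι → Option α) → ℝ) :
    tensorForm (fun p => compatDensity (q p)) (sieveWeight q y)
      ≤ ∑ c, y c ^ 2 * colorProd (fun p => 1 / q p) c := by
  -- The added rank-one matrix is `1/q²` on pairs of colours. It completes the square, so that the
  -- sum is exactly diagonal in the forms `diagVec`.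
  have h1 := tensorForm_le_of_gram (T := Option α) (L := Option α) (L' := Unit)
    (fun p => compatDensity (q p))
    (fun p s t => compatDensity (q p) s t + ∑ _l : Unit, 1 *
      ((if s = none then 0 else 1 / q p) * (if t = none then 0 else 1 / q p)))
    (fun p l => if l = none then 1 - Fintype.card α / q p else 1 / q p)
    (fun p l s => if s = none ∨ s = l then 1 else 0)
    (fun p _ => 1) (fun p _ s => if s = none then 0 else 1 / q p)
    (by
      intro p l
      have := hq p
      split_ifs
      · rw [sub_nonneg, div_le_one this]; exact hk p
      · positivity)
    (fun _ _ => zero_le_one) (fun p s t => compatDensity_gram (q p) s t) (fun _ _ _ => rfl)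
    (sieveWeight q y)
  refine h1.trans (le_of_eq ?_)
  rw [tensorForm_eq_sum_sq (L := Option α) _ (fun p l => if l = none then 1 else 1 / q p)
    (fun p => diagVec (q p)) (by
      intro p s t
      rw [Fintype.sum_option]
      cases s <;> cases t <;> simp [compatDensity, diagVec]
      rw [add_comm]; congr 1; simp [eq_comm])]
  refine Finset.sum_congr rfl fun l _ => ?_
  rw [sum_sieveWeight_mul_prod, Finset.sum_eq_single l]
  · simp_rw [sum_moebiusFactor_mul_diagVec, if_pos]
    rw [mul_comm, mul_pow, ← Finset.prod_pow]
    have : ∀ p, (if l p = none then (1 : ℝ) else -1) ^ 2 = 1 := by intro p; split_ifs <;> simp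
    simp_rw [this]
    simp [colorProd]
  · intro r _ hr
    have : ∃ p, l p ≠ r p := by
      by_contra! h
      exact hr (funext fun p => (h p).symm)
    obtain ⟨p, hp⟩ := this
    rw [Finset.prod_eq_zero (Finset.mem_univ p), mul_zero]
    rw [sum_moebiusFactor_mul_diagVec, if_neg hp]
  · simp

end SieveForms

/-! ### Lower bound for the form and transfer to the form weighted by primes. -/

section SieveLower

variable {ι α : Type*} [Fintype ι] [DecidableEq ι] [Fintype α] [DecidableEq α]

/-- The sum of squares of differences over ordered pairs is twice the Laplacian of the complete
graph, with entries `kδ - 1`. -/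
theorem sum_mul_indicator_sub_mul (i j : α) (x : ℝ) :
    ∑ a : α × α, x * (((if i = a.1 then (1 : ℝ) else 0) - if i = a.2 then 1 else 0) *
      ((if j = a.1 then (1 : ℝ) else 0) - if j = a.2 then 1 else 0))
      = x * (2 * ((if i = j then (Fintype.card α : ℝ) else 0) - 1)) := by
  rw [← Finset.mul_sum, Fintype.sum_prod_type]
  congr 1
  simp only [sub_mul, mul_sub, Finset.sum_sub_distrib, mul_ite, ite_mul, mul_one, mul_zero,
    one_mul, zero_mul, Finset.sum_ite_eq, Finset.mem_univ, if_true, Finset.sum_const,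
    Finset.card_univ, nsmul_eq_mul]
  have h : (Finset.univ.sum fun x : α => if j = x then if i = x then (1 : ℝ) else 0 else 0)
      = if i = j then 1 else 0 := by simp
  split_ifs with hij
  · simp [hij]; ring
  · simp [hij]; norm_num

/-- The sieve form dominates a diagonal one. -/
theorem le_tensorForm_compatDensity (q : ι → ℝ) (hq : ∀ p, 0 < q p)
    (hk : ∀ p, (Fintype.card α : ℝ) ≤ q p) (v : (ι → Option α) → ℝ) :
    ∑ l : ι → Option α, colorProd (fun p => 1 / q p - Fintype.card α / q p ^ 2) l *
        (∑ c, v c * ∏ p, diagVec (q p) (l p) (c p)) ^ 2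
      ≤ tensorForm (fun p => compatDensity (q p)) v := by
  have hgram : ∀ p (s t : Option α), (fun p s t => ∑ l : Option α,
        (if l = none then 1 else 1 / q p - Fintype.card α / q p ^ 2) *
          (diagVec (q p) l s * diagVec (q p) l t)) p s t
      = ∑ l : Option α, (if l = none then 1 else 1 / q p - Fintype.card α / q p ^ 2) *
          (diagVec (q p) l s * diagVec (q p) l t) := fun _ _ _ => rfl
  -- Lowering the colour weight from `1/q` to `1/q - k/q²` leaves the remainder `(kδ - 1)/q²` on
  -- pairs of colours, a complete-graph Laplacian and therefore positive semidefinite.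
  have h1 := tensorForm_le_of_gram (T := Option α) (L := Option α) (L' := α × α)
    (fun p s t => ∑ l : Option α, (if l = none then 1 else 1 / q p - Fintype.card α / q p ^ 2) *
      (diagVec (q p) l s * diagVec (q p) l t))
    (fun p => compatDensity (q p))
    (fun p l => if l = none then 1 else 1 / q p - Fintype.card α / q p ^ 2)
    (fun p => diagVec (q p))
    (fun p _ => 1 / (2 * q p ^ 2))
    (fun p a s => (if s = some a.1 then 1 else 0) - if s = some a.2 then 1 else 0)
    (by
      intro p l
      have := hq p
      split_ifs
      · exact zero_le_one
      · rw [sub_nonneg, div_le_div_iff₀ (by positivity) this]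
        nlinarith [hk p])
    (fun p _ => by have := hq p; positivity) hgram
    (by
      intro p s t
      have hp := (hq p).ne'
      rw [Fintype.sum_option]
      cases s with
      | none => cases t <;> simp [compatDensity, diagVec]
      | some i =>
        cases t with
        | none => simp [compatDensity, diagVec]
        | some j =>
          simp only [Option.some.injEq]
          rw [sum_mul_indicator_sub_mul]
          by_cases hij : i = j
          · subst hij
            simp [compatDensity, diagVec]
            field_simp
            ring
          · simp [compatDensity, diagVec, hij, Ne.symm hij]
            field_simp
            norm_num)
    v
  refine le_trans (le_of_eq ?_) h1
  rw [tensorForm_eq_sum_sq (L := Option α) _ _ _ hgram]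
  rfl

/-- The coefficients expressing the diagonal variables of the form weighted by primes at
`n + h_j` through those of the full form. -/
noncomputable def transferFactor (j : α) (q : ℝ) (l t : Option α) : ℝ :=
  if l = none then
    (if t = none then 1 else if t = some j then 1 / q else 1 / q - 1 / (q - 1))
  else if t = l then 1 else 0

/-- The part of `transferFactor` in which only the colour `j` is added. -/
noncomputable def transferMain (j : α) (q : ℝ) (l t : Option α) : ℝ :=
  if l = none then (if t = none then 1 else if t = some j then 1 / q else 0)
  else if t = l then 1 else 0

/-- The weights are built with density `1/q`, but primes have density `1/(q-1)` in each reduced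
class, and colour `j` is forbidden. Composing the two transformations gives the coefficients
`transferFactor`. -/
theorem sum_moebiusFactor_mul_restrict (j : α) (q : ℝ) (l t : Option α) (hl : l ≠ some j) :
    ∑ s, moebiusFactor q s t * ((if s = some j then 0 else 1) * diagVec (q - 1) l s)
      = (if l = none then 1 else -1) * transferFactor j q l t := by
  rw [Fintype.sum_option]
  cases l with
  | none =>
    cases t with
    | none => simp [moebiusFactor, diagVec, transferFactor]
    | some i =>
      by_cases hi : i = j
      · subst hi
        simp only [moebiusFactor, diagVec, transferFactor]
        rw [Finset.sum_eq_zero]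
        · simp
        · intro b _
          by_cases hb : b = i <;> simp [hb]
      · simp only [moebiusFactor, diagVec, transferFactor]
        rw [Finset.sum_eq_single i]
        · simp [hi]; ring
        · intro b _ hb; simp [hb]
        · simp
  | some i =>
    have hij : i ≠ j := fun h => hl (by rw [h])
    cases t with
    | none => simp [moebiusFactor, diagVec, transferFactor]
    | some b =>
      simp only [moebiusFactor, diagVec, transferFactor]
      rw [Finset.sum_eq_single b]
      · by_cases hb : b = i
        · subst hb; simp [hij]
        · simp [hb, Ne.symm hb]
      · intro a _ ha; simp [ha]
      · simp

theorem sq_sum_restrict_sieveWeight (j : α) (q : ι → ℝ) (y : (ι → Option α) → ℝ)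
    (l : ι → Option α) (hl : ∀ p, l p ≠ some j) :
    (∑ c, (if ∀ p, c p ≠ some j then sieveWeight q y c else 0) *
        ∏ p, diagVec (q p - 1) (l p) (c p)) ^ 2
      = (∑ r, y r * ∏ p, transferFactor j (q p) (l p) (r p)) ^ 2 := by
  have h1 : ∀ c : ι → Option α, (if ∀ p, c p ≠ some j then sieveWeight q y c else 0) *
        ∏ p, diagVec (q p - 1) (l p) (c p)
      = sieveWeight q y c *
        ∏ p, ((if c p = some j then 0 else 1) * diagVec (q p - 1) (l p) (c p)) := by
    intro c
    split_ifs with h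
    · congr 1
      refine Finset.prod_congr rfl fun p _ => ?_
      rw [if_neg (h p), one_mul]
    · push Not at h
      obtain ⟨p, hp⟩ := h
      rw [Finset.prod_eq_zero (i := p)
        (f := fun p => (if c p = some j then 0 else 1) * diagVec (q p - 1) (l p) (c p))
        (Finset.mem_univ p) (by rw [if_pos hp, zero_mul])]
      simp
  simp_rw [h1]
  rw [sum_sieveWeight_mul_prod q y
    (fun p s => (if s = some j then 0 else 1) * diagVec (q p - 1) (l p) s)]
  simp_rw [sum_moebiusFactor_mul_restrict j _ _ _ (hl _), Finset.prod_mul_distrib]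
  have : ∀ r : ι → Option α, y r * ((∏ p, if l p = none then (1 : ℝ) else -1) *
      ∏ p, transferFactor j (q p) (l p) (r p))
      = (∏ p, if l p = none then (1 : ℝ) else -1) *
        (y r * ∏ p, transferFactor j (q p) (l p) (r p)) := fun r => by ring
  simp_rw [this]
  rw [← Finset.mul_sum, mul_pow, ← Finset.prod_pow]
  have h2 : ∀ p, (if l p = none then (1 : ℝ) else -1) ^ 2 = 1 := by
    intro p; split_ifs <;> simp
  simp_rw [h2]
  simp

theorem transferMain_nonneg (j : α) {q : ℝ} (hq : 0 < q) (l t : Option α) :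
    0 ≤ transferMain j q l t := by
  unfold transferMain
  split_ifs <;> positivity

/-- If all factors agree with their main parts, both sides are equal. Otherwise some main factor is
0, and only `-|T| ≤ T` is needed. -/
theorem two_mul_prod_transferMain_sub_le (j : α) (q : ι → ℝ) (hq : ∀ p, 1 < q p)
    (l r : ι → Option α) :
    2 * ∏ p, transferMain j (q p) (l p) (r p) - ∏ p, |transferFactor j (q p) (l p) (r p)|
      ≤ ∏ p, transferFactor j (q p) (l p) (r p) := by
  by_cases h : ∀ p, transferMain j (q p) (l p) (r p) = transferFactor j (q p) (l p) (r p)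
  · have h0 : ∀ p, |transferFactor j (q p) (l p) (r p)| = transferFactor j (q p) (l p) (r p) :=
      fun p => abs_of_nonneg (by rw [← h p]; exact transferMain_nonneg j (by linarith [hq p]) _ _)
    simp_rw [h0, h]
    linarith
  · push Not at h
    obtain ⟨p, hp⟩ := h
    have h0 : transferMain j (q p) (l p) (r p) = 0 := by
      unfold transferMain transferFactor at *
      split_ifs at * <;> simp_all
    rw [Finset.prod_eq_zero (Finset.mem_univ p) h0, ← Finset.abs_prod]
    linarith [neg_abs_le (∏ p, transferFactor j (q p) (l p) (r p))]

/-- Colours other than `j` placed on an uncoloured prime have size `1/(q-1) - 1/q`. Erasing them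
moves at most `k` such terms onto `none`, where the main factor is 1. -/
theorem sum_abs_transferFactor_le (j : α) {q : ℝ} (hq : 1 < q) (l s : Option α) :
    (∑ t, if (if l = none ∧ t ≠ some j then none else t) = s then |transferFactor j q l t| else 0)
      ≤ (1 + Fintype.card α * (1 / (q - 1) - 1 / q)) * transferMain j q l s := by
  have hq0 : 0 < q := by linarith
  have hε : 0 ≤ 1 / (q - 1) - 1 / q := by
    rw [sub_nonneg]; exact one_div_le_one_div_of_le (by linarith) (by linarith)
  have hone : 1 ≤ 1 + Fintype.card α * (1 / (q - 1) - 1 / q) := by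
    have : 0 ≤ (Fintype.card α : ℝ) * (1 / (q - 1) - 1 / q) := by positivity
    linarith
  cases l with
  | some i =>
    simp only [reduceCtorEq, false_and, if_false, Finset.sum_ite_eq', Finset.mem_univ, if_true]
    have : |transferFactor j q (some i) s| = transferMain j q (some i) s := by
      unfold transferFactor transferMain
      simp only [reduceCtorEq, if_false]
      split_ifs <;> simp
    rw [this]
    exact le_mul_of_one_le_left (transferMain_nonneg j hq0 _ _) hone
  | none =>
    cases s with
    | some i =>
      by_cases hi : i = j
      · subst hi
        rw [Finset.sum_eq_single (some i)]
        · simp only [ne_eq, not_true_eq_false, and_false, if_false, if_true]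
          have : |transferFactor i q none (some i)| = transferMain i q none (some i) := by
            unfold transferFactor transferMain
            simp [abs_of_pos hq0]
          rw [this]
          exact le_mul_of_one_le_left (transferMain_nonneg i hq0 _ _) hone
        · intro t _ ht
          simp [ht]
        · simp
      · refine le_trans (le_of_eq (Finset.sum_eq_zero fun t _ => ?_))
          (mul_nonneg (by linarith) (transferMain_nonneg j hq0 _ _))
        by_cases ht : t = some j
        · subst ht; simp [Ne.symm hi]
        · simp [ht]
    | none =>
      rw [Fintype.sum_option]
      have h1 : transferMain j q none none = 1 := by simp [transferMain]
      have h2 : |transferFactor j q none none| = 1 := by simp [transferFactor]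
      rw [h1, h2, mul_one]
      simp only [ne_eq, reduceCtorEq, not_false_eq_true, and_self, if_true]
      refine add_le_add_right ?_ 1
      calc _ ≤ ∑ _i : α, (1 / (q - 1) - 1 / q) := by
            refine Finset.sum_le_sum fun i _ => ?_
            by_cases hi : i = j
            · subst hi; simpa using hε
            · have : |transferFactor j q none (some i)| = 1 / (q - 1) - 1 / q := by
                unfold transferFactor
                simp only [reduceCtorEq, if_false, if_true, Option.some.injEq, hi]
                rw [abs_sub_comm, abs_of_nonneg hε]
              simpa [hi, this] using hε
        _ = _ := by rw [Finset.sum_const, Finset.card_univ, nsmul_eq_mul]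

/-- The unwanted colours are erased, which only increases `y` by `hmono`. The absolute sum thus
exceeds the main sum by at most the product over the primes, and `two_mul_prod_transferMain_sub_le`
turns this into a lower bound. -/
theorem mul_sum_transferMain_le (j : α) (q : ι → ℝ) (hq : ∀ p, 1 < q p)
    (y : (ι → Option α) → ℝ) (hy : ∀ r, 0 ≤ y r)
    (hmono : ∀ r s : ι → Option α, (∀ p, s p = none ∨ s p = r p) → y r ≤ y s)
    (l : ι → Option α) :
    (2 - ∏ p, (1 + Fintype.card α * (1 / (q p - 1) - 1 / q p))) *
        ∑ r, y r * ∏ p, transferMain j (q p) (l p) (r p)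
      ≤ ∑ r, y r * ∏ p, transferFactor j (q p) (l p) (r p) := by
  have h1 : ∑ r, y r * ∏ p, |transferFactor j (q p) (l p) (r p)|
      ≤ (∏ p, (1 + Fintype.card α * (1 / (q p - 1) - 1 / q p))) *
        ∑ r, y r * ∏ p, transferMain j (q p) (l p) (r p) := by
    calc _ ≤ ∑ r : ι → Option α,
          y (fun p => if l p = none ∧ r p ≠ some j then none else r p) *
            ∏ p, |transferFactor j (q p) (l p) (r p)| := by
          refine Finset.sum_le_sum fun r _ => ?_
          refine mul_le_mul_of_nonneg_right (hmono _ _ fun p => ?_)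
            (Finset.prod_nonneg fun p _ => abs_nonneg _)
          split_ifs
          · exact Or.inl rfl
          · exact Or.inr rfl
      _ = _ := sum_comp_mul_prod (fun p t => if l p = none ∧ t ≠ some j then none else t)
            (fun p t => |transferFactor j (q p) (l p) t|) y
      _ ≤ ∑ s, y s * ∏ p, ((1 + Fintype.card α * (1 / (q p - 1) - 1 / q p)) *
            transferMain j (q p) (l p) (s p)) := by
          refine Finset.sum_le_sum fun s _ => mul_le_mul_of_nonneg_left ?_ (hy s)
          refine Finset.prod_le_prod (fun p _ => Finset.sum_nonneg fun t _ => ?_)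
            fun p _ => sum_abs_transferFactor_le j (hq p) (l p) (s p)
          split_ifs <;> positivity
      _ = _ := by
          rw [Finset.mul_sum]
          refine Finset.sum_congr rfl fun s _ => ?_
          rw [Finset.prod_mul_distrib]
          ring
  rw [sub_mul]
  refine (sub_le_sub_left h1 _).trans ?_
  rw [Finset.mul_sum, ← Finset.sum_sub_distrib]
  refine Finset.sum_le_sum fun r _ => ?_
  have := mul_le_mul_of_nonneg_left (two_mul_prod_transferMain_sub_le j q hq l r) (hy r)
  linarith

end SieveLower

/-! ### Colourings as tuples of disjoint sets, and one-dimensional sums. -/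

section ColorClasses

variable {ι α : Type*} [Fintype ι] [DecidableEq ι] [Fintype α] [DecidableEq α]

/-- The elements of colour `i`. -/
def colorClass (c : ι → Option α) (i : α) : Finset ι :=
  Finset.univ.filter fun p => c p = some i

/-- The coloured elements. -/
def colorSupport (c : ι → Option α) : Finset ι :=
  Finset.univ.filter fun p => c p ≠ none

/-- The sum of the logarithms over a finite set. -/
noncomputable def logSum (x : ι → ℝ) (S : Finset ι) : ℝ := ∑ p ∈ S, Real.log (x p)

/-- The product of the inverses over a finite set. -/
noncomputable def invProd (x : ι → ℝ) (S : Finset ι) : ℝ := ∏ p ∈ S, 1 / x p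

theorem mem_colorClass {c : ι → Option α} {i : α} {p : ι} :
    p ∈ colorClass c i ↔ c p = some i := by simp [colorClass]

theorem mem_colorSupport {c : ι → Option α} {p : ι} : p ∈ colorSupport c ↔ c p ≠ none := by
  simp [colorSupport]

theorem colorSupport_eq_biUnion (c : ι → Option α) :
    colorSupport c = Finset.univ.biUnion (colorClass c) := by
  ext p
  simp [mem_colorSupport, mem_colorClass, Option.ne_none_iff_exists']

theorem pairwiseDisjoint_colorClass (c : ι → Option α) :
    (↑(Finset.univ : Finset α) : Set α).PairwiseDisjoint (colorClass c) := by
  intro i _ i' _ h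
  refine Finset.disjoint_left.mpr fun p hp hp' => h ?_
  rw [mem_colorClass] at hp hp'
  exact Option.some_injective _ (hp.symm.trans hp')

theorem prod_prod_colorClass (f : ι → ℝ) (c : ι → Option α) :
    ∏ i, ∏ p ∈ colorClass c i, f p = ∏ p ∈ colorSupport c, f p := by
  rw [colorSupport_eq_biUnion, Finset.prod_biUnion (pairwiseDisjoint_colorClass c)]

theorem sum_sum_colorClass (f : ι → ℝ) (c : ι → Option α) :
    ∑ i, ∑ p ∈ colorClass c i, f p = ∑ p ∈ colorSupport c, f p := by
  rw [colorSupport_eq_biUnion, Finset.sum_biUnion (pairwiseDisjoint_colorClass c)]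

theorem colorProd_eq_prod (f : ι → ℝ) (c : ι → Option α) :
    colorProd f c = ∏ p ∈ colorSupport c, f p := by
  rw [colorProd, colorSupport, Finset.prod_filter]
  refine Finset.prod_congr rfl fun p _ => ?_
  by_cases h : c p = none <;> simp [h]

theorem colorClass_injective : Function.Injective (colorClass : (ι → Option α) → α → Finset ι) := by
  intro c c' h
  have key : ∀ p i, c p = some i ↔ c' p = some i := by
    intro p i
    rw [← mem_colorClass, h, mem_colorClass]
  funext p
  exact Option.ext fun i => by simpa using key p i

theorem exists_colorClass_eq {S : α → Finset ι} (hS : ∀ i i', i ≠ i' → Disjoint (S i) (S i')) :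
    ∃ c : ι → Option α, colorClass c = S := by
  classical
  refine ⟨fun p => if h : ∃ i, p ∈ S i then some h.choose else none, ?_⟩
  funext i
  ext p
  rw [mem_colorClass]
  constructor
  · intro h
    by_cases h' : ∃ i, p ∈ S i
    · rw [dif_pos h'] at h
      rw [← Option.some_injective _ h]
      exact h'.choose_spec
    · rw [dif_neg h'] at h
      exact absurd h (by simp)
  · intro h
    have h' : ∃ i, p ∈ S i := ⟨i, h⟩
    rw [dif_pos h']
    congr 1
    by_contra hne
    exact Finset.disjoint_left.mp (hS _ _ hne) h'.choose_spec h

/-- Colourings correspond to tuples of pairwise disjoint sets. Dropping disjointness makes the sum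
over tuples factor. -/
theorem sum_colorings_le (Ψ : (α → Finset ι) → ℝ) (hΨ : ∀ S, 0 ≤ Ψ S) :
    ∑ c : ι → Option α, Ψ (colorClass c) ≤ ∑ S, Ψ S := by
  calc _ = ∑ S ∈ Finset.univ.map ⟨_, colorClass_injective⟩, Ψ S := by rw [Finset.sum_map]; rfl
    _ ≤ _ := Finset.sum_le_sum_of_subset_of_nonneg (Finset.subset_univ _) fun S _ _ => hΨ S

/-- For lower bounds the minorant `Ψ` only has to be nonpositive on tuples that are not disjoint. -/
theorem sum_le_sum_colorings (Ψ : (α → Finset ι) → ℝ)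
    (hΨ : ∀ S, ∀ i i', i ≠ i' → ¬ Disjoint (S i) (S i') → Ψ S ≤ 0) :
    ∑ S, Ψ S ≤ ∑ c : ι → Option α, Ψ (colorClass c) := by
  calc ∑ S, Ψ S ≤ ∑ S ∈ Finset.univ.map ⟨_, colorClass_injective⟩, Ψ S := by
        rw [← Finset.sum_sdiff (Finset.subset_univ
          ((Finset.univ : Finset (ι → Option α)).map ⟨_, colorClass_injective⟩))]
        rw [add_le_iff_nonpos_left]
        refine Finset.sum_nonpos fun S hS => ?_
        by_cases h : ∀ i i', i ≠ i' → Disjoint (S i) (S i')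
        · obtain ⟨c, hc⟩ := exists_colorClass_eq h
          exact absurd (Finset.mem_map.mpr ⟨c, Finset.mem_univ _, hc⟩) (Finset.mem_sdiff.mp hS).2
        · push Not at h
          obtain ⟨i, i', h1, h2⟩ := h
          exact hΨ S i i' h1 h2
    _ = _ := by rw [Finset.sum_map]; rfl

theorem logSum_colorSupport (x : ι → ℝ) (c : ι → Option α) :
    logSum x (colorSupport c) = ∑ i, logSum x (colorClass c i) :=
  (sum_sum_colorClass _ c).symm

theorem invProd_colorSupport (x : ι → ℝ) (c : ι → Option α) :
    invProd x (colorSupport c) = ∏ i, invProd x (colorClass c i) :=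
  (prod_prod_colorClass _ c).symm

theorem invProd_pos {x : ι → ℝ} (hx : ∀ p, 1 < x p) (S : Finset ι) : 0 < invProd x S :=
  Finset.prod_pos fun p _ => one_div_pos.mpr (by linarith [hx p])

theorem logSum_nonneg {x : ι → ℝ} (hx : ∀ p, 1 < x p) (S : Finset ι) : 0 ≤ logSum x S :=
  Finset.sum_nonneg fun p _ => Real.log_nonneg (hx p).le

theorem logSum_mono {x : ι → ℝ} (hx : ∀ p, 1 < x p) {S T : Finset ι} (h : S ⊆ T) :
    logSum x S ≤ logSum x T :=
  Finset.sum_le_sum_of_subset_of_nonneg h fun p _ _ => Real.log_nonneg (hx p).le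

/-- The diagonal variables of the sieve. -/
noncomputable def diagVar (x : ι → ℝ) (ρ : ℝ) (G : ℝ → ℝ) (c : ι → Option α) : ℝ :=
  if logSum x (colorSupport c) ≤ ρ then ∏ i, G (logSum x (colorClass c i)) else 0

theorem diagVar_nonneg (x : ι → ℝ) (ρ : ℝ) {G : ℝ → ℝ} (hG : ∀ u, 0 ≤ G u) (c : ι → Option α) :
    0 ≤ diagVar x ρ G c := by
  unfold diagVar
  split_ifs
  · exact Finset.prod_nonneg fun i _ => hG _
  · exact le_rfl

theorem diagVar_mono {x : ι → ℝ} (hx : ∀ p, 1 < x p) (ρ : ℝ) {G : ℝ → ℝ} (hG : ∀ u, 0 ≤ G u)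
    (hanti : Antitone G) (r s : ι → Option α) (h : ∀ p, s p = none ∨ s p = r p) :
    diagVar x ρ G r ≤ diagVar x ρ G s := by
  have h1 : colorSupport s ⊆ colorSupport r := by
    intro p hp
    rw [mem_colorSupport] at *
    rcases h p with h | h
    · exact absurd h hp
    · rwa [← h]
  have h2 : ∀ i, colorClass s i ⊆ colorClass r i := by
    intro i p hp
    rw [mem_colorClass] at *
    rcases h p with h | h
    · rw [h] at hp; exact absurd hp (by simp)
    · rwa [← h]
  unfold diagVar
  by_cases hr : logSum x (colorSupport r) ≤ ρ
  · rw [if_pos hr, if_pos ((logSum_mono hx h1).trans hr)]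
    exact Finset.prod_le_prod (fun i _ => hG _) fun i _ => hanti (logSum_mono hx (h2 i))
  · rw [if_neg hr]
    exact diagVar_nonneg x ρ hG s

/-- The one-dimensional sum `∑ f(log d) / d`. -/
noncomputable def weightedSum (x : ι → ℝ) (f : ℝ → ℝ) : ℝ :=
  ∑ S : Finset ι, f (logSum x S) * invProd x S

theorem weightedSum_nonneg {x : ι → ℝ} (hx : ∀ p, 1 < x p) {f : ℝ → ℝ} (hf : ∀ u, 0 ≤ u → 0 ≤ f u) :
    0 ≤ weightedSum x f :=
  Finset.sum_nonneg fun S _ => mul_nonneg (hf _ (logSum_nonneg hx S)) (invProd_pos hx S).le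

/-- Both the truncation at `ρ` and the disjointness of the classes are discarded, leaving a product
of independent sums. -/
theorem sum_diagVar_sq_le {x : ι → ℝ} (hx : ∀ p, 1 < x p) (ρ : ℝ) {G : ℝ → ℝ} :
    ∑ c : ι → Option α, diagVar x ρ G c ^ 2 * colorProd (fun p => 1 / x p) c
      ≤ weightedSum x (fun u => G u ^ 2) ^ Fintype.card α := by
  have h1 : weightedSum x (fun u => G u ^ 2) ^ Fintype.card α
      = ∑ S : α → Finset ι, ∏ i, (G (logSum x (S i)) ^ 2 * invProd x (S i)) := by
    rw [sum_pi_prod (fun (_ : α) S => G (logSum x S) ^ 2 * invProd x S)]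
    simp [weightedSum]
  rw [h1]
  refine le_trans (Finset.sum_le_sum fun c _ => ?_)
    (sum_colorings_le _ fun S => Finset.prod_nonneg fun i _ =>
      mul_nonneg (sq_nonneg _) (invProd_pos hx _).le)
  rw [Finset.prod_mul_distrib, ← invProd_colorSupport, colorProd_eq_prod, Finset.prod_pow]
  refine mul_le_mul_of_nonneg_right ?_ (invProd_pos hx _).le
  unfold diagVar
  split_ifs
  · exact le_rfl
  · rw [zero_pow two_ne_zero]; exact sq_nonneg _

theorem sum_colorProd_le {x : ι → ℝ} (hx : ∀ p, 1 < x p) (v : ℝ) :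
    ∑ c : ι → Option α, (if logSum x (colorSupport c) ≤ v then invProd x (colorSupport c) else 0)
      ≤ weightedSum x (fun u => if u ≤ v then 1 else 0) ^ Fintype.card α := by
  have h1 : weightedSum x (fun u => if u ≤ v then 1 else 0) ^ Fintype.card α
      = ∑ S : α → Finset ι, ∏ i, ((if logSum x (S i) ≤ v then 1 else 0) * invProd x (S i)) := by
    rw [sum_pi_prod (fun (_ : α) S => (if logSum x S ≤ v then 1 else 0) * invProd x S)]
    simp [weightedSum]
  rw [h1]
  refine le_trans (Finset.sum_le_sum fun c _ => ?_)
    (sum_colorings_le _ fun S => Finset.prod_nonneg fun i _ =>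
      mul_nonneg (by split_ifs <;> norm_num) (invProd_pos hx _).le)
  rw [Finset.prod_mul_distrib, ← invProd_colorSupport]
  have h0 := (invProd_pos hx (colorSupport c)).le
  split_ifs with h
  · rw [Finset.prod_eq_one, one_mul]
    intro i _
    rw [if_pos]
    refine le_trans (logSum_mono hx ?_) h
    rw [colorSupport_eq_biUnion]
    exact Finset.subset_biUnion_of_mem _ (Finset.mem_univ i)
  · exact mul_nonneg (Finset.prod_nonneg fun i _ => by split_ifs <;> norm_num) h0

/-- Divisibility by `p` costs a factor `1 / p`. -/
theorem sum_mem_le {x : ι → ℝ} (hx : ∀ p, 1 < x p) {f : ℝ → ℝ} (hf : ∀ u, 0 ≤ f u)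
    (hanti : Antitone f) (p : ι) :
    ∑ S : Finset ι with p ∈ S, f (logSum x S) * invProd x S ≤ 1 / x p * weightedSum x f := by
  have hp : 0 < 1 / x p := one_div_pos.mpr (by linarith [hx p])
  calc _ ≤ ∑ S : Finset ι with p ∈ S, 1 / x p * (f (logSum x (S.erase p)) *
          invProd x (S.erase p)) := by
        refine Finset.sum_le_sum fun S hS => ?_
        have hpS : p ∈ S := (Finset.mem_filter.mp hS).2
        have h1 : invProd x S = 1 / x p * invProd x (S.erase p) :=
          (Finset.mul_prod_erase S _ hpS).symm
        rw [h1]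
        have := mul_le_mul_of_nonneg_right
          (hanti (logSum_mono hx (Finset.erase_subset p S))) (invProd_pos hx (S.erase p)).le
        nlinarith
    _ = 1 / x p * ∑ S ∈ (Finset.univ.filter fun S : Finset ι => p ∈ S).image (·.erase p),
          f (logSum x S) * invProd x S := by
        rw [← Finset.mul_sum, Finset.sum_image]
        intro S hS T hT h
        have hS : p ∈ S := by simpa using hS
        have hT : p ∈ T := by simpa using hT
        rw [← Finset.insert_erase hS, ← Finset.insert_erase hT]
        exact congrArg _ h
    _ ≤ _ := mul_le_mul_of_nonneg_left (Finset.sum_le_sum_of_subset_of_nonneg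
        (Finset.subset_univ _) fun S _ _ => mul_nonneg (hf _) (invProd_pos hx S).le) hp.le

/-- Union bound over the elements of `T`, each costing a factor `1 / x p` by `sum_mem_le`. -/
theorem le_sum_disjoint {x : ι → ℝ} (hx : ∀ p, 1 < x p) {f : ℝ → ℝ} (hf : ∀ u, 0 ≤ f u)
    (hanti : Antitone f) (T : Finset ι) :
    weightedSum x f * (1 - ∑ p ∈ T, 1 / x p)
      ≤ ∑ S : Finset ι with Disjoint S T, f (logSum x S) * invProd x S := by
  have h1 := Finset.sum_filter_add_sum_filter_not Finset.univ (fun S : Finset ι => Disjoint S T)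
    (fun S => f (logSum x S) * invProd x S)
  have h2 : ∑ S : Finset ι with ¬ Disjoint S T, f (logSum x S) * invProd x S
      ≤ ∑ p ∈ T, 1 / x p * weightedSum x f := by
    refine le_trans ?_ (Finset.sum_le_sum fun p _ => sum_mem_le hx hf hanti p)
    have hnn : ∀ S : Finset ι, 0 ≤ f (logSum x S) * invProd x S :=
      fun S => mul_nonneg (hf _) (invProd_pos hx S).le
    simp_rw [Finset.sum_filter]
    rw [Finset.sum_comm]
    refine Finset.sum_le_sum fun S _ => ?_
    by_cases h : Disjoint S T
    · rw [if_neg (not_not.mpr h)]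
      exact Finset.sum_nonneg fun a _ => by split_ifs <;> [exact hnn S; exact le_rfl]
    · rw [if_pos h]
      obtain ⟨p, hpS, hpT⟩ := Finset.not_disjoint_iff.mp h
      refine le_trans (by rw [if_pos hpS]) (Finset.single_le_sum
        (f := fun a => if a ∈ S then f (logSum x S) * invProd x S else 0)
        (fun a _ => ?_) hpT)
      split_ifs <;> [exact hnn S; exact le_rfl]
  rw [← Finset.sum_mul] at h2
  unfold weightedSum at *
  nlinarith

/-- Only the colourings obtained from `l` by giving colour `j` to a set `S` disjoint from its
support are kept. Since `G` vanishes beyond `ρ/4` and `l` uses at most `3ρ/4`, the truncation at `ρ`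
never interferes. -/
theorem le_sum_transferMain {x : ι → ℝ} (hx : ∀ p, 1 < x p) {ρ : ℝ} {G : ℝ → ℝ}
    (hG : ∀ u, 0 ≤ G u) (hsupp : ∀ u, ρ / 4 < u → G u = 0) (j : α) (l : ι → Option α)
    (hl : ∀ p, l p ≠ some j) (hlρ : logSum x (colorSupport l) ≤ 3 / 4 * ρ) :
    (∏ i ∈ Finset.univ.erase j, G (logSum x (colorClass l i))) *
        ∑ S : Finset ι with Disjoint S (colorSupport l), G (logSum x S) * invProd x S
      ≤ ∑ r, diagVar x ρ G r * ∏ p, transferMain j (x p) (l p) (r p) := by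
  set e : Finset ι → ι → Option α := fun S p => if p ∈ S then some j else l p with he
  have hclsj : ∀ S, colorClass (e S) j = S := by
    intro S
    ext p
    rw [mem_colorClass]
    simp only [he]
    split_ifs with h
    · simp [h]
    · simp [h, hl p]
  have hcls : ∀ S, Disjoint S (colorSupport l) → ∀ i, i ≠ j →
      colorClass (e S) i = colorClass l i := by
    intro S hS i hi
    ext p
    rw [mem_colorClass, mem_colorClass]
    simp only [he]
    split_ifs with h
    · have := Finset.disjoint_left.mp hS h
      rw [mem_colorSupport, not_not] at this
      simp [this, Ne.symm hi]
    · rfl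
  have hterm : ∀ S, Disjoint S (colorSupport l) →
      (∏ i ∈ Finset.univ.erase j, G (logSum x (colorClass l i))) *
        (G (logSum x S) * invProd x S)
      ≤ diagVar x ρ G (e S) * ∏ p, transferMain j (x p) (l p) (e S p) := by
    intro S hS
    have h1 : ∏ p, transferMain j (x p) (l p) (e S p) = invProd x S := by
      rw [invProd, ← Finset.prod_subset (Finset.subset_univ S)]
      · refine Finset.prod_congr rfl fun p hp => ?_
        have := Finset.disjoint_left.mp hS hp
        rw [mem_colorSupport, not_not] at this
        simp [he, hp, transferMain, this]
      · intro p _ hp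
        simp only [he, hp, if_false, transferMain, if_true]
        split_ifs <;> rfl
    rw [h1, ← mul_assoc]
    refine mul_le_mul_of_nonneg_right ?_ (invProd_pos hx S).le
    have h2 : ∏ i, G (logSum x (colorClass (e S) i))
        = (∏ i ∈ Finset.univ.erase j, G (logSum x (colorClass l i))) * G (logSum x S) := by
      rw [← Finset.mul_prod_erase Finset.univ _ (Finset.mem_univ j), hclsj, mul_comm]
      congr 1
      refine Finset.prod_congr rfl fun i hi => ?_
      rw [hcls S hS i (Finset.ne_of_mem_erase hi)]
    by_cases hS4 : ρ / 4 < logSum x S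
    · rw [hsupp _ hS4, mul_zero]
      exact diagVar_nonneg x ρ hG _
    · unfold diagVar
      rw [if_pos, h2]
      have h3 : colorSupport (e S) ⊆ S ∪ colorSupport l := by
        intro p hp
        rw [mem_colorSupport] at hp
        rw [Finset.mem_union, mem_colorSupport]
        by_cases h : p ∈ S
        · exact Or.inl h
        · right
          simpa [he, h] using hp
      refine (logSum_mono hx h3).trans ?_
      have : logSum x (S ∪ colorSupport l) = logSum x S + logSum x (colorSupport l) :=
        Finset.sum_union hS
      rw [this]
      linarith
  rw [Finset.mul_sum]
  calc _ ≤ ∑ S : Finset ι with Disjoint S (colorSupport l),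
          diagVar x ρ G (e S) * ∏ p, transferMain j (x p) (l p) (e S p) :=
        Finset.sum_le_sum fun S hS => hterm S (Finset.mem_filter.mp hS).2
    _ = ∑ r ∈ (Finset.univ.filter fun S => Disjoint S (colorSupport l)).image e,
          diagVar x ρ G r * ∏ p, transferMain j (x p) (l p) (r p) := by
        rw [Finset.sum_image]
        intro S _ T _ h
        rw [← hclsj S, ← hclsj T, h]
    _ ≤ _ := Finset.sum_le_sum_of_subset_of_nonneg (Finset.subset_univ _) fun r _ _ =>
        mul_nonneg (diagVar_nonneg x ρ hG _) (Finset.prod_nonneg fun p _ =>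
          transferMain_nonneg j (by linarith [hx p]) _ _)

end ColorClasses

/-! ### Moments with respect to product weights. -/

section ProductMeasure

variable {β α : Type*} [Fintype β] [DecidableEq β] [Fintype α] [DecidableEq α]

theorem sum_prod_mul_coord_le (w : α → β → ℝ) (f : β → ℝ) (b : ℝ) (i₀ : α)
    (h : ∑ t, w i₀ t * f t ≤ b * ∑ t, w i₀ t) (hw : ∀ i t, 0 ≤ w i t) :
    ∑ S : α → β, (∏ i, w i (S i)) * f (S i₀) ≤ b * ∏ i, ∑ t, w i t := by
  have h1 : ∀ S : α → β, (∏ i, w i (S i)) * f (S i₀)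
      = ∏ i, w i (S i) * (if i = i₀ then f (S i) else 1) := by
    intro S
    rw [Finset.prod_mul_distrib]
    simp
  simp_rw [h1]
  rw [sum_pi_prod (fun i t => w i t * (if i = i₀ then f t else 1)),
    ← Finset.mul_prod_erase _ _ (Finset.mem_univ i₀),
    ← Finset.mul_prod_erase Finset.univ (fun i => ∑ t, w i t) (Finset.mem_univ i₀), ← mul_assoc]
  have h2 : ∏ i ∈ Finset.univ.erase i₀, ∑ t, w i t * (if i = i₀ then f t else 1)
      = ∏ i ∈ Finset.univ.erase i₀, ∑ t, w i t := by
    refine Finset.prod_congr rfl fun i hi => Finset.sum_congr rfl fun t _ => ?_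
    rw [if_neg (Finset.ne_of_mem_erase hi), mul_one]
  rw [h2]
  refine mul_le_mul_of_nonneg_right ?_
    (Finset.prod_nonneg fun i _ => Finset.sum_nonneg fun t _ => hw i t)
  simpa using h

/-- The one-coordinate bound is applied twice, first with the factor `f (S i₀)` absorbed into the
weight. -/
theorem sum_prod_mul_two_coord_le (w : α → β → ℝ) (f : β → ℝ) (hf : ∀ t, 0 ≤ f t) (b : ℝ)
    (hb : 0 ≤ b) (i₀ i₁ : α) (hne : i₀ ≠ i₁)
    (h : ∀ i, ∑ t, w i t * f t ≤ b * ∑ t, w i t) (hw : ∀ i t, 0 ≤ w i t) :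
    ∑ S : α → β, (∏ i, w i (S i)) * (f (S i₀) * f (S i₁)) ≤ b ^ 2 * ∏ i, ∑ t, w i t := by
  set w' : α → β → ℝ := fun i t => w i t * (if i = i₀ then f t else 1) with hw'
  have hw'0 : ∀ i t, 0 ≤ w' i t := by
    intro i t
    simp only [hw']
    split_ifs
    · exact mul_nonneg (hw i t) (hf t)
    · simpa using hw i t
  have h1 : ∀ S : α → β, (∏ i, w i (S i)) * (f (S i₀) * f (S i₁))
      = (∏ i, w' i (S i)) * f (S i₁) := by
    intro S
    simp only [hw']
    rw [Finset.prod_mul_distrib]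
    simp
    ring
  simp_rw [h1]
  have h2 := sum_prod_mul_coord_le w' f b i₁ (by simpa [hw', hne.symm] using h i₁) hw'0
  refine h2.trans ?_
  rw [sq, mul_assoc]
  refine mul_le_mul_of_nonneg_left ?_ hb
  rw [← sum_pi_prod w']
  refine le_trans (le_of_eq ?_) (sum_prod_mul_coord_le w f b i₀ (h i₀) hw)
  refine Finset.sum_congr rfl fun S _ => ?_
  simp only [hw']
  rw [Finset.prod_mul_distrib]
  simp

end ProductMeasure

/-! ### Lower bound for the form weighted by primes. -/

section PrimeForm

variable {ι α : Type*} [Fintype ι] [DecidableEq ι] [Fintype α] [DecidableEq α]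

/-- The weights of the product measure on tuples of sets whose `j`-th set is empty. -/
noncomputable def tupleWeight (x : ι → ℝ) (G : ℝ → ℝ) (j i : α) (S : Finset ι) : ℝ :=
  if i = j then (if S = ∅ then 1 else 0) else G (logSum x S) ^ 2 * invProd x S

theorem tupleWeight_nonneg {x : ι → ℝ} (hx : ∀ p, 1 < x p) (G : ℝ → ℝ) (j i : α) (S : Finset ι) :
    0 ≤ tupleWeight x G j i S := by
  unfold tupleWeight
  split_ifs
  · exact zero_le_one
  · exact le_rfl
  · exact mul_nonneg (sq_nonneg _) (invProd_pos hx S).le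

theorem sum_tupleWeight_mul (x : ι → ℝ) (G : ℝ → ℝ) (j i : α) (f : Finset ι → ℝ) :
    ∑ S, tupleWeight x G j i S * f S
      = if i = j then f ∅ else ∑ S, G (logSum x S) ^ 2 * invProd x S * f S := by
  unfold tupleWeight
  split_ifs with h
  · simp
  · rfl

theorem prod_sum_tupleWeight (x : ι → ℝ) (G : ℝ → ℝ) (j : α) :
    ∏ i, ∑ S, tupleWeight x G j i S
      = weightedSum x (fun u => G u ^ 2) ^ (Fintype.card α - 1) := by
  rw [← Finset.mul_prod_erase _ _ (Finset.mem_univ j)]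
  have h1 : ∑ S, tupleWeight x G j j S = 1 := by simp [tupleWeight]
  have h2 : ∏ i ∈ Finset.univ.erase j, ∑ S, tupleWeight x G j i S
      = ∏ _i ∈ Finset.univ.erase j, weightedSum x (fun u => G u ^ 2) := by
    refine Finset.prod_congr rfl fun i hi => Finset.sum_congr rfl fun S _ => ?_
    simp [tupleWeight, Finset.ne_of_mem_erase hi]
  rw [h1, h2, Finset.prod_const, one_mul, Finset.card_erase_of_mem (Finset.mem_univ j),
    Finset.card_univ]

theorem sum_tupleWeight_mem_le {x : ι → ℝ} (hx : ∀ p, 1 < x p) {G : ℝ → ℝ} (hG : ∀ u, 0 ≤ G u)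
    (hanti : Antitone G) (j i : α) (p : ι) :
    ∑ S, tupleWeight x G j i S * (if p ∈ S then 1 else 0)
      ≤ 1 / x p * ∑ S, tupleWeight x G j i S := by
  have hp : 0 < 1 / x p := one_div_pos.mpr (by linarith [hx p])
  rw [sum_tupleWeight_mul]
  split_ifs with h h'
  · simp at h'
  · exact mul_nonneg hp.le (Finset.sum_nonneg fun S _ => tupleWeight_nonneg hx G j i S)
  · have h1 := sum_mem_le hx (f := fun u => G u ^ 2) (fun u => sq_nonneg _)
      (fun a b hab => pow_le_pow_left₀ (hG b) (hanti hab) 2) p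
    rw [Finset.sum_filter] at h1
    simp only [mul_ite, mul_one, mul_zero]
    refine h1.trans (le_of_eq ?_)
    simp [weightedSum, tupleWeight, h]

/-- The defect of a tuple of sets: it bounds the loss from non-disjointness, from the arithmetic
weights, and from the truncation. -/
noncomputable def tupleDefect (x : ι → ℝ) (ρ : ℝ) (S : α → Finset ι) : ℝ :=
  (∑ i, ((Fintype.card α + 2 : ℝ) * ∑ p ∈ S i, 1 / x p + logSum x (S i) / (3 / 4 * ρ)))
    + ∑ i, ∑ i', if i = i' then 0 else
      ∑ p, (if p ∈ S i then (1 : ℝ) else 0) * (if p ∈ S i' then 1 else 0)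

/-- A first-moment bound: each summand of the defect depends on one or two coordinates. A prime lies
in a given set with relative weight at most `1 / x p`, so `∑ 1/p²` appears; the logarithmic part has
mean at most `m/(3ρ/4)` in each coordinate. -/
theorem sum_tupleWeight_mul_defect_le {x : ι → ℝ} (hx : ∀ p, 1 < x p) {ρ : ℝ} (hρ : 0 < ρ)
    {G : ℝ → ℝ} (hG : ∀ u, 0 ≤ G u) (hanti : Antitone G) (j : α) {m : ℝ}
    (hm0 : 0 ≤ m)
    (hm : weightedSum x (fun u => u * G u ^ 2) ≤ m * weightedSum x (fun u => G u ^ 2)) :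
    ∑ S : α → Finset ι, (∏ i, tupleWeight x G j i (S i)) * tupleDefect x ρ S
      ≤ (Fintype.card α * ((Fintype.card α + 2) * (∑ p, (1 / x p) ^ 2) + m / (3 / 4 * ρ))
          + Fintype.card α ^ 2 * ∑ p, (1 / x p) ^ 2) *
        weightedSum x (fun u => G u ^ 2) ^ (Fintype.card α - 1) := by
  rw [← prod_sum_tupleWeight x G j]
  set Pr := ∏ i, ∑ S, tupleWeight x G j i S with hPr
  set σ := ∑ p, (1 / x p) ^ 2 with hσ
  have hσ0 : 0 ≤ σ := Finset.sum_nonneg fun p _ => sq_nonneg _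
  have hw := tupleWeight_nonneg hx G j
  have hPr0 : 0 ≤ Pr := Finset.prod_nonneg fun i _ => Finset.sum_nonneg fun t _ => hw i t
  have hinv : ∀ p, 0 < 1 / x p := fun p => one_div_pos.mpr (by linarith [hx p])
  have hone : ∀ i, ∑ S : α → Finset ι, (∏ i, tupleWeight x G j i (S i)) *
      ((Fintype.card α + 2 : ℝ) * ∑ p ∈ S i, 1 / x p + logSum x (S i) / (3 / 4 * ρ))
      ≤ ((Fintype.card α + 2) * σ + m / (3 / 4 * ρ)) * Pr := by
    intro i
    refine sum_prod_mul_coord_le (tupleWeight x G j) (fun T => (Fintype.card α + 2 : ℝ) *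
      ∑ p ∈ T, 1 / x p + logSum x T / (3 / 4 * ρ))
      ((Fintype.card α + 2) * σ + m / (3 / 4 * ρ)) i ?_ hw
    have hm0 : 0 ≤ ∑ t, tupleWeight x G j i t := Finset.sum_nonneg fun t _ => hw i t
    have h1 : ∑ T, tupleWeight x G j i T * ∑ p ∈ T, 1 / x p
        ≤ σ * ∑ t, tupleWeight x G j i t := by
      have : ∀ T, tupleWeight x G j i T * ∑ p ∈ T, 1 / x p
          = ∑ p, 1 / x p * (tupleWeight x G j i T * if p ∈ T then 1 else 0) := by
        intro T
        rw [← Finset.sum_filter_add_sum_filter_not Finset.univ (fun p => p ∈ T),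
          Finset.mul_sum]
        rw [Finset.sum_eq_zero (s := Finset.univ.filter fun p => ¬ p ∈ T), add_zero]
        · have hT : (Finset.univ.filter fun p => p ∈ T) = T := by ext; simp
          rw [hT]
          refine Finset.sum_congr rfl fun p hp => ?_
          rw [if_pos hp]; ring
        · intro p hp
          rw [if_neg (Finset.mem_filter.mp hp).2]; ring
      simp_rw [this]
      rw [Finset.sum_comm, hσ, Finset.sum_mul]
      refine Finset.sum_le_sum fun p _ => ?_
      rw [← Finset.mul_sum, sq, mul_assoc]
      exact mul_le_mul_of_nonneg_left (sum_tupleWeight_mem_le hx hG hanti j i p) (hinv p).le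
    have h2 : ∑ T, tupleWeight x G j i T * logSum x T ≤ m * ∑ t, tupleWeight x G j i t := by
      rw [sum_tupleWeight_mul]
      split_ifs with h
      · rw [show logSum x (∅ : Finset ι) = 0 by simp [logSum]]
        positivity
      · have e1 : ∑ S, G (logSum x S) ^ 2 * invProd x S * logSum x S
            = weightedSum x (fun u => u * G u ^ 2) :=
          Finset.sum_congr rfl fun S _ => by ring
        have e2 : ∑ t, tupleWeight x G j i t = weightedSum x (fun u => G u ^ 2) :=
          Finset.sum_congr rfl fun S _ => by simp [tupleWeight, h]
        rw [e1, e2]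
        exact hm
    have h3 : ∀ T, tupleWeight x G j i T * ((Fintype.card α + 2 : ℝ) *
        ∑ p ∈ T, 1 / x p + logSum x T / (3 / 4 * ρ))
        = (Fintype.card α + 2 : ℝ) * (tupleWeight x G j i T * ∑ p ∈ T, 1 / x p)
          + 1 / (3 / 4 * ρ) * (tupleWeight x G j i T * logSum x T) := by
      intro T; ring
    simp_rw [h3]
    rw [Finset.sum_add_distrib, ← Finset.mul_sum, ← Finset.mul_sum]
    have h4 := mul_le_mul_of_nonneg_left h1 (show (0 : ℝ) ≤ Fintype.card α + 2 by positivity)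
    have h5 := mul_le_mul_of_nonneg_left h2 (show (0 : ℝ) ≤ 1 / (3 / 4 * ρ) by positivity)
    exact (add_le_add h4 h5).trans (le_of_eq (by ring))
  have htwo : ∀ i i', ∑ S : α → Finset ι, (∏ i, tupleWeight x G j i (S i)) *
      (if i = i' then 0 else
        ∑ p, (if p ∈ S i then (1 : ℝ) else 0) * (if p ∈ S i' then 1 else 0)) ≤ σ * Pr := by
    intro i i'
    by_cases h : i = i'
    · simp only [h, if_true, mul_zero, Finset.sum_const_zero]
      positivity
    · simp only [h, if_false, Finset.mul_sum]
      rw [Finset.sum_comm, hσ, Finset.sum_mul]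
      refine Finset.sum_le_sum fun p _ => ?_
      exact sum_prod_mul_two_coord_le (tupleWeight x G j) (fun T => if p ∈ T then 1 else 0)
        (fun T => by split_ifs <;> norm_num) _ (hinv p).le i i' h
        (fun i => sum_tupleWeight_mem_le hx hG hanti j i p) hw
  unfold tupleDefect
  refine le_trans (le_of_eq (Finset.sum_congr rfl fun S _ => mul_add _ _ _)) ?_
  rw [Finset.sum_add_distrib, add_mul]
  refine add_le_add ?_ ?_
  · simp_rw [Finset.mul_sum (s := (Finset.univ : Finset α))]
    rw [Finset.sum_comm]
    refine (Finset.sum_le_sum fun i _ => hone i).trans (le_of_eq ?_)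
    simp
    ring
  · simp_rw [Finset.mul_sum (s := (Finset.univ : Finset α))]
    rw [Finset.sum_comm]
    have : ∀ i : α, ∑ S : α → Finset ι, ∑ i', (∏ i, tupleWeight x G j i (S i)) *
      (if i = i' then 0 else
        ∑ p, (if p ∈ S i then (1 : ℝ) else 0) * (if p ∈ S i' then 1 else 0))
        ≤ ∑ _i' : α, σ * Pr := by
      intro i
      rw [Finset.sum_comm]
      exact Finset.sum_le_sum fun i' _ => htwo i i'
    refine (Finset.sum_le_sum fun i _ => this i).trans (le_of_eq ?_)
    simp
    ring

theorem one_sub_mul_sum_le_prod {s : Finset ι} {a : ι → ℝ} (h0 : ∀ p, 0 ≤ a p)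
    (h1 : ∀ p, a p ≤ 1) : 1 - ∑ p ∈ s, a p ≤ ∏ p ∈ s, (1 - a p) := by
  induction s using Finset.induction_on with
  | empty => simp
  | insert p s hp ih =>
    rw [Finset.sum_insert hp, Finset.prod_insert hp]
    have h2 : ∏ p ∈ s, (1 - a p) ≤ 1 :=
      Finset.prod_le_one (fun q _ => by linarith [h1 q]) fun q _ => by linarith [h0 q]
    nlinarith [h0 p, h1 p]

/-- The function `t ↦ (t - k)/t²` is decreasing for `t ≥ 2k`, and `x - 1 ≥ 2k`. -/
theorem le_local_density {k x : ℝ} (hk : 0 ≤ k) (hx : 2 * k + 1 ≤ x) (hx1 : 1 < x) :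
    1 / x * (1 - k * (1 / x)) ≤ 1 / (x - 1) - k / (x - 1) ^ 2 := by
  have h1 : 0 < x - 1 := by linarith
  have h0 : 0 < x := by linarith
  have e1 : 1 / x * (1 - k * (1 / x)) = (x - k) / x ^ 2 := by field_simp
  have e2 : 1 / (x - 1) - k / (x - 1) ^ 2 = (x - 1 - k) / (x - 1) ^ 2 := by field_simp
  rw [e1, e2, div_le_div_iff₀ (by positivity) (by positivity)]
  nlinarith

/-- Lower bound for the sieve form weighted by the primes at `n + h_j`. -/
theorem le_primeForm {x : ι → ℝ} (hx : ∀ p, 1 < x p)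
    (hxk : ∀ p, 2 * (Fintype.card α : ℝ) + 1 ≤ x p) {ρ : ℝ} (hρ : 0 < ρ) {G : ℝ → ℝ}
    (hG : ∀ u, 0 ≤ G u) (hanti : Antitone G) (hsupp : ∀ u, ρ / 4 < u → G u = 0) (j : α)
    {m : ℝ} (hm0 : 0 ≤ m)
    (hm : weightedSum x (fun u => u * G u ^ 2) ≤ m * weightedSum x (fun u => G u ^ 2))
    {η : ℝ} (hη0 : 0 ≤ η)
    (hη : η ≤ 2 - ∏ p, (1 + Fintype.card α * (1 / (x p - 1) - 1 / x p))) :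
    weightedSum x (fun u => G u ^ 2) ^ (Fintype.card α - 1) * (η * weightedSum x G) ^ 2 *
      (1 - (Fintype.card α * ((Fintype.card α + 2) * (∑ p, (1 / x p) ^ 2) + m / (3 / 4 * ρ))
          + Fintype.card α ^ 2 * ∑ p, (1 / x p) ^ 2))
      ≤ tensorForm (fun p => compatDensity (x p - 1))
          (fun c : ι → Option α => if ∀ p, c p ≠ some j then sieveWeight x (diagVar x ρ G) c else 0) := by
  set k : ℝ := (Fintype.card α : ℝ) with hk
  have hk0 : 0 ≤ k := Nat.cast_nonneg _
  have hinv : ∀ p, 0 < 1 / x p := fun p => one_div_pos.mpr (by linarith [hx p])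
  have hdens : ∀ p, 0 ≤ 1 / x p * (1 - k * (1 / x p)) := by
    intro p
    refine mul_nonneg (hinv p).le ?_
    have h0 : 0 < x p := by linarith [hx p]
    rw [sub_nonneg, mul_one_div, div_le_one h0]
    linarith [hxk p]
  have hdens' : ∀ p, 0 ≤ 1 / (x p - 1) - k / (x p - 1) ^ 2 := fun p =>
    (hdens p).trans (le_local_density hk0 (hxk p) (hx p))
  refine le_trans ?_ (le_tensorForm_compatDensity (fun p => x p - 1)
    (fun p => by linarith [hx p]) (fun p => by linarith [hxk p]) _)
  -- A minorant defined on all tuples: it factors up to the defect, and is nonpositive whenever the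
  -- defect is at least 1, in particular for tuples that are not disjoint.
  set Ψ : (α → Finset ι) → ℝ := fun S =>
    (∏ i, tupleWeight x G j i (S i)) * ((η * weightedSum x G) ^ 2 * (1 - tupleDefect x ρ S)) with hΨ
  have hwnn : ∀ S : α → Finset ι, 0 ≤ ∏ i, tupleWeight x G j i (S i) :=
    fun S => Finset.prod_nonneg fun i _ => tupleWeight_nonneg hx G j i _
  have hΨneg : ∀ S, 1 ≤ tupleDefect x ρ S → Ψ S ≤ 0 := fun S hS =>
    mul_nonpos_of_nonneg_of_nonpos (hwnn S)
      (mul_nonpos_of_nonneg_of_nonpos (sq_nonneg _) (by linarith))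
  calc _ ≤ ∑ S, Ψ S := by
        simp only [hΨ]
        have h1 : ∀ S : α → Finset ι, (∏ i, tupleWeight x G j i (S i)) *
            ((η * weightedSum x G) ^ 2 * (1 - tupleDefect x ρ S))
            = (η * weightedSum x G) ^ 2 * ((∏ i, tupleWeight x G j i (S i)) -
              (∏ i, tupleWeight x G j i (S i)) * tupleDefect x ρ S) := fun S => by ring
        simp_rw [h1]
        rw [← Finset.mul_sum, Finset.sum_sub_distrib, sum_pi_prod, prod_sum_tupleWeight]
        have h2 := sum_tupleWeight_mul_defect_le hx hρ hG hanti j hm0 hm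
        have h3 := mul_le_mul_of_nonneg_left h2 (sq_nonneg (η * weightedSum x G))
        refine le_trans (le_of_eq ?_)
          ((sub_le_sub_left h3 _).trans (le_of_eq (mul_sub _ _ _).symm))
        ring
    _ ≤ ∑ l : ι → Option α, Ψ (colorClass l) := by
        refine sum_le_sum_colorings Ψ fun S i i' hii hnd => hΨneg S ?_
        obtain ⟨p, hp, hp'⟩ := Finset.not_disjoint_iff.mp hnd
        have hA : 0 ≤ ∑ i, ((Fintype.card α + 2 : ℝ) * ∑ p ∈ S i, 1 / x p +
            logSum x (S i) / (3 / 4 * ρ)) :=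
          Finset.sum_nonneg fun i _ => add_nonneg (mul_nonneg (by positivity)
            (Finset.sum_nonneg fun p _ => (hinv p).le))
            (div_nonneg (logSum_nonneg hx _) (by positivity))
        have hnn : ∀ a b : α, 0 ≤ (if a = b then (0 : ℝ) else
            ∑ p, (if p ∈ S a then (1 : ℝ) else 0) * (if p ∈ S b then 1 else 0)) := by
          intro a b
          split_ifs
          · exact le_rfl
          · exact Finset.sum_nonneg fun p _ => by split_ifs <;> norm_num
        have hB : 1 ≤ ∑ a, ∑ b, (if a = b then (0 : ℝ) else
            ∑ p, (if p ∈ S a then (1 : ℝ) else 0) * (if p ∈ S b then 1 else 0)) := by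
          refine le_trans ?_ (Finset.single_le_sum (fun a _ => Finset.sum_nonneg fun b _ => hnn a b)
            (Finset.mem_univ i))
          refine le_trans ?_ (Finset.single_le_sum (fun b _ => hnn i b) (Finset.mem_univ i'))
          rw [if_neg hii]
          refine le_trans ?_ (Finset.single_le_sum (fun p _ => ?_) (Finset.mem_univ p))
          · simp [hp, hp']
          · split_ifs <;> norm_num
        unfold tupleDefect
        linarith
    _ ≤ _ := by
        refine Finset.sum_le_sum fun l _ => ?_
        have hrhs : 0 ≤ colorProd (fun p => 1 / (x p - 1) - k / (x p - 1) ^ 2) l *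
            (∑ c : ι → Option α, (if ∀ p, c p ≠ some j then
              sieveWeight x (diagVar x ρ G) c else 0) *
              ∏ p, diagVec (x p - 1) (l p) (c p)) ^ 2 := by
          refine mul_nonneg ?_ (sq_nonneg _)
          rw [colorProd_eq_prod]
          exact Finset.prod_nonneg fun p _ => hdens' p
        by_cases hlj : ∀ p, l p ≠ some j
        swap
        · push Not at hlj
          obtain ⟨p, hp⟩ := hlj
          have : ∏ i, tupleWeight x G j i (colorClass l i) = 0 := by
            refine Finset.prod_eq_zero (Finset.mem_univ j) ?_
            have : colorClass l j ≠ ∅ :=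
              Finset.ne_empty_of_mem (mem_colorClass.mpr hp)
            simp [tupleWeight, this]
          simp only [hΨ, this, zero_mul]
          exact hrhs
        have hempty : colorClass l j = ∅ := by
          ext p; simp [mem_colorClass, hlj p]
        set s := ∑ p ∈ colorSupport l, 1 / x p with hs
        have hs0 : 0 ≤ s := Finset.sum_nonneg fun p _ => (hinv p).le
        have hdef : (k + 2) * s + logSum x (colorSupport l) / (3 / 4 * ρ)
            ≤ tupleDefect x ρ (colorClass l) := by
          unfold tupleDefect
          rw [Finset.sum_add_distrib, ← Finset.mul_sum, sum_sum_colorClass, ← Finset.sum_div,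
            ← logSum_colorSupport]
          refine le_add_of_nonneg_right (Finset.sum_nonneg fun a _ => Finset.sum_nonneg
            fun b _ => ?_)
          split_ifs
          · exact le_rfl
          · exact Finset.sum_nonneg fun p _ => by split_ifs <;> norm_num
        have hlog0 : 0 ≤ logSum x (colorSupport l) / (3 / 4 * ρ) :=
          div_nonneg (logSum_nonneg hx _) (by positivity)
        -- Colourings with a large defect cost nothing. A defect below 1 forces both the truncation
        -- bound `3ρ/4` and `(k + 2) s < 1`.
        by_cases hbad : 1 ≤ tupleDefect x ρ (colorClass l)
        · exact (hΨneg _ hbad).trans hrhs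
        push Not at hbad
        have hlρ : logSum x (colorSupport l) ≤ 3 / 4 * ρ := by
          have h1 : logSum x (colorSupport l) / (3 / 4 * ρ) < 1 := by
            have : 0 ≤ (k + 2) * s := by positivity
            linarith
          exact ((div_lt_one (by positivity)).mp h1).le
        have hs1 : (k + 2) * s < 1 := by linarith
        rw [sq_sum_restrict_sieveWeight j x _ l hlj]
        set Y := weightedSum x G with hY
        have hY0 : 0 ≤ Y := weightedSum_nonneg hx fun u _ => hG u
        set g := ∏ i ∈ Finset.univ.erase j, G (logSum x (colorClass l i)) with hg
        have hg0 : 0 ≤ g := Finset.prod_nonneg fun i _ => hG _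
        have hz : η * (g * (Y * (1 - s)))
            ≤ ∑ r, diagVar x ρ G r * ∏ p, transferFactor j (x p) (l p) (r p) := by
          have h1 := le_sum_disjoint hx hG hanti (colorSupport l)
          have h2 := le_sum_transferMain hx hG hsupp j l hlj hlρ
          have h3 := mul_sum_transferMain_le j x hx (diagVar x ρ G)
            (fun r => diagVar_nonneg x ρ hG r) (fun r s h => diagVar_mono hx ρ hG hanti r s h) l
          refine le_trans ?_ h3
          have h4 : g * (Y * (1 - s))
              ≤ ∑ r, diagVar x ρ G r * ∏ p, transferMain j (x p) (l p) (r p) :=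
            (mul_le_mul_of_nonneg_left h1 hg0).trans h2
          have h5 : 0 ≤ g * (Y * (1 - s)) :=
            mul_nonneg hg0 (mul_nonneg hY0 (by nlinarith))
          exact mul_le_mul hη h4 h5 (hη0.trans hη)
        have hz0 : 0 ≤ η * (g * (Y * (1 - s))) :=
          mul_nonneg hη0 (mul_nonneg hg0 (mul_nonneg hY0 (by nlinarith)))
        have hz2 := pow_le_pow_left₀ hz0 hz 2
        set a := invProd x (colorSupport l) with ha
        have ha0 : 0 < a := invProd_pos hx _
        have hc : a * (1 - k * s) ≤ colorProd (fun p => 1 / (x p - 1) - k / (x p - 1) ^ 2) l := by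
          rw [colorProd_eq_prod]
          refine le_trans ?_ (Finset.prod_le_prod (fun p _ => hdens p)
            fun p _ => le_local_density hk0 (hxk p) (hx p))
          rw [Finset.prod_mul_distrib]
          refine mul_le_mul_of_nonneg_left ?_ ha0.le
          rw [hs, Finset.mul_sum]
          refine one_sub_mul_sum_le_prod (fun p => mul_nonneg hk0 (hinv p).le) fun p => ?_
          have h0 : 0 < x p := by linarith [hx p]
          rw [mul_one_div, div_le_one h0]
          linarith [hxk p]
        have hw : ∏ i, tupleWeight x G j i (colorClass l i) = a * g ^ 2 := by
          rw [ha, invProd_colorSupport, ← Finset.mul_prod_erase _ _ (Finset.mem_univ j),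
            ← Finset.mul_prod_erase Finset.univ (fun i => invProd x (colorClass l i))
              (Finset.mem_univ j), hempty, hg, ← Finset.prod_pow]
          have h1 : invProd x (∅ : Finset ι) = 1 := by simp [invProd]
          have h2 : tupleWeight x G j j ∅ = 1 := by simp [tupleWeight]
          rw [h1, h2, one_mul, one_mul, ← Finset.prod_mul_distrib]
          refine Finset.prod_congr rfl fun i hi => ?_
          simp only [tupleWeight, Finset.ne_of_mem_erase hi, if_false]
          ring
        have hks : 0 ≤ 1 - k * s := by nlinarith
        calc Ψ (colorClass l)
            ≤ a * g ^ 2 * ((η * Y) ^ 2 * (1 - (k + 2) * s)) := by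
              simp only [hΨ, hw]
              refine mul_le_mul_of_nonneg_left ?_ (by positivity)
              refine mul_le_mul_of_nonneg_left ?_ (sq_nonneg _)
              linarith
          _ ≤ a * g ^ 2 * ((η * Y) ^ 2 * ((1 - k * s) * (1 - s) ^ 2)) := by
              refine mul_le_mul_of_nonneg_left ?_ (by positivity)
              refine mul_le_mul_of_nonneg_left ?_ (sq_nonneg _)
              -- The coefficient `k + 2` in the defect comes from here: `1 - ks` is the loss in the
              -- local densities and `(1 - s)²` the loss from disjointness, squared.
              have h1 : 1 - 2 * s ≤ (1 - s) ^ 2 := by nlinarith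
              have h2 := mul_le_mul_of_nonneg_left h1 hks
              nlinarith [mul_nonneg hk0 (sq_nonneg s)]
          _ = (a * (1 - k * s)) * (η * (g * (Y * (1 - s)))) ^ 2 := by ring
          _ ≤ _ := mul_le_mul hc hz2 (sq_nonneg _) (le_trans (by positivity) hc)

end PrimeForm

/-! ### Harmonic sums over integers coprime to `W`. -/

section CoprimeHarmonic

/-- The sum of `1 / s` over the `s ≤ n` that are coprime to `W`. -/
noncomputable def coprimeHarmonic (W n : ℕ) : ℝ :=
  ∑ s ∈ (Finset.Icc 1 n).filter W.Coprime, (1 / s : ℝ)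

theorem sum_Ico_block_le {W q : ℕ} (hW : 0 < W) (hq : 0 < q) :
    ∑ s ∈ (Finset.Ico (q * W) (q * W + W)).filter W.Coprime, (1 / s : ℝ)
      ≤ W.totient / W * (1 / q) := by
  have h : ∀ s ∈ (Finset.Ico (q * W) (q * W + W)).filter W.Coprime, (1 / s : ℝ) ≤ 1 / (q * W) := by
    intro s hs
    have := (Finset.mem_Ico.mp (Finset.mem_filter.mp hs).1).1
    refine one_div_le_one_div_of_le (by positivity) (by exact_mod_cast this)
  refine (Finset.sum_le_card_nsmul _ _ _ h).trans (le_of_eq ?_)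
  rw [Nat.filter_coprime_Ico_eq_totient, nsmul_eq_mul]
  field_simp

theorem le_sum_Ico_block {W q : ℕ} (hW : 0 < W) (hq : 0 < q) :
    W.totient / W * (1 / (q + 1 : ℝ))
      ≤ ∑ s ∈ (Finset.Ico (q * W) (q * W + W)).filter W.Coprime, (1 / s : ℝ) := by
  have h : ∀ s ∈ (Finset.Ico (q * W) (q * W + W)).filter W.Coprime,
      1 / ((q + 1) * W : ℝ) ≤ (1 / s : ℝ) := by
    intro s hs
    have h1 := Finset.mem_Ico.mp (Finset.mem_filter.mp hs).1
    have h0 : 0 < q * W := Nat.mul_pos hq hW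
    refine one_div_le_one_div_of_le (by exact_mod_cast h0.trans_le h1.1) ?_
    have : s ≤ (q + 1) * W := by rw [add_mul, one_mul]; exact h1.2.le
    exact_mod_cast this
  refine le_trans (le_of_eq ?_) (Finset.card_nsmul_le_sum _ _ _ h)
  rw [Nat.filter_coprime_Ico_eq_totient, nsmul_eq_mul]
  field_simp

/-- Each block of `W` consecutive integers has `φ(W)` members coprime to `W`, and `1/s` is nearly
constant on the block. -/
theorem sum_Ico_coprime_bounds {W : ℕ} (hW : 0 < W) (m : ℕ) :
    ∑ s ∈ (Finset.Ico W ((m + 1) * W)).filter W.Coprime, (1 / s : ℝ)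
        ≤ W.totient / W * (harmonic m : ℝ) ∧
      W.totient / W * ((harmonic (m + 1) : ℝ) - 1)
        ≤ ∑ s ∈ (Finset.Ico W ((m + 1) * W)).filter W.Coprime, (1 / s : ℝ) := by
  induction m with
  | zero => simp [harmonic]
  | succ m ih =>
    have h1 : Finset.Ico W ((m + 1 + 1) * W)
        = Finset.Ico W ((m + 1) * W) ∪ Finset.Ico ((m + 1) * W) ((m + 1) * W + W) := by
      rw [Finset.Ico_union_Ico_eq_Ico (by nlinarith) (by omega)]
      congr 1
      ring
    have h2 : ∑ s ∈ (Finset.Ico W ((m + 1 + 1) * W)).filter W.Coprime, (1 / s : ℝ)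
        = ∑ s ∈ (Finset.Ico W ((m + 1) * W)).filter W.Coprime, (1 / s : ℝ) +
          ∑ s ∈ (Finset.Ico ((m + 1) * W) ((m + 1) * W + W)).filter W.Coprime, (1 / s : ℝ) := by
      rw [h1, Finset.filter_union, Finset.sum_union]
      exact Finset.disjoint_filter_filter (Finset.Ico_disjoint_Ico_consecutive _ _ _)
    have h3 := sum_Ico_block_le hW (Nat.succ_pos m)
    have h4 := le_sum_Ico_block hW (Nat.succ_pos m)
    rw [h2, harmonic_succ, harmonic_succ (m + 1)]
    simp only [Nat.succ_eq_add_one] at h3 h4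
    push_cast at *
    constructor
    · rw [mul_add, ← one_div]; linarith [ih.1]
    · rw [← one_div, add_sub_right_comm, mul_add]; linarith [ih.2]

theorem totient_div_le_one (W : ℕ) : (W.totient / W : ℝ) ≤ 1 :=
  div_le_one_of_le₀ (by exact_mod_cast Nat.totient_le W) (Nat.cast_nonneg W)

theorem coprimeHarmonic_le {W : ℕ} (hW : 0 < W) {n : ℕ} {v : ℝ} (hv : 0 ≤ v)
    (hn : (n : ℝ) ≤ Real.exp v) : coprimeHarmonic W n ≤ W.totient / W * v + (W + 1) := by
  set m := n / W
  have hκ0 : (0 : ℝ) ≤ W.totient / W := by positivity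
  have hmn : n < (m + 1) * W := by
    rw [mul_comm]; exact Nat.lt_mul_div_succ n hW
  have h1 : coprimeHarmonic W n ≤ ∑ s ∈ (Finset.Ico 1 W).filter W.Coprime, (1 / s : ℝ) +
      ∑ s ∈ (Finset.Ico W ((m + 1) * W)).filter W.Coprime, (1 / s : ℝ) := by
    rw [← Finset.sum_union (Finset.disjoint_filter_filter
      (Finset.Ico_disjoint_Ico_consecutive _ _ _)), ← Finset.filter_union,
      Finset.Ico_union_Ico_eq_Ico hW (by nlinarith)]
    refine Finset.sum_le_sum_of_subset_of_nonneg (Finset.filter_subset_filter _ fun s hs => ?_)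
      fun s _ _ => by positivity
    rw [Finset.mem_Icc] at hs
    rw [Finset.mem_Ico]
    omega
  have h2 : ∑ s ∈ (Finset.Ico 1 W).filter W.Coprime, (1 / s : ℝ) ≤ W := by
    calc _ ≤ ∑ s ∈ Finset.Ico 1 W, (1 : ℝ) := by
          refine (Finset.sum_le_sum_of_subset_of_nonneg (Finset.filter_subset _ _)
            fun s _ _ => by positivity).trans (Finset.sum_le_sum fun s hs => ?_)
          have : (1 : ℝ) ≤ s := by exact_mod_cast (Finset.mem_Ico.mp hs).1
          exact (div_le_one (by linarith)).mpr this
      _ ≤ W := by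
          simp
  have h3 := (sum_Ico_coprime_bounds hW m).1
  have h4 : (harmonic m : ℝ) ≤ 1 + v := by
    refine (harmonic_le_one_add_log m).trans ?_
    rcases Nat.eq_zero_or_pos m with h | h
    · simp [h, hv]
    · have : Real.log m ≤ v := by
        rw [Real.log_le_iff_le_exp (by exact_mod_cast h)]
        exact le_trans (by exact_mod_cast Nat.div_le_self n W) hn
      linarith
  have h5 := mul_le_mul_of_nonneg_left h4 hκ0
  have h6 := totient_div_le_one W
  nlinarith

theorem le_coprimeHarmonic {W : ℕ} (hW : 0 < W) {n : ℕ} {v : ℝ} (hv : 0 ≤ v)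
    (hn : Real.exp v ≤ n + 1) : W.totient / W * v - (W + 1) ≤ coprimeHarmonic W n := by
  set m := n / W with hm
  have hκ0 : (0 : ℝ) ≤ W.totient / W := by positivity
  have hmn : n + 1 ≤ (m + 1) * W := by
    rw [mul_comm]; exact Nat.lt_mul_div_succ n hW
  have hW1 : (1 : ℝ) ≤ W := by exact_mod_cast hW
  have h0 : 0 ≤ coprimeHarmonic W n := Finset.sum_nonneg fun s _ => by positivity
  have hlog : v ≤ Real.log (m + 1) + Real.log W := by
    rw [← Real.log_mul (by positivity) (by positivity), Real.le_log_iff_exp_le (by positivity)]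
    exact hn.trans (by exact_mod_cast hmn)
  have hlW : Real.log W ≤ W := (Real.log_le_sub_one_of_pos (by linarith)).trans (by linarith)
  have h6 := totient_div_le_one W
  rcases Nat.eq_zero_or_pos m with h | h
  · rw [h] at hlog
    simp at hlog
    nlinarith
  · obtain ⟨m', hm'⟩ : ∃ m', m = m' + 1 := ⟨m - 1, by omega⟩
    have h3 := (sum_Ico_coprime_bounds hW m').2
    rw [← hm'] at h3
    have h4 : ∑ s ∈ (Finset.Ico W (m * W)).filter W.Coprime, (1 / s : ℝ)
        ≤ coprimeHarmonic W n := by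
      refine Finset.sum_le_sum_of_subset_of_nonneg (Finset.filter_subset_filter _ fun s hs => ?_)
        fun s _ _ => by positivity
      rw [Finset.mem_Ico] at hs
      rw [Finset.mem_Icc]
      have : m * W ≤ n := Nat.div_mul_le_self n W
      omega
    have h5 := log_add_one_le_harmonic m
    have h7 : v - W ≤ (harmonic m : ℝ) := by push_cast at h5; linarith
    have h8 := mul_le_mul_of_nonneg_left h7 hκ0
    have h9 : (W.totient / W : ℝ) * W ≤ W := by nlinarith
    nlinarith

theorem sum_inv_sq_le_two (n : ℕ) : ∑ b ∈ Finset.Icc 1 n, (1 / (b : ℝ) ^ 2) ≤ 2 := by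
  rcases Nat.eq_zero_or_pos n with h | h
  · simp [h]
  · have h1 : Finset.Icc 1 n = insert 1 (Finset.Ioc 1 n) := by
      ext; simp; omega
    rw [h1, Finset.sum_insert (by simp)]
    have h2 := sum_Ioc_inv_sq_le_sub (α := ℝ) one_ne_zero h
    simp only [one_div]
    have : (0 : ℝ) ≤ (n : ℝ)⁻¹ := by positivity
    norm_num at h2 ⊢
    linarith

/-- Write `s = b²a` with `a` squarefree and use `∑ 1/b² ≤ 2`. -/
theorem coprimeHarmonic_le_two_mul (W n : ℕ) :
    coprimeHarmonic W n
      ≤ 2 * ∑ s ∈ (Finset.Icc 1 n).filter (fun s => W.Coprime s ∧ Squarefree s), (1 / s : ℝ) := by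
  set A := (Finset.Icc 1 n).filter (fun s => W.Coprime s ∧ Squarefree s) with hA
  have h1 : ∑ z ∈ Finset.Icc 1 n ×ˢ A, (1 / (z.1 : ℝ) ^ 2 * (1 / z.2))
      = (∑ b ∈ Finset.Icc 1 n, (1 / (b : ℝ) ^ 2)) * ∑ s ∈ A, (1 / s : ℝ) := by
    rw [Finset.sum_mul_sum, Finset.sum_product]
  have h2 : coprimeHarmonic W n ≤ ∑ z ∈ Finset.Icc 1 n ×ˢ A, (1 / (z.1 : ℝ) ^ 2 * (1 / z.2)) := by
    choose a b hab ha using Nat.sq_mul_squarefree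
    have hinj : Function.Injective fun s : ℕ => (b s, a s) := by
      intro s t h
      simp only [Prod.mk.injEq] at h
      rw [← hab s, ← hab t, h.1, h.2]
    calc _ = ∑ z ∈ ((Finset.Icc 1 n).filter W.Coprime).map ⟨_, hinj⟩,
          (1 / (z.1 : ℝ) ^ 2 * (1 / z.2)) := by
          rw [Finset.sum_map]
          refine Finset.sum_congr rfl fun s _ => ?_
          simp only [Function.Embedding.coeFn_mk]
          rw [one_div_mul_one_div]
          congr 1
          exact_mod_cast (hab s).symm
      _ ≤ _ := by
          refine Finset.sum_le_sum_of_subset_of_nonneg (fun z hz => ?_) fun z _ _ => by positivity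
          obtain ⟨s, hs, rfl⟩ := Finset.mem_map.mp hz
          simp only [Finset.mem_filter, Finset.mem_Icc] at hs
          obtain ⟨⟨hs1, hsn⟩, hsW⟩ := hs
          have hb0 : b s ≠ 0 := by
            intro h
            have := hab s
            rw [h] at this
            simp at this
            omega
          have ha0 : a s ≠ 0 := (ha s).ne_zero
          have e := hab s
          simp only [Function.Embedding.coeFn_mk, Finset.mem_product, Finset.mem_Icc, hA,
            Finset.mem_filter]
          have hbs : b s ∣ s := ⟨b s * a s, by rw [← mul_assoc, ← sq, e]⟩
          have has : a s ∣ s := ⟨b s ^ 2, by rw [mul_comm, e]⟩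
          refine ⟨⟨by omega, (Nat.le_of_dvd hs1 hbs).trans hsn⟩,
            ⟨by omega, (Nat.le_of_dvd hs1 has).trans hsn⟩, hsW.coprime_dvd_right has, ha s⟩
  rw [h1] at h2
  refine h2.trans (mul_le_mul_of_nonneg_right (sum_inv_sq_le_two n)
    (Finset.sum_nonneg fun s _ => by positivity))

end CoprimeHarmonic

/-! ### Sets of sieve primes as squarefree integers. -/

section SievePrimes

/-- The primes in `(D, R]`. -/
def sievePrimes (D R : ℕ) : Finset ℕ := (Finset.Ioc D R).filter Nat.Prime

variable {D R : ℕ}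

theorem prime_of_sievePrimes (p : sievePrimes D R) : (p : ℕ).Prime :=
  (Finset.mem_filter.mp p.2).2

theorem lt_of_sievePrimes (p : sievePrimes D R) : D < p :=
  (Finset.mem_Ioc.mp (Finset.mem_filter.mp p.2).1).1

theorem le_of_sievePrimes (p : sievePrimes D R) : (p : ℕ) ≤ R :=
  (Finset.mem_Ioc.mp (Finset.mem_filter.mp p.2).1).2

/-- The primes of the sieve as real numbers. -/
def realPrime (p : sievePrimes D R) : ℝ := (p : ℕ)

theorem one_lt_realPrime (p : sievePrimes D R) : 1 < realPrime p := by
  unfold realPrime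
  exact_mod_cast (prime_of_sievePrimes p).one_lt

/-- The squarefree number with a given set of prime factors. -/
def natProd (S : Finset (sievePrimes D R)) : ℕ := ∏ p ∈ S, (p : ℕ)

theorem natProd_pos (S : Finset (sievePrimes D R)) : 0 < natProd S :=
  Finset.prod_pos fun p _ => (prime_of_sievePrimes p).pos

theorem logSum_realPrime (S : Finset (sievePrimes D R)) :
    logSum realPrime S = Real.log (natProd S) := by
  unfold logSum realPrime natProd
  push_cast
  rw [Real.log_prod]
  intro p _
  exact_mod_cast (prime_of_sievePrimes p).ne_zero

theorem invProd_realPrime (S : Finset (sievePrimes D R)) :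
    invProd realPrime S = 1 / (natProd S : ℝ) := by
  unfold invProd realPrime natProd
  rw [Finset.prod_div_distrib, Finset.prod_const_one]
  push_cast
  rfl

theorem prime_dvd_natProd {S : Finset (sievePrimes D R)} {q : ℕ} (hq : q.Prime) :
    q ∣ natProd S ↔ ∃ p ∈ S, (p : ℕ) = q := by
  unfold natProd
  rw [hq.prime.dvd_finset_prod_iff]
  refine exists_congr fun p => and_congr_right fun _ => ?_
  rw [Nat.prime_dvd_prime_iff_eq hq (prime_of_sievePrimes p), eq_comm]

theorem natProd_injective : Function.Injective (natProd : Finset (sievePrimes D R) → ℕ) := by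
  have key : ∀ (S : Finset (sievePrimes D R)) p, p ∈ S ↔ (p : ℕ) ∣ natProd S := by
    intro S p
    rw [prime_dvd_natProd (prime_of_sievePrimes p)]
    exact ⟨fun h => ⟨p, h, rfl⟩, fun ⟨q, hq, h⟩ => Subtype.ext h ▸ hq⟩
  intro S T h
  ext p
  rw [key, h, ← key]

theorem coprime_factorial_natProd (S : Finset (sievePrimes D R)) :
    (D.factorial).Coprime (natProd S) := by
  refine Nat.Coprime.prod_right fun p _ => ?_
  rw [Nat.coprime_comm]
  refine (Nat.coprime_factorial_iff (prime_of_sievePrimes p).ne_one).mpr ?_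
  rw [(prime_of_sievePrimes p).minFac_eq]
  exact lt_of_sievePrimes p

theorem exists_natProd_eq {s : ℕ} (hs : Squarefree s) (hW : (D.factorial).Coprime s)
    (hsR : s ≤ R) : ∃ S : Finset (sievePrimes D R), natProd S = s := by
  have hmem : ∀ p ∈ s.primeFactors, p ∈ sievePrimes D R := by
    intro p hp
    have hpp := Nat.prime_of_mem_primeFactors hp
    have hps := Nat.dvd_of_mem_primeFactors hp
    rw [sievePrimes, Finset.mem_filter, Finset.mem_Ioc]
    refine ⟨⟨?_, (Nat.le_of_dvd (Nat.pos_of_ne_zero hs.ne_zero) hps).trans hsR⟩, hpp⟩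
    by_contra! h
    exact hpp.one_lt.ne' (Nat.eq_one_of_dvd_coprimes hW
      ((hpp.dvd_factorial).mpr h) hps)
  refine ⟨s.primeFactors.subtype (· ∈ sievePrimes D R), ?_⟩
  unfold natProd
  rw [Finset.prod_subtype_of_mem (fun p => p) hmem]
  exact Nat.prod_primeFactors_of_squarefree hs

theorem weightedSum_indicator (v : ℝ) :
    weightedSum (realPrime (D := D) (R := R)) (fun u => if u ≤ v then 1 else 0)
      = ∑ S : Finset (sievePrimes D R) with Real.log (natProd S) ≤ v, 1 / (natProd S : ℝ) := by
  rw [weightedSum, Finset.sum_filter]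
  refine Finset.sum_congr rfl fun S _ => ?_
  rw [logSum_realPrime, invProd_realPrime]
  split_ifs <;> simp

theorem natProd_le_floor_exp {S : Finset (sievePrimes D R)} {v : ℝ}
    (h : Real.log (natProd S) ≤ v) : natProd S ≤ ⌊Real.exp v⌋₊ := by
  refine Nat.le_floor ?_
  exact (Real.log_le_iff_le_exp (by exact_mod_cast natProd_pos S)).mp h

theorem weightedSum_indicator_le_coprimeHarmonic (v : ℝ) :
    weightedSum (realPrime (D := D) (R := R)) (fun u => if u ≤ v then 1 else 0)
      ≤ coprimeHarmonic D.factorial ⌊Real.exp v⌋₊ := by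
  rw [weightedSum_indicator]
  calc _ = ∑ s ∈ (Finset.univ.filter fun S : Finset (sievePrimes D R) =>
        Real.log (natProd S) ≤ v).map ⟨_, natProd_injective⟩, (1 / s : ℝ) := by
        rw [Finset.sum_map]; rfl
    _ ≤ _ := by
        refine Finset.sum_le_sum_of_subset_of_nonneg (fun s hs => ?_) fun s _ _ => by positivity
        obtain ⟨S, hS, rfl⟩ := Finset.mem_map.mp hs
        have hS := (Finset.mem_filter.mp hS).2
        rw [Finset.mem_filter, Finset.mem_Icc]
        exact ⟨⟨natProd_pos S, natProd_le_floor_exp hS⟩, coprime_factorial_natProd S⟩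

theorem weightedSum_indicator_le {v : ℝ} (hv : 0 ≤ v) :
    weightedSum (realPrime (D := D) (R := R)) (fun u => if u ≤ v then 1 else 0)
      ≤ D.factorial.totient / D.factorial * v + (D.factorial + 1) :=
  (weightedSum_indicator_le_coprimeHarmonic v).trans
    (coprimeHarmonic_le D.factorial_pos hv (Nat.floor_le (Real.exp_pos v).le))

theorem weightedSum_indicator_le_one_add {v : ℝ} (hv : 0 ≤ v) :
    weightedSum (realPrime (D := D) (R := R)) (fun u => if u ≤ v then 1 else 0) ≤ 1 + v := by
  refine (weightedSum_indicator_le_coprimeHarmonic v).trans ?_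
  calc _ ≤ ∑ s ∈ Finset.Icc 1 ⌊Real.exp v⌋₊, (1 / s : ℝ) :=
        Finset.sum_le_sum_of_subset_of_nonneg (Finset.filter_subset _ _)
          fun s _ _ => by positivity
    _ = (harmonic ⌊Real.exp v⌋₊ : ℝ) := by
        rw [harmonic_eq_sum_Icc]; push_cast; simp
    _ ≤ 1 + Real.log (Real.exp v) := harmonic_floor_le_one_add_log _ (Real.one_le_exp hv)
    _ = 1 + v := by rw [Real.log_exp]

/-- Since `e^v < R + 1`, every squarefree `s ≤ e^v` coprime to `D!` is a product of sieve primes: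
the upper limit `R` excludes nothing. The division by 2 is the price of squarefreeness. -/
theorem le_weightedSum_indicator {v : ℝ} (hv : 0 ≤ v) (hvR : Real.exp v < R + 1) :
    (D.factorial.totient / D.factorial * v - (D.factorial + 1)) / 2
      ≤ weightedSum (realPrime (D := D) (R := R)) (fun u => if u ≤ v then 1 else 0) := by
  have h1 := le_coprimeHarmonic D.factorial_pos hv (Nat.lt_floor_add_one (Real.exp v)).le
  have h2 := coprimeHarmonic_le_two_mul D.factorial ⌊Real.exp v⌋₊
  have h3 : ∑ s ∈ (Finset.Icc 1 ⌊Real.exp v⌋₊).filter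
      (fun s => D.factorial.Coprime s ∧ Squarefree s), (1 / s : ℝ)
      ≤ weightedSum (realPrime (D := D) (R := R)) (fun u => if u ≤ v then 1 else 0) := by
    rw [weightedSum_indicator]
    calc _ ≤ ∑ s ∈ (Finset.univ.filter fun S : Finset (sievePrimes D R) =>
          Real.log (natProd S) ≤ v).map ⟨_, natProd_injective⟩, (1 / s : ℝ) := by
          refine Finset.sum_le_sum_of_subset_of_nonneg (fun s hs => ?_) fun s _ _ => by positivity
          rw [Finset.mem_filter, Finset.mem_Icc] at hs
          obtain ⟨⟨hs1, hsn⟩, hsW, hsq⟩ := hs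
          have hsR : s ≤ R := by
            have : ⌊Real.exp v⌋₊ < R + 1 := by
              rw [Nat.floor_lt (Real.exp_pos v).le]
              exact_mod_cast hvR
            omega
          obtain ⟨S, rfl⟩ := exists_natProd_eq hsq hsW hsR
          refine Finset.mem_map.mpr ⟨S, Finset.mem_filter.mpr ⟨Finset.mem_univ _, ?_⟩, rfl⟩
          rw [Real.log_le_iff_le_exp (by exact_mod_cast hs1)]
          exact (Nat.le_floor_iff (Real.exp_pos v).le).mp hsn
      _ = _ := by rw [Finset.sum_map]; rfl
  linarith

end SievePrimes

/-! ### The step function and its moments. -/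

section Smoothing

/-- The one-variable weight: a step function comparable to `min(1, ℓ / u)`. -/
noncomputable def stepWeight (J : ℕ) (ℓ u : ℝ) : ℝ :=
  ∑ j ∈ Finset.range J, (1 / 2) ^ j * (if u ≤ 2 ^ j * ℓ then 1 else 0)

theorem stepWeight_nonneg (J : ℕ) (ℓ u : ℝ) : 0 ≤ stepWeight J ℓ u :=
  Finset.sum_nonneg fun j _ => by split_ifs <;> positivity

theorem stepWeight_antitone (J : ℕ) (ℓ : ℝ) : Antitone (stepWeight J ℓ) := by
  intro u v huv
  refine Finset.sum_le_sum fun j _ => mul_le_mul_of_nonneg_left ?_ (by positivity)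
  split_ifs with h1 h2
  · exact le_rfl
  · exact absurd (huv.trans h1) h2
  · exact zero_le_one
  · exact le_rfl

theorem sum_half_pow_mul_le_two (a : ℕ → ℝ) (ha : ∀ j, a j ≤ 1) (J : ℕ) :
    ∑ j ∈ Finset.range J, (1 / 2 : ℝ) ^ j * a j ≤ 2 := by
  have h1 : ∑ j ∈ Finset.range J, (1 / 2 : ℝ) ^ j ≤ 2 := by
    rw [geom_sum_eq (by norm_num), div_le_iff_of_neg (by norm_num)]
    have : (0 : ℝ) ≤ (1 / 2) ^ J := by positivity
    linarith
  exact (Finset.sum_le_sum fun j _ => mul_le_of_le_one_right (by positivity) (ha j)).trans h1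

theorem stepWeight_le_two (J : ℕ) (ℓ u : ℝ) : stepWeight J ℓ u ≤ 2 :=
  sum_half_pow_mul_le_two _ (fun j => by split_ifs <;> norm_num) J

/-- If `a 0 = 0`, shifting the index scales both sides by `1/4`. If `a 0 = 1`, the left side is at
most 4 and the right side at least 4. -/
theorem sq_sum_half_pow_le (J : ℕ) (a : ℕ → ℝ) (ha : ∀ j, a j = 0 ∨ a j = 1) :
    (∑ j ∈ Finset.range J, (1 / 2 : ℝ) ^ j * a j) ^ 2
      ≤ 4 * ∑ j ∈ Finset.range J, (1 / 4 : ℝ) ^ j * a j := by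
  induction J generalizing a with
  | zero => simp
  | succ J ih =>
    have hnn : ∀ j, 0 ≤ a j := fun j => by rcases ha j with h | h <;> rw [h]; norm_num
    have hle : ∀ j, a j ≤ 1 := fun j => by rcases ha j with h | h <;> rw [h]; norm_num
    have hS0 : 0 ≤ ∑ j ∈ Finset.range (J + 1), (1 / 2 : ℝ) ^ j * a j :=
      Finset.sum_nonneg fun j _ => mul_nonneg (by positivity) (hnn j)
    have hS2 := sum_half_pow_mul_le_two a hle (J + 1)
    have hT0 : 0 ≤ ∑ j ∈ Finset.range J, (1 / 4 : ℝ) ^ (j + 1) * a (j + 1) :=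
      Finset.sum_nonneg fun j _ => mul_nonneg (by positivity) (hnn _)
    rcases ha 0 with h | h
    · rw [Finset.sum_range_succ', Finset.sum_range_succ', h]
      have h1 := ih (fun j => a (j + 1)) fun j => ha _
      simp only [pow_succ, mul_zero, add_zero] at *
      have e1 : ∑ j ∈ Finset.range J, (1 / 2 : ℝ) ^ j * (1 / 2) * a (j + 1)
          = 1 / 2 * ∑ j ∈ Finset.range J, (1 / 2 : ℝ) ^ j * a (j + 1) := by
        rw [Finset.mul_sum]; exact Finset.sum_congr rfl fun j _ => by ring
      have e2 : ∑ j ∈ Finset.range J, (1 / 4 : ℝ) ^ j * (1 / 4) * a (j + 1)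
          = 1 / 4 * ∑ j ∈ Finset.range J, (1 / 4 : ℝ) ^ j * a (j + 1) := by
        rw [Finset.mul_sum]; exact Finset.sum_congr rfl fun j _ => by ring
      rw [e1, e2]
      nlinarith
    · rw [Finset.sum_range_succ' (fun j => (1 / 4 : ℝ) ^ j * a j), h]
      simp only [pow_zero, mul_one]
      nlinarith

theorem stepWeight_sq_le (J : ℕ) (ℓ u : ℝ) :
    stepWeight J ℓ u ^ 2
      ≤ 4 * ∑ j ∈ Finset.range J, (1 / 4) ^ j * (if u ≤ 2 ^ j * ℓ then 1 else 0) :=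
  sq_sum_half_pow_le J _ fun j => by split_ifs <;> simp

/-- On the `j`-th step `u ≤ 2^j ℓ`, so the factor `u` turns `4^(-j)` into `2^(-j) ℓ`. -/
theorem mul_stepWeight_sq_le (J : ℕ) {ℓ u : ℝ} (hu : 0 ≤ u) :
    u * stepWeight J ℓ u ^ 2
      ≤ 4 * ℓ * ∑ j ∈ Finset.range J, (1 / 2) ^ j * (if u ≤ 2 ^ j * ℓ then 1 else 0) := by
  refine (mul_le_mul_of_nonneg_left (stepWeight_sq_le J ℓ u) hu).trans ?_
  rw [mul_left_comm u, mul_assoc 4 ℓ, Finset.mul_sum _ _ u, Finset.mul_sum _ _ ℓ]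
  refine mul_le_mul_of_nonneg_left (Finset.sum_le_sum fun j _ => ?_) (by norm_num)
  split_ifs with h
  · have : (1 / 4 : ℝ) ^ j * 2 ^ j = (1 / 2) ^ j := by rw [← mul_pow]; norm_num
    have h4 : (0 : ℝ) ≤ (1 / 4) ^ j := by positivity
    have h5 := mul_le_mul_of_nonneg_left h h4
    have h6 : (1 / 4 : ℝ) ^ j * (2 ^ j * ℓ) = ℓ * (1 / 2) ^ j := by rw [← this]; ring
    linarith
  · simp

variable {ι : Type*} [Fintype ι] [DecidableEq ι]

theorem weightedSum_mono {x : ι → ℝ} (hx : ∀ p, 1 < x p) {f g : ℝ → ℝ}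
    (h : ∀ u, 0 ≤ u → f u ≤ g u) : weightedSum x f ≤ weightedSum x g :=
  Finset.sum_le_sum fun S _ =>
    mul_le_mul_of_nonneg_right (h _ (logSum_nonneg hx S)) (invProd_pos hx S).le

theorem weightedSum_const_mul_sum (x : ι → ℝ) (J : ℕ) (C : ℝ) (b : ℕ → ℝ) (f : ℕ → ℝ → ℝ) :
    weightedSum x (fun u => C * ∑ j ∈ Finset.range J, b j * f j u)
      = C * ∑ j ∈ Finset.range J, b j * weightedSum x (f j) := by
  unfold weightedSum
  simp_rw [Finset.mul_sum, Finset.sum_mul]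
  rw [Finset.sum_comm]
  refine Finset.sum_congr rfl fun j _ => Finset.sum_congr rfl fun S _ => by ring

/-- Each dyadic scale contributes equally to the first sum, which grows like `J`, whereas the sum of
squares is dominated by a geometric series. This discrepancy is the gain of the sieve. -/
theorem stepWeight_moments {x : ι → ℝ} (hx : ∀ p, 1 < x p) {J : ℕ} (hJ : 0 < J) {κ ℓ : ℝ}
    (hκ : 0 < κ) (hℓ : 0 < ℓ)
    (hlo : ∀ j < J, κ * (2 ^ j * ℓ) / 4 ≤ weightedSum x (fun u => if u ≤ 2 ^ j * ℓ then 1 else 0))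
    (hup : ∀ j < J, weightedSum x (fun u => if u ≤ 2 ^ j * ℓ then 1 else 0)
      ≤ 2 * (κ * (2 ^ j * ℓ))) :
    J * (κ * ℓ) / 4 ≤ weightedSum x (stepWeight J ℓ) ∧
      κ * ℓ / 4 ≤ weightedSum x (fun u => stepWeight J ℓ u ^ 2) ∧
      weightedSum x (fun u => stepWeight J ℓ u ^ 2) ≤ 16 * (κ * ℓ) ∧
      weightedSum x (fun u => u * stepWeight J ℓ u ^ 2) ≤ 8 * J * (κ * ℓ) * ℓ := by
  have e1 : ∀ j : ℕ, (1 / 2 : ℝ) ^ j * 2 ^ j = 1 := fun j => by rw [← mul_pow]; norm_num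
  have e2 : ∀ j : ℕ, (1 / 4 : ℝ) ^ j * 2 ^ j = (1 / 2) ^ j := fun j => by
    rw [← mul_pow]; norm_num
  refine ⟨?_, ?_, ?_, ?_⟩
  · have h1 := weightedSum_const_mul_sum x J 1 (fun j => (1 / 2) ^ j)
      (fun j u => if u ≤ 2 ^ j * ℓ then 1 else 0)
    simp only [one_mul] at h1
    unfold stepWeight
    rw [h1]
    calc _ = ∑ j ∈ Finset.range J, κ * ℓ / 4 := by simp; ring
      _ ≤ _ := by
        refine Finset.sum_le_sum fun j hj => ?_
        have h2 := mul_le_mul_of_nonneg_left (hlo j (Finset.mem_range.mp hj))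
          (show (0 : ℝ) ≤ (1 / 2) ^ j by positivity)
        refine le_trans (le_of_eq ?_) h2
        rw [show (1 / 2 : ℝ) ^ j * (κ * (2 ^ j * ℓ) / 4)
          = (1 / 2 : ℝ) ^ j * 2 ^ j * (κ * ℓ / 4) by ring, e1, one_mul]
  · have h1 := hlo 0 hJ
    rw [pow_zero, one_mul] at h1
    refine h1.trans (weightedSum_mono hx fun u _ => ?_)
    split_ifs with h
    · have h2 : (1 : ℝ) ≤ stepWeight J ℓ u := by
        refine le_trans ?_ (Finset.single_le_sum (f := fun j : ℕ => (1 / 2 : ℝ) ^ j *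
          (if u ≤ 2 ^ j * ℓ then 1 else 0)) (fun j _ => by split_ifs <;> positivity)
          (Finset.mem_range.mpr hJ))
        simp [h]
      exact one_le_pow₀ h2
    · exact sq_nonneg _
  · refine (weightedSum_mono hx fun u _ => stepWeight_sq_le J ℓ u).trans ?_
    rw [weightedSum_const_mul_sum x J 4 (fun j => (1 / 4) ^ j)
      (fun j u => if u ≤ 2 ^ j * ℓ then 1 else 0)]
    have : ∑ j ∈ Finset.range J, (1 / 4 : ℝ) ^ j *
        weightedSum x (fun u => if u ≤ 2 ^ j * ℓ then 1 else 0)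
        ≤ ∑ j ∈ Finset.range J, 2 * (κ * ℓ) * ((1 / 2 : ℝ) ^ j * 1) := by
      refine Finset.sum_le_sum fun j hj => ?_
      refine (mul_le_mul_of_nonneg_left (hup j (Finset.mem_range.mp hj))
          (show (0 : ℝ) ≤ (1 / 4) ^ j by positivity)).trans (le_of_eq ?_)
      rw [← e2]; ring
    rw [← Finset.mul_sum] at this
    have h3 := sum_half_pow_mul_le_two (fun _ => 1) (fun _ => le_rfl) J
    have h4 := mul_le_mul_of_nonneg_left h3 (show 0 ≤ 2 * (κ * ℓ) by positivity)
    linarith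
  · refine (weightedSum_mono hx fun u hu => mul_stepWeight_sq_le J hu).trans ?_
    rw [weightedSum_const_mul_sum x J (4 * ℓ) (fun j => (1 / 2) ^ j)
      (fun j u => if u ≤ 2 ^ j * ℓ then 1 else 0)]
    have : ∑ j ∈ Finset.range J, (1 / 2 : ℝ) ^ j *
        weightedSum x (fun u => if u ≤ 2 ^ j * ℓ then 1 else 0)
        ≤ ∑ j ∈ Finset.range J, 2 * (κ * ℓ) := by
      refine Finset.sum_le_sum fun j hj => ?_
      refine (mul_le_mul_of_nonneg_left (hup j (Finset.mem_range.mp hj))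
          (show (0 : ℝ) ≤ (1 / 2) ^ j by positivity)).trans (le_of_eq ?_)
      rw [show (1 / 2 : ℝ) ^ j * (2 * (κ * (2 ^ j * ℓ)))
          = (1 / 2 : ℝ) ^ j * 2 ^ j * (2 * (κ * ℓ)) by ring, e1, one_mul]
    rw [Finset.sum_const, Finset.card_range, nsmul_eq_mul] at this
    refine (mul_le_mul_of_nonneg_left this (by positivity)).trans (le_of_eq (by ring))

end Smoothing

/-! ### Pairs of colourings and their common extension. -/

section CompatibleColorings

variable {ι α : Type*} [Fintype ι] [DecidableEq ι] [Fintype α] [DecidableEq α]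

/-- No element has different colours in `c` and `c'`. -/
def Compatible (c c' : ι → Option α) : Prop :=
  ∀ p i i', c p = some i → c' p = some i' → i = i'

/-- The common extension of two compatible colourings. -/
def mergeColoring (c c' : ι → Option α) (p : ι) : Option α := (c p).or (c' p)

theorem colorSupport_mergeColoring (c c' : ι → Option α) :
    colorSupport (mergeColoring c c') = colorSupport c ∪ colorSupport c' := by
  ext p
  rw [Finset.mem_union, mem_colorSupport, mem_colorSupport, mem_colorSupport, mergeColoring]
  cases c p <;> simp

theorem prod_compatDensity_of_compatible (q : ι → ℝ) {c c' : ι → Option α}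
    (h : Compatible c c') :
    ∏ p, compatDensity (q p) (c p) (c' p)
      = ∏ p ∈ colorSupport (mergeColoring c c'), 1 / q p := by
  rw [← colorProd_eq_prod, colorProd]
  refine Finset.prod_congr rfl fun p _ => ?_
  have hp := h p
  unfold mergeColoring
  cases hc : c p with
  | none => cases hc' : c' p <;> simp [compatDensity]
  | some i =>
    cases hc' : c' p with
    | none => simp [compatDensity]
    | some i' =>
      have := hp i i' hc hc'
      simp [compatDensity, this]

theorem prod_compatDensity_of_not_compatible (q : ι → ℝ) {c c' : ι → Option α}
    (h : ¬ Compatible c c') : ∏ p, compatDensity (q p) (c p) (c' p) = 0 := by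
  unfold Compatible at h
  push Not at h
  obtain ⟨p, i, i', hc, hc', hne⟩ := h
  refine Finset.prod_eq_zero (Finset.mem_univ p) ?_
  rw [hc, hc', compatDensity, if_neg hne]

end CompatibleColorings

/-! ### Counting integers and primes under the divisibility conditions. -/

section Counting

variable {D R k : ℕ}

/-- The shifts `n + i W` are divisible by the primes of colour `i`. -/
def DivCond (c : sievePrimes D R → Option (Fin k)) (n : ℕ) : Prop :=
  ∀ p i, c p = some i → (p : ℕ) ∣ n + (i : ℕ) * D.factorial

theorem coprime_sievePrimes_factorial (p : sievePrimes D R) : (p : ℕ).Coprime D.factorial := by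
  refine (Nat.coprime_factorial_iff (prime_of_sievePrimes p).ne_one).mpr ?_
  rw [(prime_of_sievePrimes p).minFac_eq]
  exact lt_of_sievePrimes p

/-- Simultaneous congruences to `W` and to distinct primes form one residue class. -/
theorem exists_residue (b : sievePrimes D R → ℕ) (T : Finset (sievePrimes D R)) :
    ∃ a, ∀ n, (n ≡ 1 [MOD D.factorial] ∧ ∀ p ∈ T, n ≡ b p [MOD p])
      ↔ n ≡ a [MOD D.factorial * natProd T] := by
  induction T using Finset.induction_on with
  | empty => exact ⟨1, fun n => by simp [natProd]⟩
  | insert p T hp ih =>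
    obtain ⟨a, ha⟩ := ih
    have hco : (D.factorial * natProd T).Coprime (p : ℕ) := by
      refine Nat.Coprime.mul_left (coprime_sievePrimes_factorial p).symm ?_
      rw [Nat.coprime_comm, (prime_of_sievePrimes p).coprime_iff_not_dvd,
        prime_dvd_natProd (prime_of_sievePrimes p)]
      rintro ⟨q, hq, hqp⟩
      exact hp (Subtype.ext hqp ▸ hq)
    obtain ⟨z, hz1, hz2⟩ := Nat.chineseRemainder hco a (b p)
    refine ⟨z, fun n => ?_⟩
    have hprod : D.factorial * natProd (insert p T) = D.factorial * natProd T * p := by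
      unfold natProd
      rw [Finset.prod_insert hp]; ring
    rw [hprod, ← Nat.modEq_and_modEq_iff_modEq_mul hco, Finset.forall_mem_insert]
    constructor
    · rintro ⟨h1, h2, h3⟩
      exact ⟨((ha n).mp ⟨h1, h3⟩).trans hz1.symm, h2.trans hz2.symm⟩
    · rintro ⟨h1, h2⟩
      obtain ⟨h3, h4⟩ := (ha n).mpr (h1.trans hz1)
      exact ⟨h3, h2.trans hz2, h4⟩

/-- The residue `(p - 1) * t` stands for `-t` in the natural numbers. -/
theorem dvd_add_iff_modEq {p n t : ℕ} (hp : 0 < p) : p ∣ n + t ↔ n ≡ (p - 1) * t [MOD p] := by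
  have h1 : (p - 1) * t + t = p * t := by
    obtain ⟨q, rfl⟩ : ∃ q, p = q + 1 := ⟨p - 1, by omega⟩
    simp; ring
  have h2 : (p - 1) * t + t ≡ 0 [MOD p] := by
    rw [h1]; exact (Nat.modEq_zero_iff_dvd).mpr (dvd_mul_right _ _)
  rw [← Nat.modEq_zero_iff_dvd]
  constructor
  · intro h
    exact Nat.ModEq.add_right_cancel' t (h.trans h2.symm)
  · intro h
    exact (h.add_right t).trans h2

theorem exists_residue_divCond (c : sievePrimes D R → Option (Fin k)) :
    ∃ a, ∀ n, (n ≡ 1 [MOD D.factorial] ∧ DivCond c n)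
      ↔ n ≡ a [MOD D.factorial * natProd (colorSupport c)] := by
  obtain ⟨a, ha⟩ := exists_residue (fun p => match c p with
    | none => 0
    | some i => ((p : ℕ) - 1) * ((i : ℕ) * D.factorial)) (colorSupport c)
  refine ⟨a, fun n => ?_⟩
  rw [← ha n]
  refine and_congr_right fun _ => ?_
  constructor
  · intro h p hp
    obtain ⟨i, hi⟩ := Option.ne_none_iff_exists'.mp (mem_colorSupport.mp hp)
    simp only [hi]
    exact (dvd_add_iff_modEq (prime_of_sievePrimes p).pos).mp (h p i hi)
  · intro h p i hi
    have := h p (mem_colorSupport.mpr (by simp [hi]))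
    simp only [hi] at this
    exact (dvd_add_iff_modEq (prime_of_sievePrimes p).pos).mpr this

/-- The prime divides `(i' - i) D!` and is coprime to `D!`, while `|i' - i| < k ≤ D < p`. -/
theorem eq_of_dvd_shifts (hkD : k ≤ D) (p : sievePrimes D R) {n : ℕ} {i i' : Fin k}
    (h : (p : ℕ) ∣ n + (i : ℕ) * D.factorial) (h' : (p : ℕ) ∣ n + (i' : ℕ) * D.factorial) :
    i = i' := by
  have hD := lt_of_sievePrimes p
  have key : ∀ i i' : Fin k, i ≤ i' → (p : ℕ) ∣ n + (i : ℕ) * D.factorial →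
      (p : ℕ) ∣ n + (i' : ℕ) * D.factorial → i = i' := by
    intro i i' hii h h'
    have h1 := Nat.dvd_sub h' h
    have hle : (i : ℕ) ≤ i' := hii
    have h2 : n + (i' : ℕ) * D.factorial - (n + (i : ℕ) * D.factorial)
        = ((i' : ℕ) - i) * D.factorial := by
      rw [Nat.add_sub_add_left, Nat.sub_mul]
    rw [h2] at h1
    have h3 := (coprime_sievePrimes_factorial p).dvd_of_dvd_mul_right h1
    have h4 : (i' : ℕ) - i = 0 := Nat.eq_zero_of_dvd_of_lt h3 (by have := i'.2; omega)
    exact Fin.ext (by omega)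
  rcases le_total i i' with hl | hl
  · exact key i i' hl h h'
  · exact (key i' i hl h' h).symm

theorem compatible_of_divCond (hkD : k ≤ D) {c c' : sievePrimes D R → Option (Fin k)} {n : ℕ}
    (h : DivCond c n) (h' : DivCond c' n) : Compatible c c' :=
  fun p i i' hi hi' => eq_of_dvd_shifts hkD p (h p i hi) (h' p i' hi')

theorem divCond_mergeColoring {c c' : sievePrimes D R → Option (Fin k)} (hcc : Compatible c c')
    (n : ℕ) : DivCond (mergeColoring c c') n ↔ DivCond c n ∧ DivCond c' n := by
  unfold mergeColoring
  constructor
  · intro h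
    refine ⟨fun p i hi => h p i (by simp [hi]), fun p i hi => h p i ?_⟩
    cases hc : c p with
    | none => simp [hc, hi]
    | some i' => simp [hc, hcc p i' i hc hi]
  · rintro ⟨h1, h2⟩ p i hi
    cases hc : c p with
    | none => exact h2 p i (by simpa [hc] using hi)
    | some i' => exact h1 p i (by simpa [hc] using hi)

theorem abs_card_modEq_sub_le (A B a : ℕ) (hAB : A ≤ B) {r : ℕ} (hr : 0 < r) :
    |(((Finset.Ioc A B).filter fun n => n ≡ a [MOD r]).card : ℝ) - (B - A : ℝ) / r| ≤ 1 := by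
  have hr' : (0 : ℚ) < r := by exact_mod_cast hr
  have key : |(((Finset.Ioc A B).filter fun n => n ≡ a [MOD r]).card : ℚ) - (B - A : ℚ) / r|
      ≤ 1 := by
    have h1 := Nat.Ioc_filter_modEq_card A B hr a
    have hBA : ((A : ℚ) - a) / r ≤ ((B : ℚ) - a) / r := by
      have : (A : ℚ) ≤ B := by exact_mod_cast hAB
      gcongr
    have hfl := Int.floor_le_floor hBA
    rw [max_eq_left (by linarith)] at h1
    have h2 : (((Finset.Ioc A B).filter fun n => n ≡ a [MOD r]).card : ℚ)
        = (⌊((B : ℚ) - a) / r⌋ : ℚ) - ⌊((A : ℚ) - a) / r⌋ := by exact_mod_cast h1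
    have e : ((B : ℚ) - A) / r = ((B : ℚ) - a) / r - ((A : ℚ) - a) / r := by ring
    rw [h2, e, abs_le]
    have f1 := Int.floor_le (((B : ℚ) - a) / r)
    have f2 := Int.lt_floor_add_one (((B : ℚ) - a) / r)
    have f3 := Int.floor_le (((A : ℚ) - a) / r)
    have f4 := Int.lt_floor_add_one (((A : ℚ) - a) / r)
    constructor <;> linarith
  have := (Rat.cast_le (K := ℝ)).mpr key
  push_cast at this
  exact this

open Classical in
theorem abs_card_divCond_sub_le (hkD : k ≤ D) (A B : ℕ) (hAB : A ≤ B)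
    (c c' : sievePrimes D R → Option (Fin k)) :
    |(((Finset.Ioc A B).filter fun n => n ≡ 1 [MOD D.factorial] ∧ DivCond c n ∧ DivCond c' n).card
        : ℝ) - (B - A : ℝ) / D.factorial * ∏ p, compatDensity (realPrime p) (c p) (c' p)| ≤ 1 := by
  by_cases h : Compatible c c'
  · obtain ⟨a, ha⟩ := exists_residue_divCond (mergeColoring c c')
    have h1 : ∀ n, (n ≡ 1 [MOD D.factorial] ∧ DivCond c n ∧ DivCond c' n)
        ↔ n ≡ a [MOD D.factorial * natProd (colorSupport (mergeColoring c c'))] := by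
      intro n
      rw [← ha n, divCond_mergeColoring h]
    simp_rw [h1]
    rw [prod_compatDensity_of_compatible _ h]
    have h2 := abs_card_modEq_sub_le A B a hAB
      (Nat.mul_pos D.factorial_pos (natProd_pos (colorSupport (mergeColoring c c'))))
    have h3 := invProd_realPrime (colorSupport (mergeColoring c c'))
    unfold invProd at h3
    rw [h3]
    push_cast at h2
    rwa [div_mul_div_comm, mul_one]
  · rw [prod_compatDensity_of_not_compatible _ h, mul_zero, sub_zero,
      Finset.filter_false_of_mem]
    · simp
    · rintro n _ ⟨_, h1, h2⟩
      exact h (compatible_of_divCond hkD h1 h2)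

open Classical in
/-- The square of the sieve sum at `n`. -/
noncomputable def sieveSq (lam : (sievePrimes D R → Option (Fin k)) → ℝ) (n : ℕ) : ℝ :=
  (∑ c, if DivCond c n then lam c else 0) ^ 2

theorem sieveSq_nonneg (lam : (sievePrimes D R → Option (Fin k)) → ℝ) (n : ℕ) :
    0 ≤ sieveSq lam n := sq_nonneg _

open Classical in
theorem sum_mul_sieveSq (lam : (sievePrimes D R → Option (Fin k)) → ℝ) (I : Finset ℕ)
    (f : ℕ → ℝ) :
    ∑ n ∈ I with n ≡ 1 [MOD D.factorial], f n * sieveSq lam n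
      = ∑ c, ∑ c', lam c * lam c' *
        ∑ n ∈ I with n ≡ 1 [MOD D.factorial] ∧ DivCond c n ∧ DivCond c' n, f n := by
  have h1 : ∀ n, f n * sieveSq lam n = ∑ c, ∑ c', lam c * lam c' *
      (if DivCond c n ∧ DivCond c' n then f n else 0) := by
    intro n
    rw [sieveSq, sq, Finset.sum_mul_sum, Finset.mul_sum]
    refine Finset.sum_congr rfl fun c _ => ?_
    rw [Finset.mul_sum]
    refine Finset.sum_congr rfl fun c' _ => ?_
    by_cases h : DivCond c n <;> by_cases h' : DivCond c' n <;> simp [h, h'] <;> ring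
  simp_rw [h1]
  rw [Finset.sum_comm]
  refine Finset.sum_congr rfl fun c _ => ?_
  rw [Finset.sum_comm]
  refine Finset.sum_congr rfl fun c' _ => ?_
  rw [← Finset.mul_sum, ← Finset.sum_filter, Finset.filter_filter]

theorem sum_sieveSq_le (hkD : k ≤ D) (A B : ℕ) (hAB : A ≤ B)
    (lam : (sievePrimes D R → Option (Fin k)) → ℝ) :
    ∑ n ∈ Finset.Ioc A B with n ≡ 1 [MOD D.factorial], sieveSq lam n
      ≤ (B - A : ℝ) / D.factorial * tensorForm (fun p => compatDensity (realPrime p)) lam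
        + (∑ c, |lam c|) ^ 2 := by
  classical
  have h1 := sum_mul_sieveSq lam (Finset.Ioc A B) (fun _ => 1)
  simp only [one_mul] at h1
  rw [h1, sq, Finset.sum_mul_sum, tensorForm, Finset.mul_sum, ← Finset.sum_add_distrib]
  refine Finset.sum_le_sum fun c _ => ?_
  rw [Finset.mul_sum, ← Finset.sum_add_distrib]
  refine Finset.sum_le_sum fun c' _ => ?_
  rw [Finset.sum_const, nsmul_eq_mul, mul_one]
  have h2 := abs_card_divCond_sub_le hkD A B hAB c c'
  set X : ℝ := (((Finset.Ioc A B).filter fun n => n ≡ 1 [MOD D.factorial] ∧ DivCond c n ∧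
    DivCond c' n).card : ℝ)
  set Y := ∏ p, compatDensity (realPrime p) (c p) (c' p)
  have h3 : lam c * lam c' * (X - (B - A : ℝ) / D.factorial * Y) ≤ |lam c| * |lam c'| := by
    refine (le_abs_self _).trans ?_
    rw [abs_mul, abs_mul]
    exact mul_le_of_le_one_right (by positivity) h2
  nlinarith

theorem abs_thetaStar_sub_le_maxDiscrepancy {x : ℝ} (hx : 0 < x) {a q : ℕ} (ha : a.Coprime q) :
    |thetaStar x a q - x / (q.totient : ℝ)| ≤ maxDiscrepancy x q :=
  le_csSup (discrepancySet_bddAbove x q) ⟨x, a, hx, le_rfl, ha, rfl⟩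

theorem maxDiscrepancy_nonneg {x : ℝ} (hx : 0 < x) (q : ℕ) : 0 ≤ maxDiscrepancy x q :=
  (abs_nonneg _).trans (abs_thetaStar_sub_le_maxDiscrepancy hx (Nat.coprime_one_left q))

theorem totient_natProd (S : Finset (sievePrimes D R)) :
    ((natProd S).totient : ℝ) = ∏ p ∈ S, (realPrime p - 1) := by
  induction S using Finset.induction_on with
  | empty => simp [natProd]
  | insert p S hp ih =>
    have h1 : natProd (insert p S) = p * natProd S := Finset.prod_insert hp
    have hco : (p : ℕ).Coprime (natProd S) := by
      rw [(prime_of_sievePrimes p).coprime_iff_not_dvd,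
        prime_dvd_natProd (prime_of_sievePrimes p)]
      rintro ⟨q, hq, hqp⟩
      exact hp (Subtype.ext hqp ▸ hq)
    rw [h1, Nat.totient_mul hco, Nat.totient_prime (prime_of_sievePrimes p),
      Finset.prod_insert hp, ← ih]
    push_cast [(prime_of_sievePrimes p).one_le]
    rfl

/-- The window for `m` is shifted with the form, so that `m + t` runs exactly over `(N, 2N]` and the
discrepancy is taken at `y = N`. -/
theorem sum_primeLog_shift (N t a q : ℕ) (ht : t ≤ N) :
    ∑ m ∈ Finset.Ioc (N - t) (2 * N - t) with m ≡ a [MOD q], primeLog (m + t)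
      = thetaStar N (a + t) q := by
  have h1 : ⌊(2 * N : ℝ)⌋₊ = 2 * N := by
    have : (2 * N : ℝ) = ((2 * N : ℕ) : ℝ) := by push_cast; rfl
    rw [this, Nat.floor_natCast]
  rw [thetaStar, Nat.floor_natCast, h1]
  have h2 : ((Finset.Ioc N (2 * N)).filter fun n => n ≡ a + t [MOD q])
      = ((Finset.Ioc (N - t) (2 * N - t)).filter fun m => m ≡ a [MOD q]).map
          (addRightEmbedding t) := by
    ext n
    simp only [Finset.mem_map, Finset.mem_filter, Finset.mem_Ioc, addRightEmbedding_apply]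
    constructor
    · rintro ⟨⟨h3, h4⟩, h5⟩
      refine ⟨n - t, ⟨⟨by omega, by omega⟩, ?_⟩, by omega⟩
      refine Nat.ModEq.add_right_cancel' t ?_
      rwa [Nat.sub_add_cancel (by omega)]
    · rintro ⟨m, ⟨⟨h3, h4⟩, h5⟩, rfl⟩
      exact ⟨⟨by omega, by omega⟩, h5.add_right t⟩
  rw [h2, Finset.sum_map]
  rfl

open Classical in
theorem abs_sum_primeLog_divCond_le (hkD : k ≤ D) {N : ℕ} (hN : 0 < N) (j : Fin k)
    (hjN : (j : ℕ) * D.factorial ≤ N) (c c' : sievePrimes D R → Option (Fin k))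
    (hc : ∀ p, c p ≠ some j) (hc' : ∀ p, c' p ≠ some j) :
    |(∑ m ∈ Finset.Ioc (N - (j : ℕ) * D.factorial) (2 * N - (j : ℕ) * D.factorial) with
        m ≡ 1 [MOD D.factorial] ∧ DivCond c m ∧ DivCond c' m,
          primeLog (m + (j : ℕ) * D.factorial)) -
        (N : ℝ) / D.factorial.totient * ∏ p, compatDensity (realPrime p - 1) (c p) (c' p)|
      ≤ maxDiscrepancy N (D.factorial * natProd (colorSupport c ∪ colorSupport c')) := by
  have hN' : (0 : ℝ) < N := by exact_mod_cast hN
  by_cases h : Compatible c c'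
  · obtain ⟨a, ha⟩ := exists_residue_divCond (mergeColoring c c')
    have h1 : ∀ n, (n ≡ 1 [MOD D.factorial] ∧ DivCond c n ∧ DivCond c' n)
        ↔ n ≡ a [MOD D.factorial * natProd (colorSupport (mergeColoring c c'))] := by
      intro n
      rw [← ha n, divCond_mergeColoring h]
    simp_rw [h1]
    rw [sum_primeLog_shift _ _ _ _ hjN, prod_compatDensity_of_compatible _ h,
      ← colorSupport_mergeColoring]
    set S := colorSupport (mergeColoring c c')
    obtain ⟨ha1, ha2⟩ := (ha a).mpr rfl
    -- A prime of the modulus dividing `a + jW` would have to carry the colour `j`, which neither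
    -- colouring uses.
    have hco : (a + (j : ℕ) * D.factorial).Coprime (D.factorial * natProd S) := by
      refine Nat.Coprime.mul_right ?_ (Nat.Coprime.prod_right fun p hp => ?_)
      · rw [Nat.coprime_add_mul_right_left]
        have : Nat.gcd a D.factorial = Nat.gcd 1 D.factorial := ha1.gcd_eq
        rwa [Nat.gcd_one_left] at this
      · rw [Nat.coprime_comm, (prime_of_sievePrimes p).coprime_iff_not_dvd]
        intro hdvd
        obtain ⟨i, hi⟩ := Option.ne_none_iff_exists'.mp (mem_colorSupport.mp hp)
        have hij := eq_of_dvd_shifts hkD p (ha2 p i hi) hdvd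
        unfold mergeColoring at hi
        rcases hcp : c p with _ | i'
        · rw [hcp, Option.none_or] at hi
          exact hc' p (by rw [hi, hij])
        · rw [hcp, Option.some_or] at hi
          exact hc p (by rw [hcp, hi, hij])
    have h2 := abs_thetaStar_sub_le_maxDiscrepancy hN' hco
    have h3 : (N : ℝ) / ((D.factorial * natProd S).totient : ℝ)
        = (N : ℝ) / D.factorial.totient * ∏ p ∈ S, 1 / (realPrime p - 1) := by
      rw [Nat.totient_mul (coprime_factorial_natProd S), Nat.cast_mul, totient_natProd,
        Finset.prod_div_distrib, Finset.prod_const_one, div_mul_div_comm, mul_one]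
    rwa [h3] at h2
  · rw [prod_compatDensity_of_not_compatible _ h, mul_zero, sub_zero,
      Finset.filter_false_of_mem]
    · simpa using maxDiscrepancy_nonneg hN' _
    · rintro n _ ⟨_, h1, h2⟩
      exact h (compatible_of_divCond hkD h1 h2)

open Classical in
theorem le_sum_primeLog_sieveSq (hkD : k ≤ D) {N : ℕ} (hN : 0 < N) (hRN : R ≤ N) (j : Fin k)
    (hjN : (j : ℕ) * D.factorial ≤ N) (lam : (sievePrimes D R → Option (Fin k)) → ℝ) :
    (N : ℝ) / D.factorial.totient * tensorForm (fun p => compatDensity (realPrime p - 1))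
        (fun c => if ∀ p, c p ≠ some j then lam c else 0)
        - ∑ c, ∑ c', |lam c| * |lam c'| *
          maxDiscrepancy N (D.factorial * natProd (colorSupport c ∪ colorSupport c'))
      ≤ ∑ m ∈ Finset.Ioc (N - (j : ℕ) * D.factorial) (2 * N - (j : ℕ) * D.factorial) with
        m ≡ 1 [MOD D.factorial], primeLog (m + (j : ℕ) * D.factorial) * sieveSq lam m := by
  have hN' : (0 : ℝ) < N := by exact_mod_cast hN
  set lam' : (sievePrimes D R → Option (Fin k)) → ℝ :=
    fun c => if ∀ p, c p ≠ some j then lam c else 0 with hlam'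
  have h1 : ∑ m ∈ Finset.Ioc (N - (j : ℕ) * D.factorial) (2 * N - (j : ℕ) * D.factorial) with
        m ≡ 1 [MOD D.factorial], primeLog (m + (j : ℕ) * D.factorial) * sieveSq lam m
      = ∑ m ∈ Finset.Ioc (N - (j : ℕ) * D.factorial) (2 * N - (j : ℕ) * D.factorial) with
        m ≡ 1 [MOD D.factorial], primeLog (m + (j : ℕ) * D.factorial) * sieveSq lam' m := by
    refine Finset.sum_congr rfl fun m hm => ?_
    have hm := Finset.mem_Ioc.mp (Finset.mem_filter.mp hm).1
    -- A prime `m + jW > N ≥ R` has no divisor among the sieve primes, so colourings using `j`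
    -- contribute nothing.
    by_cases hp : (m + (j : ℕ) * D.factorial).Prime
    · unfold sieveSq
      congr 2
      refine Finset.sum_congr rfl fun c _ => ?_
      split_ifs with hd
      · simp only [hlam']
        rw [if_pos]
        intro p hpj
        have h2 := hd p j hpj
        rw [Nat.prime_dvd_prime_iff_eq (prime_of_sievePrimes p) hp] at h2
        have := le_of_sievePrimes p
        omega
      · rfl
    · simp [primeLog, hp]
  rw [h1, sum_mul_sieveSq lam', tensorForm, Finset.mul_sum, ← Finset.sum_sub_distrib]
  refine Finset.sum_le_sum fun c _ => ?_
  rw [Finset.mul_sum, ← Finset.sum_sub_distrib]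
  refine Finset.sum_le_sum fun c' _ => ?_
  have hmd := maxDiscrepancy_nonneg hN'
    (D.factorial * natProd (colorSupport c ∪ colorSupport c'))
  by_cases hc : ∀ p, c p ≠ some j
  swap
  · simp only [hlam', if_neg hc, zero_mul, mul_zero, zero_sub, neg_nonpos]
    positivity
  by_cases hc' : ∀ p, c' p ≠ some j
  swap
  · simp only [hlam', if_neg hc', zero_mul, mul_zero, zero_sub, neg_nonpos]
    positivity
  have h2 := abs_sum_primeLog_divCond_le hkD hN j hjN c c' hc hc'
  simp only [hlam', if_pos hc, if_pos hc']
  set X := ∑ m ∈ Finset.Ioc (N - (j : ℕ) * D.factorial) (2 * N - (j : ℕ) * D.factorial) with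
        m ≡ 1 [MOD D.factorial] ∧ DivCond c m ∧ DivCond c' m,
          primeLog (m + (j : ℕ) * D.factorial)
  set Y := ∏ p, compatDensity (realPrime p - 1) (c p) (c' p)
  have h3 : -(lam c * lam c' * (X - (N : ℝ) / D.factorial.totient * Y))
      ≤ |lam c| * |lam c'| *
        maxDiscrepancy N (D.factorial * natProd (colorSupport c ∪ colorSupport c')) := by
    refine (neg_le_abs _).trans ?_
    rw [abs_mul, abs_mul]
    exact mul_le_mul_of_nonneg_left h2 (by positivity)
  nlinarith

end Counting

/-! ### Multiplicities of supports and size of the sieve weights. -/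

section ColoringCounts

variable {ι α : Type*} [Fintype ι] [DecidableEq ι] [Fintype α] [DecidableEq α]

theorem sum_colorSupport (f : Finset ι → ℝ) :
    ∑ c : ι → Option α, f (colorSupport c)
      = ∑ S : Finset ι, (Fintype.card α : ℝ) ^ S.card * f S := by
  rw [← Finset.sum_fiberwise Finset.univ (colorSupport : (ι → Option α) → Finset ι)]
  refine Finset.sum_congr rfl fun S _ => ?_
  have h1 : (Finset.univ.filter fun c : ι → Option α => colorSupport c = S)
      = Fintype.piFinset fun p => if p ∈ S then (Finset.univ.map Function.Embedding.some) else {none} := by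
    ext c
    simp only [Finset.mem_filter, Finset.mem_univ, true_and, Fintype.mem_piFinset]
    constructor
    · rintro rfl p
      split_ifs with h
      · obtain ⟨i, hi⟩ := Option.ne_none_iff_exists'.mp (mem_colorSupport.mp h)
        simp [hi]
      · rw [mem_colorSupport, not_not] at h
        simp [h]
    · intro h
      ext p
      have hp := h p
      rw [mem_colorSupport]
      split_ifs at hp with hpS
      · simp only [hpS, iff_true]
        obtain ⟨i, -, hi⟩ := Finset.mem_map.mp hp
        rw [← hi]
        simp
      · simp only [hpS, iff_false, not_not]
        simpa using hp
  rw [Finset.sum_congr rfl (fun c hc => by rw [(Finset.mem_filter.mp hc).2]),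
    Finset.sum_const, nsmul_eq_mul, h1, Fintype.card_piFinset]
  congr 1
  push_cast
  rw [← Finset.prod_subset (Finset.subset_univ S)]
  · rw [Finset.prod_congr rfl (fun p hp => by rw [if_pos hp])]
    simp
  · intro p _ hp
    simp [hp]

/-- When the union of supports is `S`, each of the two colourings is `none` off `S` and has at most
`k + 1` choices at each element of `S`. -/
theorem sum_sum_colorSupport_union_le (f : Finset ι → ℝ) (hf : ∀ S, 0 ≤ f S) :
    ∑ c : ι → Option α, ∑ c' : ι → Option α, f (colorSupport c ∪ colorSupport c')
      ≤ ∑ S : Finset ι, (((Fintype.card α + 1) ^ 2 : ℕ) : ℝ) ^ S.card * f S := by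
  rw [← Finset.sum_product', Finset.univ_product_univ,
    ← Finset.sum_fiberwise Finset.univ
      (fun z : (ι → Option α) × (ι → Option α) => colorSupport z.1 ∪ colorSupport z.2)]
  refine Finset.sum_le_sum fun S _ => ?_
  rw [Finset.sum_congr rfl (fun c hc => by rw [(Finset.mem_filter.mp hc).2]),
    Finset.sum_const, nsmul_eq_mul]
  refine mul_le_mul_of_nonneg_right ?_ (hf S)
  set A : Finset (ι → Option α) :=
    Fintype.piFinset fun p => if p ∈ S then Finset.univ else {none} with hA
  have hmem : ∀ c : ι → Option α, colorSupport c ⊆ S → c ∈ A := by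
    intro c hc
    rw [hA, Fintype.mem_piFinset]
    intro p
    split_ifs with h
    · simp
    · have : p ∉ colorSupport c := fun h' => h (hc h')
      rw [mem_colorSupport, not_not] at this
      simp [this]
  have hcard : A.card = (Fintype.card α + 1) ^ S.card := by
    rw [hA, Fintype.card_piFinset, ← Finset.prod_subset (Finset.subset_univ S)]
    · rw [Finset.prod_congr rfl (fun p hp => by rw [if_pos hp])]
      simp
    · intro p _ hp
      simp [hp]
  have h1 : (Finset.univ.filter fun z : (ι → Option α) × (ι → Option α) =>
      colorSupport z.1 ∪ colorSupport z.2 = S) ⊆ A ×ˢ A := by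
    intro z hz
    have hz := (Finset.mem_filter.mp hz).2
    rw [Finset.mem_product]
    exact ⟨hmem _ (hz ▸ Finset.subset_union_left), hmem _ (hz ▸ Finset.subset_union_right)⟩
  have h2 := Finset.card_le_card h1
  rw [Finset.card_product, hcard] at h2
  have h3 : (Fintype.card α + 1) ^ S.card * (Fintype.card α + 1) ^ S.card
      = ((Fintype.card α + 1) ^ 2) ^ S.card := by
    rw [← pow_add, ← pow_mul]; congr 1; ring
  rw [h3] at h2
  exact_mod_cast h2

theorem sum_abs_moebiusFactor {q : ℝ} (hq : 1 < q) (c s : Option α) :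
    (∑ t, if (if c ≠ none then none else t) = s then |moebiusFactor q c t| else 0)
      ≤ if s = none then 1 else 1 / q := by
  have hq0 : 0 < 1 / q := by positivity
  cases c with
  | none =>
    simp only [ne_eq, not_true_eq_false, if_false, Finset.sum_ite_eq', Finset.mem_univ, if_true]
    cases s with
    | none => simp [moebiusFactor]
    | some i => simp only [moebiusFactor, abs_of_pos hq0]; simp
  | some i =>
    cases s with
    | none =>
      rw [Fintype.sum_option]
      simp only [ne_eq, reduceCtorEq, not_false_eq_true, if_true, moebiusFactor, abs_zero, zero_add]
      rw [Finset.sum_eq_single i]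
      · simp
      · intro b _ hb; simp [Ne.symm hb]
      · simp
    | some i' =>
      simp
      linarith [inv_pos.mpr (show 0 < q by linarith)]

/-- Only colourings `r` extending `c` contribute, and for them the truncated sum of logarithms is at
least that of `c`. -/
theorem sieveWeight_eq_zero {x : ι → ℝ} (hx : ∀ p, 1 < x p) (ρ : ℝ) (G : ℝ → ℝ)
    (c : ι → Option α) (hc : ρ < logSum x (colorSupport c)) :
    sieveWeight x (diagVar x ρ G) c = 0 := by
  refine Finset.sum_eq_zero fun r _ => ?_
  by_cases h : colorSupport c ⊆ colorSupport r
  · rw [diagVar, if_neg (not_le.mpr (hc.trans_le (logSum_mono hx h))), zero_mul]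
  · obtain ⟨p, hp, hp'⟩ := Finset.not_subset.mp h
    rw [mem_colorSupport] at hp hp'
    rw [not_not] at hp'
    obtain ⟨i, hi⟩ := Option.ne_none_iff_exists'.mp hp
    rw [Finset.prod_eq_zero (Finset.mem_univ p) (by rw [hi, hp', moebiusFactor]), mul_zero]

/-- Where `c` is coloured, only `r = c` contributes, with a factor of size 1. Forgetting those
colours keeps the truncation, and each remaining coloured prime has weight `1/p`. -/
theorem abs_sieveWeight_le {x : ι → ℝ} (hx : ∀ p, 1 < x p) (ρ : ℝ) {G : ℝ → ℝ}
    (hG : ∀ u, 0 ≤ G u) (hG2 : ∀ u, G u ≤ 2) (c : ι → Option α) :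
    |sieveWeight x (diagVar x ρ G) c|
      ≤ 2 ^ Fintype.card α *
        weightedSum x (fun u => if u ≤ ρ then 1 else 0) ^ Fintype.card α := by
  set F : (ι → Option α) → ℝ := fun s => if logSum x (colorSupport s) ≤ ρ then 1 else 0 with hF
  have hF0 : ∀ s, 0 ≤ F s := fun s => by simp only [hF]; split_ifs <;> norm_num
  have hy : ∀ r, diagVar x ρ G r ≤
      2 ^ Fintype.card α * F (fun p => if c p ≠ none then none else r p) := by
    intro r
    unfold diagVar
    split_ifs with h
    · have h1 : colorSupport (fun p => if c p ≠ none then none else r p) ⊆ colorSupport r := by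
        intro p hp
        rw [mem_colorSupport] at *
        by_cases hcp : c p = none <;> simp_all
      simp only [hF]
      rw [if_pos ((logSum_mono hx h1).trans h), mul_one]
      calc _ ≤ ∏ _i : α, (2 : ℝ) := Finset.prod_le_prod (fun i _ => hG _) fun i _ => hG2 _
        _ = _ := by simp
    · exact mul_nonneg (by positivity) (hF0 _)
  unfold sieveWeight
  calc _ ≤ ∑ r : ι → Option α, diagVar x ρ G r * ∏ p, |moebiusFactor (x p) (c p) (r p)| := by
        refine (Finset.abs_sum_le_sum_abs _ _).trans (le_of_eq ?_)
        refine Finset.sum_congr rfl fun r _ => ?_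
        rw [abs_mul, abs_of_nonneg (diagVar_nonneg x ρ hG r), Finset.abs_prod]
    _ ≤ ∑ r : ι → Option α, 2 ^ Fintype.card α *
        (F (fun p => if c p ≠ none then none else r p) *
          ∏ p, |moebiusFactor (x p) (c p) (r p)|) := by
        refine Finset.sum_le_sum fun r _ => ?_
        rw [← mul_assoc]
        exact mul_le_mul_of_nonneg_right (hy r) (Finset.prod_nonneg fun p _ => abs_nonneg _)
    _ = 2 ^ Fintype.card α * ∑ s, F s *
        ∏ p, ∑ t, if (if c p ≠ none then none else t) = s p then
          |moebiusFactor (x p) (c p) t| else 0 := by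
        rw [← Finset.mul_sum]
        congr 1
        exact sum_comp_mul_prod (fun p t => if c p ≠ none then none else t)
          (fun p t => |moebiusFactor (x p) (c p) t|) F
    _ ≤ 2 ^ Fintype.card α * ∑ s : ι → Option α,
        (if logSum x (colorSupport s) ≤ ρ then invProd x (colorSupport s) else 0) := by
        refine mul_le_mul_of_nonneg_left (Finset.sum_le_sum fun s _ => ?_) (by positivity)
        have h1 : ∏ p, (∑ t, if (if c p ≠ none then none else t) = s p then
          |moebiusFactor (x p) (c p) t| else 0) ≤ invProd x (colorSupport s) := by
          rw [invProd, ← colorProd_eq_prod, colorProd]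
          refine Finset.prod_le_prod (fun p _ => Finset.sum_nonneg fun t _ => ?_)
            fun p _ => sum_abs_moebiusFactor (hx p) (c p) (s p)
          split_ifs <;> positivity
        have h2 := mul_le_mul_of_nonneg_left h1 (hF0 s)
        refine h2.trans (le_of_eq ?_)
        simp only [hF]
        split_ifs <;> simp
    _ ≤ _ := mul_le_mul_of_nonneg_left (sum_colorProd_le hx ρ) (by positivity)

end ColoringCounts

/-! ### Bounds for the error terms. -/

section ErrorSums

variable {D R k : ℕ}

theorem weightedSum_indicator_pow_le {v : ℝ} (hv : 0 ≤ v) (K : ℕ) :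
    weightedSum (realPrime (D := D) (R := R)) (fun u => if u ≤ v then 1 else 0) ^ K
      ≤ (1 + v) ^ K :=
  pow_le_pow_left₀ (weightedSum_nonneg one_lt_realPrime fun u _ => by split_ifs <;> norm_num)
    (weightedSum_indicator_le_one_add hv) K

/-- The factor `K ^ S.card` counts the colourings of `S` with `K` colours, which reduces the sum to
a `K`-th power. -/
theorem sum_pow_card_mul_invProd_le (K : ℕ) {v : ℝ} (hv : 0 ≤ v) :
    ∑ S : Finset (sievePrimes D R), (K : ℝ) ^ S.card *
        (if logSum realPrime S ≤ v then invProd realPrime S else 0) ≤ (1 + v) ^ K := by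
  have h1 := sum_colorSupport (α := Fin K)
    (fun S : Finset (sievePrimes D R) =>
      if logSum realPrime S ≤ v then invProd realPrime S else 0)
  rw [Fintype.card_fin] at h1
  rw [← h1]
  refine (sum_colorProd_le one_lt_realPrime v).trans ?_
  rw [Fintype.card_fin]
  exact weightedSum_indicator_pow_le hv K

theorem abs_sieveWeight_realPrime_le {ρ : ℝ} (hρ : 0 ≤ ρ) {G : ℝ → ℝ}
    (hG : ∀ u, 0 ≤ G u) (hG2 : ∀ u, G u ≤ 2) (c : sievePrimes D R → Option (Fin k)) :
    |sieveWeight realPrime (diagVar realPrime ρ G) c|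
      ≤ (2 * (1 + ρ)) ^ k * (if logSum realPrime (colorSupport c) ≤ ρ then 1 else 0) := by
  split_ifs with h
  · rw [mul_one, mul_pow]
    refine (abs_sieveWeight_le one_lt_realPrime ρ hG hG2 c).trans ?_
    rw [Fintype.card_fin]
    exact mul_le_mul_of_nonneg_left (weightedSum_indicator_pow_le hρ k) (by positivity)
  · rw [sieveWeight_eq_zero one_lt_realPrime ρ G c (not_le.mp h)]
    simp

/-- Rankin's trick: counting `d ≤ e^v` is bounded by `e^v ∑ 1/d`. -/
theorem one_le_exp_mul_invProd {S : Finset (sievePrimes D R)} {v : ℝ}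
    (h : logSum realPrime S ≤ v) : 1 ≤ Real.exp v * invProd realPrime S := by
  rw [logSum_realPrime, Real.log_le_iff_le_exp (by exact_mod_cast natProd_pos S)] at h
  rw [invProd_realPrime, mul_one_div, le_div_iff₀ (by exact_mod_cast natProd_pos S), one_mul]
  exact h

theorem sum_abs_sieveWeight_le {ρ : ℝ} (hρ : 0 ≤ ρ) {G : ℝ → ℝ}
    (hG : ∀ u, 0 ≤ G u) (hG2 : ∀ u, G u ≤ 2) :
    ∑ c : sievePrimes D R → Option (Fin k), |sieveWeight realPrime (diagVar realPrime ρ G) c|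
      ≤ (2 * (1 + ρ)) ^ k * (Real.exp ρ * (1 + ρ) ^ k) := by
  refine (Finset.sum_le_sum fun c _ => abs_sieveWeight_realPrime_le hρ hG hG2 c).trans ?_
  rw [← Finset.mul_sum]
  refine mul_le_mul_of_nonneg_left ?_ (by positivity)
  have h1 := sum_colorProd_le (α := Fin k) (one_lt_realPrime (D := D) (R := R)) ρ
  rw [Fintype.card_fin] at h1
  replace h1 := h1.trans (weightedSum_indicator_pow_le hρ k)
  refine le_trans ?_ (mul_le_mul_of_nonneg_left h1 (Real.exp_pos ρ).le)
  rw [Finset.mul_sum]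
  refine Finset.sum_le_sum fun c _ => ?_
  split_ifs with h
  · exact one_le_exp_mul_invProd h
  · simp

theorem sum_abs_sieveWeight_mul_maxDiscrepancy_le {N : ℕ} (hN : 0 < N) {ρ : ℝ} (hρ : 0 ≤ ρ)
    {G : ℝ → ℝ} (hG : ∀ u, 0 ≤ G u) (hG2 : ∀ u, G u ≤ 2) :
    ∑ c : sievePrimes D R → Option (Fin k), ∑ c' : sievePrimes D R → Option (Fin k),
      |sieveWeight realPrime (diagVar realPrime ρ G) c| *
        |sieveWeight realPrime (diagVar realPrime ρ G) c'| *
          maxDiscrepancy N (D.factorial * natProd (colorSupport c ∪ colorSupport c'))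
      ≤ ((2 * (1 + ρ)) ^ k) ^ 2 * ∑ S : Finset (sievePrimes D R),
        (((k + 1) ^ 2 : ℕ) : ℝ) ^ S.card * (if logSum realPrime S ≤ 2 * ρ then
          maxDiscrepancy N (D.factorial * natProd S) else 0) := by
  have hN' : (0 : ℝ) < N := by exact_mod_cast hN
  have hmd := maxDiscrepancy_nonneg hN'
  have h1 := sum_sum_colorSupport_union_le (α := Fin k)
    (fun S : Finset (sievePrimes D R) => if logSum realPrime S ≤ 2 * ρ then
      maxDiscrepancy N (D.factorial * natProd S) else 0)
    (fun S => by split_ifs <;> [exact hmd _; exact le_rfl])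
  rw [Fintype.card_fin] at h1
  refine le_trans ?_ (mul_le_mul_of_nonneg_left h1 (by positivity))
  rw [Finset.mul_sum]
  refine Finset.sum_le_sum fun c _ => ?_
  rw [Finset.mul_sum]
  refine Finset.sum_le_sum fun c' _ => ?_
  have h2 := abs_sieveWeight_realPrime_le hρ hG hG2 c
  have h3 := abs_sieveWeight_realPrime_le hρ hG hG2 c'
  have h4 := mul_le_mul h2 h3 (abs_nonneg _) ((abs_nonneg _).trans h2)
  refine (mul_le_mul_of_nonneg_right h4 (hmd _)).trans ?_
  by_cases hc : logSum realPrime (colorSupport c) ≤ ρ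
  swap
  · rw [if_neg hc]
    simp only [mul_zero, zero_mul]
    exact mul_nonneg (by positivity) (by split_ifs <;> [exact hmd _; exact le_rfl])
  by_cases hc' : logSum realPrime (colorSupport c') ≤ ρ
  swap
  · rw [if_neg hc']
    simp only [mul_zero, zero_mul]
    exact mul_nonneg (by positivity) (by split_ifs <;> [exact hmd _; exact le_rfl])
  have hu : logSum realPrime (colorSupport c ∪ colorSupport c') ≤ 2 * ρ := by
    have h5 : logSum realPrime (colorSupport c ∪ colorSupport c')
        ≤ logSum realPrime (colorSupport c) + logSum realPrime (colorSupport c') := by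
      have h6 := Finset.sum_union_inter (s₁ := colorSupport c) (s₂ := colorSupport c')
        (f := fun p => Real.log (realPrime p))
      have h7 := logSum_nonneg one_lt_realPrime (colorSupport c ∩ colorSupport c')
      unfold logSum at *
      linarith
    linarith
  rw [if_pos hc, if_pos hc', if_pos hu]
  exact le_of_eq (by ring)

theorem primeLog_le {n M : ℕ} (h : n ≤ M) : primeLog n ≤ Real.log M := by
  unfold primeLog
  split_ifs with hp
  · exact Real.log_le_log (by exact_mod_cast hp.pos) (by exact_mod_cast h)
  · exact Real.log_natCast_nonneg M

theorem thetaStar_le {N q : ℕ} (hq : 0 < q) (hqN : q ≤ N) {y : ℝ} (hy : 0 < y)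
    (hyN : y ≤ N) (a : ℕ) : thetaStar y a q ≤ 3 * N / q * Real.log (2 * N) := by
  have hN : 0 < N := hq.trans_le hqN
  have hq' : (0 : ℝ) < q := by exact_mod_cast hq
  have hN' : (1 : ℝ) ≤ N := by exact_mod_cast hN
  have hqN' : (q : ℝ) ≤ N := by exact_mod_cast hqN
  have hle : ⌊y⌋₊ ≤ ⌊2 * y⌋₊ := Nat.floor_le_floor (by linarith)
  have hL : 0 ≤ Real.log (2 * N) := Real.log_nonneg (by linarith)
  have h1 := (abs_le.mp (abs_card_modEq_sub_le ⌊y⌋₊ ⌊2 * y⌋₊ a hle hq)).2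
  have h2 : ((Finset.Ioc ⌊y⌋₊ ⌊2 * y⌋₊).filter fun n => n ≡ a [MOD q]).card
      ≤ 3 * (N : ℝ) / q := by
    have h3 : (⌊2 * y⌋₊ : ℝ) ≤ 2 * y := Nat.floor_le (by linarith)
    have h4 : y < (⌊y⌋₊ : ℝ) + 1 := Nat.lt_floor_add_one y
    have h5 : ((⌊2 * y⌋₊ : ℝ) - ⌊y⌋₊) / q ≤ (N + 1) / q := by
      gcongr
      linarith
    have h6 : (1 : ℝ) ≤ N / q := by rwa [le_div_iff₀ hq', one_mul]
    have h7 : ((N : ℝ) + 1) / q ≤ 2 * (N / q) := by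
      rw [← mul_div_assoc]
      gcongr
      linarith
    have h8 : 3 * (N : ℝ) / q = 2 * (N / q) + N / q := by ring
    linarith
  have h3 : thetaStar y a q
      ≤ ((Finset.Ioc ⌊y⌋₊ ⌊2 * y⌋₊).filter fun n => n ≡ a [MOD q]).card • Real.log (2 * N) := by
    refine Finset.sum_le_card_nsmul _ _ _ fun n hn => ?_
    have hn := (Finset.mem_Ioc.mp (Finset.mem_filter.mp hn).1).2
    have h4 : n ≤ 2 * N := by
      refine hn.trans ?_
      have : ⌊2 * y⌋₊ ≤ ⌊((2 * N : ℕ) : ℝ)⌋₊ := Nat.floor_le_floor (by push_cast; linarith)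
      rwa [Nat.floor_natCast] at this
    have := primeLog_le h4
    push_cast at this
    exact this
  rw [nsmul_eq_mul] at h3
  exact h3.trans (mul_le_mul_of_nonneg_right h2 hL)

theorem div_totient_le {N : ℕ} (S : Finset (sievePrimes D R)) :
    (N : ℝ) / ((D.factorial * natProd S).totient : ℝ) ≤ N * (2 ^ S.card * invProd realPrime S) := by
  rw [div_eq_mul_one_div]
  refine mul_le_mul_of_nonneg_left ?_ (Nat.cast_nonneg N)
  rw [Nat.totient_mul (coprime_factorial_natProd S), Nat.cast_mul, totient_natProd]
  have h1 : (1 : ℝ) ≤ D.factorial.totient := by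
    exact_mod_cast Nat.totient_pos.mpr D.factorial_pos
  have hpos : 0 < ∏ p ∈ S, (realPrime p - 1) :=
    Finset.prod_pos fun p _ => by linarith [one_lt_realPrime p]
  calc _ ≤ 1 / ∏ p ∈ S, (realPrime p - 1) :=
        one_div_le_one_div_of_le hpos (le_mul_of_one_le_left hpos.le h1)
    _ = ∏ p ∈ S, 1 / (realPrime p - 1) := by
        rw [Finset.prod_div_distrib, Finset.prod_const_one]
    _ ≤ ∏ p ∈ S, 2 * (1 / realPrime p) := by
        refine Finset.prod_le_prod (fun p _ => ?_) fun p _ => ?_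
        · have := one_lt_realPrime p
          exact one_div_nonneg.mpr (by linarith)
        · have h2 : 2 ≤ realPrime p := by
            unfold realPrime
            exact_mod_cast (prime_of_sievePrimes p).two_le
          rw [mul_one_div, div_le_div_iff₀ (by linarith) (by linarith)]
          linarith
    _ = _ := by rw [Finset.prod_mul_distrib, Finset.prod_const]; rfl

/-- A trivial bound for every modulus up to `N`, needed to absorb the divisor-type multiplicities
that the level of distribution does not cover. -/
theorem maxDiscrepancy_le {N : ℕ} (hN : 2 ≤ N) (S : Finset (sievePrimes D R))
    (hS : D.factorial * natProd S ≤ N) :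
    maxDiscrepancy N (D.factorial * natProd S)
      ≤ 5 * N * Real.log (2 * N) * (2 ^ S.card * invProd realPrime S) := by
  have hN' : (2 : ℝ) ≤ N := by exact_mod_cast hN
  have hL : 1 ≤ 2 * Real.log (2 * N) := by
    have h1 : Real.log 2 ≤ Real.log (2 * N) := Real.log_le_log (by norm_num) (by linarith)
    linarith [Real.log_two_gt_d9]
  have hinv := invProd_pos one_lt_realPrime S
  have hpow : (1 : ℝ) ≤ 2 ^ S.card := one_le_pow₀ (by norm_num)
  refine csSup_le (discrepancySet_nonempty (by linarith) _) ?_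
  rintro r ⟨y, a, hy, hyN, -, rfl⟩
  have hqpos : 0 < D.factorial * natProd S := Nat.mul_pos D.factorial_pos (natProd_pos S)
  have h1 := thetaStar_le hqpos hS hy hyN a
  have h0 : 0 ≤ thetaStar y a (D.factorial * natProd S) :=
    Finset.sum_nonneg fun n _ => primeLog_nonneg n
  have h2 : y / ((D.factorial * natProd S).totient : ℝ) ≤ N * (2 ^ S.card * invProd realPrime S) :=
    (div_le_div_of_nonneg_right hyN (Nat.cast_nonneg _)).trans (div_totient_le S)
  have h3 : 0 ≤ y / ((D.factorial * natProd S).totient : ℝ) := by positivity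
  have h4 : 3 * (N : ℝ) / ((D.factorial * natProd S : ℕ) : ℝ)
      ≤ 3 * N * (2 ^ S.card * invProd realPrime S) := by
    rw [div_eq_mul_one_div]
    refine mul_le_mul_of_nonneg_left ?_ (by positivity)
    rw [invProd_realPrime]
    have hp : (0 : ℝ) < natProd S := by exact_mod_cast natProd_pos S
    refine le_trans (one_div_le_one_div_of_le hp ?_) (le_mul_of_one_le_left (by positivity) hpow)
    push_cast
    exact le_mul_of_one_le_left hp.le (by exact_mod_cast D.factorial_pos)
  have h5 := h1.trans (mul_le_mul_of_nonneg_right h4 (by linarith))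
  have h6 : (N : ℝ) * (2 ^ S.card * invProd realPrime S)
      ≤ 2 * N * Real.log (2 * N) * (2 ^ S.card * invProd realPrime S) := by
    refine mul_le_mul_of_nonneg_right ?_ (by positivity)
    nlinarith
  rw [abs_le]
  constructor
  · nlinarith
  · nlinarith

/-- In place of Cauchy–Schwarz, the multiplicity `t = K ^ S.card` is split as `t ≤ H + t²/H`. The
part `H` meets the level of distribution and the part `t²/H` the trivial bound, whose `2 ^ S.card`
gives the exponent `2 * K ^ 2`. -/
theorem sum_pow_card_mul_maxDiscrepancy_le {N Q : ℕ} (hN : 2 ≤ N) (hQN : Q ≤ N) (K : ℕ) {v : ℝ}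
    (hv : 0 ≤ v) (hQ : D.factorial * Real.exp v ≤ Q) {H : ℝ} (hH : 0 < H) :
    ∑ S : Finset (sievePrimes D R), (K : ℝ) ^ S.card * (if logSum realPrime S ≤ v then
        maxDiscrepancy N (D.factorial * natProd S) else 0)
      ≤ H * ∑ q ∈ Finset.Icc 1 Q, maxDiscrepancy N q +
        5 * N * Real.log (2 * N) / H * (1 + v) ^ (2 * K ^ 2) := by
  have hN' : (2 : ℝ) ≤ N := by exact_mod_cast hN
  have hN0 : (0 : ℝ) < N := by linarith
  have hL : 0 ≤ Real.log (2 * N) := Real.log_nonneg (by linarith)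
  have hle : ∀ S : Finset (sievePrimes D R), logSum realPrime S ≤ v →
      D.factorial * natProd S ≤ Q := by
    intro S hS
    rw [logSum_realPrime, Real.log_le_iff_le_exp (by exact_mod_cast natProd_pos S)] at hS
    have : ((D.factorial * natProd S : ℕ) : ℝ) ≤ Q := by
      push_cast
      exact (mul_le_mul_of_nonneg_left hS (Nat.cast_nonneg _)).trans hQ
    exact_mod_cast this
  have h1 : ∑ S : Finset (sievePrimes D R), (if logSum realPrime S ≤ v then
        maxDiscrepancy N (D.factorial * natProd S) else 0)
      ≤ ∑ q ∈ Finset.Icc 1 Q, maxDiscrepancy N q := by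
    have hinj : Function.Injective
        fun S : Finset (sievePrimes D R) => D.factorial * natProd S := by
      intro S T h
      exact natProd_injective (Nat.eq_of_mul_eq_mul_left D.factorial_pos h)
    rw [← Finset.sum_filter]
    calc _ = ∑ q ∈ (Finset.univ.filter fun S : Finset (sievePrimes D R) =>
          logSum realPrime S ≤ v).map ⟨_, hinj⟩, maxDiscrepancy N q := by
          rw [Finset.sum_map]; rfl
      _ ≤ _ := by
          refine Finset.sum_le_sum_of_subset_of_nonneg (fun q hq => ?_)
            fun q _ _ => maxDiscrepancy_nonneg hN0 q
          obtain ⟨S, hS, rfl⟩ := Finset.mem_map.mp hq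
          rw [Finset.mem_Icc]
          exact ⟨Nat.mul_pos D.factorial_pos (natProd_pos S),
            hle S (Finset.mem_filter.mp hS).2⟩
  have h2 := sum_pow_card_mul_invProd_le (D := D) (R := R) (2 * K ^ 2) hv
  have h3 := mul_le_mul_of_nonneg_left h1 hH.le
  have h4 := mul_le_mul_of_nonneg_left h2
    (show 0 ≤ 5 * N * Real.log (2 * N) / H by positivity)
  refine le_trans ?_ (add_le_add h3 h4)
  rw [Finset.mul_sum, Finset.mul_sum, ← Finset.sum_add_distrib]
  refine Finset.sum_le_sum fun S _ => ?_
  split_ifs with hS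
  · have h5 := maxDiscrepancy_le hN S ((hle S hS).trans hQN)
    have h6 := maxDiscrepancy_nonneg hN0 (D.factorial * natProd S)
    set m := maxDiscrepancy N (D.factorial * natProd S)
    set t : ℝ := (K : ℝ) ^ S.card with ht
    have h7 : t ≤ H + t ^ 2 / H := by
      rw [← sub_le_iff_le_add', le_div_iff₀ hH]
      nlinarith [sq_nonneg (t - H)]
    have h8 : t ^ 2 / H * m ≤ 5 * N * Real.log (2 * N) / H *
        (((2 * K ^ 2 : ℕ) : ℝ) ^ S.card * invProd realPrime S) := by
      refine (mul_le_mul_of_nonneg_left h5 (by positivity)).trans (le_of_eq ?_)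
      push_cast
      rw [mul_pow, ht, ← pow_mul, ← pow_mul, mul_comm 2 S.card]
      ring
    calc t * m ≤ (H + t ^ 2 / H) * m := mul_le_mul_of_nonneg_right h7 h6
      _ = H * m + t ^ 2 / H * m := by ring
      _ ≤ _ := by linarith
  · simp

end ErrorSums

/-! ### Choice of the sieve parameters. -/

section SieveParameters

variable {D R k : ℕ}

theorem sum_inv_sq_realPrime_le (hD : 0 < D) :
    ∑ p : sievePrimes D R, (1 / realPrime p) ^ 2 ≤ (1 / D : ℝ) := by
  rcases le_or_gt D R with h | h
  · have h1 := sum_Ioc_inv_sq_le_sub (α := ℝ) hD.ne' h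
    have h2 : (0 : ℝ) ≤ (R : ℝ)⁻¹ := by positivity
    calc _ = ∑ p ∈ sievePrimes D R, (((p : ℕ) : ℝ) ^ 2)⁻¹ := by
          rw [← Finset.sum_coe_sort (sievePrimes D R) (fun p : ℕ => ((p : ℝ) ^ 2)⁻¹)]
          refine Finset.sum_congr rfl fun p _ => ?_
          simp [realPrime]
      _ ≤ ∑ n ∈ Finset.Ioc D R, ((n : ℝ) ^ 2)⁻¹ :=
          Finset.sum_le_sum_of_subset_of_nonneg (Finset.filter_subset _ _)
            fun n _ _ => by positivity
      _ ≤ 1 / D := by rw [one_div]; linarith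
  · have : IsEmpty (sievePrimes D R) :=
      ⟨fun p => by have := lt_of_sievePrimes p; have := le_of_sievePrimes p; omega⟩
    simp

/-- All primes exceed `D ≥ 100k²`, so the product is at most `exp(2k ∑ 1/p²) ≤ exp(1/50) ≤ 5/4`. -/
theorem prod_one_add_le (hk : 0 < k) (hD : 100 * k ^ 2 ≤ D) :
    (3 / 4 : ℝ) ≤ 2 - ∏ p : sievePrimes D R,
      (1 + (k : ℝ) * (1 / (realPrime p - 1) - 1 / realPrime p)) := by
  have hk1 : (1 : ℝ) ≤ k := by exact_mod_cast hk
  have hD' : (100 : ℝ) * k ^ 2 ≤ D := by exact_mod_cast hD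
  have hDpos : 0 < D := by nlinarith
  have h1 : ∀ p : sievePrimes D R, 1 / (realPrime p - 1) - 1 / realPrime p
      ≤ 2 * (1 / realPrime p) ^ 2 := by
    intro p
    have h2 : 2 ≤ realPrime p := by
      unfold realPrime
      exact_mod_cast (prime_of_sievePrimes p).two_le
    have h3 : 0 < realPrime p - 1 := by linarith
    have h4 : 0 < realPrime p := by linarith
    have e1 : 1 / (realPrime p - 1) - 1 / realPrime p
        = 1 / ((realPrime p - 1) * realPrime p) := by field_simp; ring
    have e2 : 2 * (1 / realPrime p) ^ 2 = 2 / realPrime p ^ 2 := by ring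
    rw [e1, e2, div_le_div_iff₀ (by positivity) (by positivity)]
    nlinarith
  have h2 : ∏ p : sievePrimes D R,
      (1 + (k : ℝ) * (1 / (realPrime p - 1) - 1 / realPrime p))
      ≤ Real.exp (2 * k * ∑ p : sievePrimes D R, (1 / realPrime p) ^ 2) := by
    rw [Finset.mul_sum, Real.exp_sum]
    refine Finset.prod_le_prod (fun p _ => ?_) fun p _ => ?_
    · have h3 := one_lt_realPrime p
      have : 0 ≤ 1 / (realPrime p - 1) - 1 / realPrime p := by
        rw [sub_nonneg]
        exact one_div_le_one_div_of_le (by linarith) (by linarith)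
      positivity
    · have h3 := mul_le_mul_of_nonneg_left (h1 p) (show (0 : ℝ) ≤ k by linarith)
      have h4 := Real.add_one_le_exp (2 * k * (1 / realPrime p) ^ 2)
      linarith
  have h3 : 2 * (k : ℝ) * ∑ p : sievePrimes D R, (1 / realPrime p) ^ 2 ≤ 1 / 50 := by
    have h4 := mul_le_mul_of_nonneg_left (sum_inv_sq_realPrime_le (R := R) hDpos)
      (show (0 : ℝ) ≤ 2 * k by linarith)
    refine h4.trans ?_
    have hD0 : (0 : ℝ) < D := by exact_mod_cast hDpos
    rw [mul_one_div, div_le_div_iff₀ hD0 (by norm_num)]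
    nlinarith
  have h4 : Real.exp (2 * k * ∑ p : sievePrimes D R, (1 / realPrime p) ^ 2) ≤ 5 / 4 := by
    refine (Real.exp_le_exp.mpr h3).trans ?_
    have h5 := Real.exp_bound_div_one_sub_of_interval (x := 1 / 50) (by norm_num) (by norm_num)
    norm_num at h5 ⊢
    linarith
  linarith

/-- The comparison of the two sieve forms. -/
theorem exists_form_bounds {J : ℕ} (hk : 0 < k) (hJ : 0 < J) (hD : 100 * k ^ 2 ≤ D) {κ ρ ℓ : ℝ}
    (hκ : κ = D.factorial.totient / D.factorial) (hρ : 0 < ρ)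
    (hℓ : ℓ = ρ / (200 * J * k)) (h2J : 2 ^ J ≤ 50 * J * k) (hR : Real.exp ρ < R + 1)
    (hbig : (D.factorial : ℝ) + 1 ≤ κ * ℓ / 4) :
    ∃ X : ℝ, 1 ≤ X ∧
      tensorForm (fun p : sievePrimes D R => compatDensity (α := Fin k) (realPrime p))
        (sieveWeight realPrime (diagVar realPrime ρ (stepWeight J ℓ))) ≤ X ^ k ∧
      ∀ j : Fin k, κ * ρ * J / (204800 * k) * X ^ k ≤
        tensorForm (fun p : sievePrimes D R => compatDensity (realPrime p - 1))
          (fun c => if ∀ p, c p ≠ some j then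
            sieveWeight realPrime (diagVar realPrime ρ (stepWeight J ℓ)) c else 0) := by
  have hk1 : (1 : ℝ) ≤ k := by exact_mod_cast hk
  have hJ1 : (1 : ℝ) ≤ J := by exact_mod_cast hJ
  have hD' : (100 : ℝ) * k ^ 2 ≤ D := by exact_mod_cast hD
  have hDpos : 0 < D := by nlinarith
  have hD0 : (0 : ℝ) < D := by exact_mod_cast hDpos
  have hℓ0 : 0 < ℓ := by rw [hℓ]; positivity
  have hκ0 : 0 < κ := by
    rw [hκ]
    have : 0 < D.factorial.totient := Nat.totient_pos.mpr D.factorial_pos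
    have := D.factorial_pos
    positivity
  have hx := one_lt_realPrime (D := D) (R := R)
  -- All steps of `stepWeight` end below `ρ/4`, the support condition of `le_primeForm`.
  have hv : ∀ j < J, (2 : ℝ) ^ j * ℓ ≤ ρ / 4 := by
    intro j hj
    have h1 : (2 : ℝ) ^ j ≤ 2 ^ J := pow_le_pow_right₀ (by norm_num) hj.le
    have h2 : (2 : ℝ) ^ J ≤ 50 * J * k := by exact_mod_cast h2J
    calc (2 : ℝ) ^ j * ℓ ≤ (50 * J * k) * ℓ := mul_le_mul_of_nonneg_right (h1.trans h2) hℓ0.le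
      _ = ρ / 4 := by rw [hℓ]; field_simp; norm_num
  have hv1 : ∀ j : ℕ, ℓ ≤ 2 ^ j * ℓ := fun j =>
    le_mul_of_one_le_left hℓ0.le (one_le_pow₀ (by norm_num))
  -- By `hbig` the error `W + 1` of the harmonic sums is at most a quarter of `κ ℓ`; hence the clean
  -- bounds `κ v / 4` and `2 κ v`.
  obtain ⟨hY, hXlo, hXup, hM⟩ := stepWeight_moments hx hJ hκ0 hℓ0
    (fun j hj => by
      have h1 := le_weightedSum_indicator (D := D) (R := R) (v := 2 ^ j * ℓ) (by positivity)
        (lt_of_le_of_lt (Real.exp_le_exp.mpr (by linarith [hv j hj])) hR)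
      rw [← hκ] at h1
      have h2 := mul_le_mul_of_nonneg_left (hv1 j) hκ0.le
      linarith)
    (fun j hj => by
      have h1 := weightedSum_indicator_le (D := D) (R := R) (v := 2 ^ j * ℓ) (by positivity)
      rw [← hκ] at h1
      have h2 := mul_le_mul_of_nonneg_left (hv1 j) hκ0.le
      have : 0 ≤ κ * ℓ := by positivity
      linarith)
  set X := weightedSum (realPrime (D := D) (R := R)) (fun u => stepWeight J ℓ u ^ 2) with hX
  set Y := weightedSum (realPrime (D := D) (R := R)) (stepWeight J ℓ) with hYdef
  have hfac : (1 : ℝ) ≤ D.factorial := by exact_mod_cast D.factorial_pos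
  have hX1 : 1 ≤ X := by linarith
  have hxk : ∀ p : sievePrimes D R, 2 * (Fintype.card (Fin k) : ℝ) + 1 ≤ realPrime p := by
    intro p
    rw [Fintype.card_fin]
    have h1 : (D : ℝ) ≤ realPrime p := by
      unfold realPrime
      exact_mod_cast (lt_of_sievePrimes p).le
    nlinarith
  refine ⟨X, hX1, ?_, fun j => ?_⟩
  · refine (tensorForm_compatDensity_le realPrime (fun p => by linarith [hx p])
      (fun p => by have := hxk p; have : (0 : ℝ) ≤ Fintype.card (Fin k) := Nat.cast_nonneg _; linarith) _).trans ?_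
    refine (sum_diagVar_sq_le hx ρ).trans ?_
    rw [Fintype.card_fin]
  · have hm : weightedSum (realPrime (D := D) (R := R)) (fun u => u * stepWeight J ℓ u ^ 2)
        ≤ 32 * J * ℓ * X := by
      refine hM.trans ?_
      have := mul_le_mul_of_nonneg_left hXlo (show 0 ≤ 32 * J * ℓ by positivity)
      linarith
    have hsupp : ∀ u, ρ / 4 < u → stepWeight J ℓ u = 0 := by
      intro u hu
      refine Finset.sum_eq_zero fun i hi => ?_
      rw [if_neg (by linarith [hv i (Finset.mem_range.mp hi)]), mul_zero]
    have h1 := le_primeForm (α := Fin k) hx hxk hρ (stepWeight_nonneg J ℓ)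
      (stepWeight_antitone J ℓ) hsupp j (m := 32 * J * ℓ) (by positivity) hm (η := 3 / 4)
      (by norm_num) (by rw [Fintype.card_fin]; exact prod_one_add_le hk hD)
    rw [Fintype.card_fin, ← hX, ← hYdef] at h1
    refine le_trans ?_ h1
    have hσ := sum_inv_sq_realPrime_le (R := R) hDpos
    set σ := ∑ p : sievePrimes D R, (1 / realPrime p) ^ 2 with hσdef
    have hσ0 : 0 ≤ σ := Finset.sum_nonneg fun p _ => sq_nonneg _
    -- The prime sums contribute at most `4/100`, and the truncation contributes `32/150 = 16/75` by
    -- the choice of `ℓ`.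
    have hdef : (1 : ℝ) / 2 ≤ 1 - (k * ((k + 2) * σ + 32 * J * ℓ / (3 / 4 * ρ)) + k ^ 2 * σ) := by
      have e1 : k * (32 * J * ℓ / (3 / 4 * ρ)) = (16 / 75 : ℝ) := by
        rw [hℓ]; field_simp; norm_num
      have hkσ : (k : ℝ) ^ 2 * σ ≤ 1 / 100 := by
        have h3 := mul_le_mul_of_nonneg_left hσ (sq_nonneg (k : ℝ))
        refine h3.trans ?_
        rw [mul_one_div, div_le_div_iff₀ hD0 (by norm_num)]
        linarith
      have h4 : k * σ ≤ (k : ℝ) ^ 2 * σ := by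
        have : (k : ℝ) ≤ k ^ 2 := by nlinarith
        exact mul_le_mul_of_nonneg_right this hσ0
      have e2 : k * ((k + 2) * σ + 32 * J * ℓ / (3 / 4 * ρ)) + k ^ 2 * σ
          = 2 * (k ^ 2 * σ) + 2 * (k * σ) + k * (32 * J * ℓ / (3 / 4 * ρ)) := by ring
      rw [e2, e1]
      linarith
    have hXk : X ^ k = X ^ (k - 1) * X := by
      rw [← pow_succ, Nat.sub_add_cancel hk]
    have hXp : 0 ≤ X ^ (k - 1) := by positivity
    -- From `Y ≥ J κ ℓ / 4` and `X ≤ 16 κ ℓ`.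
    have hYX : J ^ 2 * (κ * ℓ) * X ≤ 256 * Y ^ 2 := by
      have h5 : (J * (κ * ℓ) / 4) ^ 2 ≤ Y ^ 2 := pow_le_pow_left₀ (by positivity) hY 2
      have h6 := mul_le_mul_of_nonneg_left hXup (show 0 ≤ J ^ 2 * (κ * ℓ) by positivity)
      nlinarith
    have e3 : κ * ρ * J / (204800 * k) = J ^ 2 * (κ * ℓ) / 1024 := by
      rw [hℓ]; field_simp; norm_num
    calc κ * ρ * J / (204800 * k) * X ^ k
        = X ^ (k - 1) * (J ^ 2 * (κ * ℓ) * X / 1024) := by rw [e3, hXk]; ring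
      _ ≤ X ^ (k - 1) * ((3 / 4 * Y) ^ 2 * (1 / 2)) := by
          refine mul_le_mul_of_nonneg_left ?_ hXp
          nlinarith [sq_nonneg Y]
      _ = X ^ (k - 1) * (3 / 4 * Y) ^ 2 * (1 / 2) := by ring
      _ ≤ _ := mul_le_mul_of_nonneg_left hdef (mul_nonneg hXp (sq_nonneg _))

end SieveParameters

/-! ### From the sieve inequality to two primes among the shifts. -/

section TwoPrimes

variable {D R k : ℕ}

/-- At most one term is nonzero, since two would give a pair of primes forbidden by `h`. -/
theorem sum_primeLog_le_of_subsingleton {N m : ℕ}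
    (h : ∀ i i' : Fin k, i < i' → ¬ ((m + (i : ℕ) * D.factorial).Prime ∧
      (m + (i' : ℕ) * D.factorial).Prime ∧ N < m + (i : ℕ) * D.factorial))
    (P : Fin k → Prop) [DecidablePred P]
    (hP : ∀ j, P j → N < m + (j : ℕ) * D.factorial ∧ m + (j : ℕ) * D.factorial ≤ 2 * N)
    (hN : 0 < N) :
    ∑ j : Fin k, (if P j then primeLog (m + (j : ℕ) * D.factorial) else 0)
      ≤ Real.log (2 * N) := by
  have hL : 0 ≤ Real.log (2 * N) := by
    refine Real.log_nonneg ?_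
    have : (1 : ℝ) ≤ N := by exact_mod_cast hN
    linarith
  by_cases hex : ∃ j, P j ∧ (m + (j : ℕ) * D.factorial).Prime
  · obtain ⟨j, hj, hjp⟩ := hex
    rw [Finset.sum_eq_single j]
    · rw [if_pos hj]
      have := primeLog_le (hP j hj).2
      push_cast at this ⊢
      exact this
    · intro i _ hij
      split_ifs with hi
      · rw [primeLog, if_neg]
        intro hip
        rcases lt_or_gt_of_ne hij with hlt | hlt
        · exact h i j hlt ⟨hip, hjp, (hP i hi).1⟩
        · exact h j i hlt ⟨hjp, hip, (hP j hj).1⟩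
      · rfl
    · simp
  · push Not at hex
    refine le_trans (le_of_eq (Finset.sum_eq_zero fun j _ => ?_)) hL
    split_ifs with hj
    · rw [primeLog, if_neg (hex j hj)]
    · rfl

/-- If the sieve main terms dominate the error terms, then two of the shifts are prime. -/
theorem exists_two_primes (hkD : k ≤ D) {N : ℕ} (hN : 0 < N) (hRN : R ≤ N)
    (hkN : k * D.factorial ≤ N) (lam : (sievePrimes D R → Option (Fin k)) → ℝ) {Q₁ Q₂ E₂ : ℝ}
    (hQ₁ : tensorForm (fun p => compatDensity (realPrime p)) lam ≤ Q₁) (hQ₁0 : 0 ≤ Q₁)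
    (hQ₂ : ∀ j : Fin k, Q₂ ≤ tensorForm (fun p => compatDensity (realPrime p - 1))
        (fun c => if ∀ p, c p ≠ some j then lam c else 0))
    (hE₂ : ∑ c, ∑ c', |lam c| * |lam c'| *
      maxDiscrepancy N (D.factorial * natProd (colorSupport c ∪ colorSupport c')) ≤ E₂)
    (hmain : Real.log (2 * N) * (2 * N / D.factorial * Q₁ + (∑ c, |lam c|) ^ 2)
      < k * (N / D.factorial.totient * Q₂ - E₂)) :
    ∃ m : ℕ, ∃ i i' : Fin k, i < i' ∧ (m + (i : ℕ) * D.factorial).Prime ∧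
      (m + (i' : ℕ) * D.factorial).Prime ∧ N < m + (i : ℕ) * D.factorial := by
  by_contra hcon
  push Not at hcon
  refine absurd hmain (not_lt.mpr ?_)
  have hL : 0 ≤ Real.log (2 * N) := by
    refine Real.log_nonneg ?_
    have : (1 : ℝ) ≤ N := by exact_mod_cast hN
    linarith
  -- One window containing all the shifted windows `(N - jW, 2N - jW]`, so that the sums over `j`
  -- can be exchanged with the sum over `m`.
  set I := (Finset.Ioc (N - k * D.factorial) (2 * N)).filter (fun n => n ≡ 1 [MOD D.factorial]) with hI
  have hS1 : ∑ n ∈ I, sieveSq lam n ≤ 2 * N / D.factorial * Q₁ + (∑ c, |lam c|) ^ 2 := by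
    refine (sum_sieveSq_le hkD (N - k * D.factorial) (2 * N) (by omega) lam).trans ?_
    refine add_le_add_left ?_ _
    have h1 : (((2 * N : ℕ) : ℝ) - ((N - k * D.factorial : ℕ) : ℝ)) / D.factorial ≤ 2 * N / D.factorial := by
      gcongr
      push_cast
      linarith [Nat.cast_nonneg (α := ℝ) (N - k * D.factorial)]
    have h0 : 0 ≤ (((2 * N : ℕ) : ℝ) - ((N - k * D.factorial : ℕ) : ℝ)) / D.factorial := by
      refine div_nonneg (sub_nonneg.mpr ?_) (Nat.cast_nonneg _)
      exact_mod_cast (by omega : N - k * D.factorial ≤ 2 * N)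
    exact (mul_le_mul_of_nonneg_left hQ₁ h0).trans (mul_le_mul_of_nonneg_right h1 hQ₁0)
  have hS2 : ∀ j : Fin k, (N : ℝ) / D.factorial.totient * Q₂ - E₂ ≤
      ∑ m ∈ I, (if N - (j : ℕ) * D.factorial < m ∧ m ≤ 2 * N - (j : ℕ) * D.factorial then
        primeLog (m + (j : ℕ) * D.factorial) else 0) * sieveSq lam m := by
    intro j
    have hjk : (j : ℕ) * D.factorial ≤ k * D.factorial := Nat.mul_le_mul_right _ j.2.le
    have h1 := le_sum_primeLog_sieveSq hkD hN hRN j (hjk.trans hkN) lam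
    have h2 := mul_le_mul_of_nonneg_left (hQ₂ j) (show (0 : ℝ) ≤ (N : ℝ) / D.factorial.totient by positivity)
    refine le_trans (sub_le_sub h2 hE₂) (h1.trans (le_of_eq ?_))
    simp_rw [ite_mul, zero_mul]
    rw [← Finset.sum_filter]
    refine Finset.sum_congr ?_ fun _ _ => rfl
    ext m
    simp only [hI, Finset.mem_filter, Finset.mem_Ioc]
    constructor
    · rintro ⟨⟨h3, h4⟩, h5⟩
      exact ⟨⟨⟨by omega, by omega⟩, h5⟩, h3, h4⟩
    · rintro ⟨⟨_, h5⟩, h3, h4⟩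
      exact ⟨⟨h3, h4⟩, h5⟩
  calc (k : ℝ) * (N / D.factorial.totient * Q₂ - E₂)
      = ∑ _j : Fin k, ((N : ℝ) / D.factorial.totient * Q₂ - E₂) := by
        rw [Finset.sum_const, Finset.card_univ, Fintype.card_fin, nsmul_eq_mul]
    _ ≤ ∑ j : Fin k, ∑ m ∈ I, (if N - (j : ℕ) * D.factorial < m ∧ m ≤ 2 * N - (j : ℕ) * D.factorial then
        primeLog (m + (j : ℕ) * D.factorial) else 0) * sieveSq lam m :=
        Finset.sum_le_sum fun j _ => hS2 j
    _ = ∑ m ∈ I, (∑ j : Fin k, (if N - (j : ℕ) * D.factorial < m ∧ m ≤ 2 * N - (j : ℕ) * D.factorial then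
        primeLog (m + (j : ℕ) * D.factorial) else 0)) * sieveSq lam m := by
        rw [Finset.sum_comm]
        exact Finset.sum_congr rfl fun m _ => (Finset.sum_mul _ _ _).symm
    _ ≤ ∑ m ∈ I, Real.log (2 * N) * sieveSq lam m := by
        refine Finset.sum_le_sum fun m _ => mul_le_mul_of_nonneg_right ?_ (sieveSq_nonneg lam m)
        refine sum_primeLog_le_of_subsingleton (fun i i' hii => ?_) _ (fun j hj => ?_) hN
        · rintro ⟨h1, h2, h3⟩
          exact absurd (hcon m i i' hii h1 h2) (not_le.mpr h3)
        · have hjk : (j : ℕ) * D.factorial ≤ k * D.factorial := Nat.mul_le_mul_right _ j.2.le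
          omega
    _ = Real.log (2 * N) * ∑ m ∈ I, sieveSq lam m := by rw [Finset.mul_sum]
    _ ≤ _ := mul_le_mul_of_nonneg_left hS1 hL

end TwoPrimes

/-! ### Asymptotic estimates for the errors. -/

section Asymptotics

theorem tendsto_log_natCast : Tendsto (fun N : ℕ => Real.log N) atTop atTop :=
  Real.tendsto_log_atTop.comp tendsto_natCast_atTop_atTop

theorem eventually_pow_log_mul_le (C : ℝ) (n : ℕ) :
    ∀ᶠ N : ℕ in atTop, C * Real.log N ^ n * Real.exp (Real.log N / 2) ≤ N := by
  have h1 := (isLittleO_pow_exp_pos_mul_atTop n (show (0 : ℝ) < 1 / 2 by norm_num)).bound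
    (show 0 < 1 / (|C| + 1) by positivity)
  filter_upwards [tendsto_log_natCast.eventually h1, tendsto_log_natCast.eventually_ge_atTop 0,
    eventually_gt_atTop 0] with N h2 h3 h4
  have hN : (0 : ℝ) < N := by exact_mod_cast h4
  rw [Real.norm_of_nonneg (by positivity), Real.norm_of_nonneg (by positivity),
    div_mul_eq_mul_div, le_div_iff₀ (by positivity), one_mul] at h2
  have h5 : C * Real.log N ^ n ≤ Real.exp (1 / 2 * Real.log N) := by
    refine le_trans ?_ h2
    rw [mul_comm]
    refine mul_le_mul_of_nonneg_left ?_ (by positivity)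
    linarith [le_abs_self C]
  have h6 : Real.exp (1 / 2 * Real.log N) * Real.exp (Real.log N / 2) = N := by
    rw [← Real.exp_add, show 1 / 2 * Real.log (N : ℝ) + Real.log N / 2 = Real.log N by ring,
      Real.exp_log hN]
  calc _ ≤ Real.exp (1 / 2 * Real.log N) * Real.exp (Real.log N / 2) :=
        mul_le_mul_of_nonneg_right h5 (Real.exp_pos _).le
    _ = N := h6

theorem eventually_sum_maxDiscrepancy_le {θ : ℝ} (hθ : HasLevelOfDistribution θ) (a b : ℕ)
    {C ε : ℝ} (hC : 0 ≤ C) (hε : 0 < ε) :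
    ∀ᶠ N : ℕ in atTop, C * Real.log N ^ a * (Real.log N ^ (a + b + 2) *
      ∑ q ∈ Finset.Icc 1 ⌊(N : ℝ) ^ θ⌋₊, maxDiscrepancy N q +
        N * Real.log N / Real.log N ^ (a + b + 2) * Real.log N ^ b) ≤ ε * N := by
  -- The exponent `2a + b + 3` is chosen so that with `H = L^(a+b+2)` both error terms become `O(N /
  -- L)`.
  obtain ⟨c, hc, hbound⟩ := (hθ ((2 * a + b + 3 : ℕ) : ℝ) (by positivity)).exists_pos
  have h1 := tendsto_natCast_atTop_atTop.eventually hbound.bound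
  filter_upwards [h1, tendsto_log_natCast.eventually_ge_atTop 1, eventually_gt_atTop 0,
    tendsto_log_natCast.eventually_ge_atTop (C * (c + 1) / ε)] with N h2 h3 h4 h5
  have hN : (0 : ℝ) < N := by exact_mod_cast h4
  set L := Real.log N with hL
  have hL0 : 0 < L := by linarith
  rw [Real.rpow_natCast, Real.norm_of_nonneg
    (Finset.sum_nonneg fun q _ => maxDiscrepancy_nonneg hN q),
    Real.norm_of_nonneg (by positivity)] at h2
  set T := ∑ q ∈ Finset.Icc 1 ⌊(N : ℝ) ^ θ⌋₊, maxDiscrepancy N q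
  have h6 : L ^ a * (L ^ (a + b + 2) * T) ≤ c * N / L := by
    have h7 := mul_le_mul_of_nonneg_left h2 (show 0 ≤ L ^ a * L ^ (a + b + 2) by positivity)
    rw [← mul_assoc]
    refine h7.trans (le_of_eq ?_)
    have : L ^ (2 * a + b + 3) = L ^ a * L ^ (a + b + 2) * L := by ring
    rw [this]
    field_simp
  have h7 : L ^ a * (N * L / L ^ (a + b + 2) * L ^ b) = N / L := by
    have : L ^ (a + b + 2) = L ^ a * L ^ b * L * L := by ring
    rw [this]
    field_simp
  have h8 : C * L ^ a * (L ^ (a + b + 2) * T + N * L / L ^ (a + b + 2) * L ^ b)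
      = C * (L ^ a * (L ^ (a + b + 2) * T) + L ^ a * (N * L / L ^ (a + b + 2) * L ^ b)) := by ring
  rw [h8, h7]
  calc _ ≤ C * (c * N / L + N / L) := mul_le_mul_of_nonneg_left (by linarith) hC
    _ = C * (c + 1) * N / L := by ring
    _ ≤ ε * N := by
        rw [div_le_iff₀ hL0]
        rw [div_le_iff₀ hε] at h5
        nlinarith

end Asymptotics

/-! ### Bounded gaps and the conclusion. -/

section BoundedGaps

/-- With `A = N/W · X^k · L`, the left side is at most `4A + N/2` and the right side at least `5A -
N/2`. Here `819200 = 4 · 204800`, `4096000 = 5 · 819200`, and `N < A` because `W < L`. -/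
theorem sieve_main_inequality {D k J : ℕ} (hk : 0 < k) {θ N κ ρ L X E₁ E₂ : ℝ}
    (hJ : 4096000 ≤ J * θ) (hN : 0 < N)
    (hκ : κ = D.factorial.totient / D.factorial) (hρ : ρ = θ / 4 * L) (hX : 1 ≤ X)
    (hL1 : 1 ≤ L) (hLW : (D.factorial : ℝ) < L) (hlog : Real.log (2 * N) ≤ 2 * L)
    (hE₁0 : 0 ≤ E₁) (hE₁ : 2 * L * E₁ ≤ N / 2) (hE₂ : k * E₂ ≤ N / 2) :
    Real.log (2 * N) * (2 * N / D.factorial * X ^ k + E₁)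
      < k * (N / D.factorial.totient * (κ * ρ * J / (204800 * k) * X ^ k) - E₂) := by
  have hk0 : (0 : ℝ) < k := by exact_mod_cast hk
  have hW : (0 : ℝ) < D.factorial := by exact_mod_cast D.factorial_pos
  have hφ : (0 : ℝ) < D.factorial.totient := by
    exact_mod_cast Nat.totient_pos.mpr D.factorial_pos
  have hXk : 1 ≤ X ^ k := one_le_pow₀ hX
  have e1 : k * (N / D.factorial.totient * (κ * ρ * J / (204800 * k) * X ^ k) - E₂)
      = N / D.factorial * X ^ k * L * (J * θ / 819200) - k * E₂ := by
    rw [hκ, hρ]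
    field_simp
    ring
  set A := N / D.factorial * X ^ k * L with hA
  have hA0 : 0 < A := by positivity
  have h1 : A * 5 ≤ A * (J * θ / 819200) := mul_le_mul_of_nonneg_left (by linarith) hA0.le
  have h2 : N < A := by
    have h3 : N / D.factorial * L ≤ A := by
      rw [hA, mul_right_comm]
      exact le_mul_of_one_le_right (by positivity) hXk
    have h4 : N < N / D.factorial * L := by
      rw [div_mul_eq_mul_div, lt_div_iff₀ hW]
      exact mul_lt_mul_of_pos_left hLW hN
    linarith
  have h5 : Real.log (2 * N) * (2 * N / D.factorial * X ^ k + E₁) ≤ 4 * A + 2 * L * E₁ := by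
    have h6 : 0 ≤ 2 * N / D.factorial * X ^ k + E₁ := by positivity
    refine (mul_le_mul_of_nonneg_right hlog h6).trans (le_of_eq ?_)
    rw [hA]; ring
  rw [e1]
  linarith

theorem first_error_le {k : ℕ} {L ρ S N : ℝ} (hL0 : 0 < L) (h0 : 0 ≤ 1 + ρ) (h1 : 1 + ρ ≤ 2 * L)
    (hρL : 2 * ρ ≤ L / 2) (hS0 : 0 ≤ S)
    (hS : S ≤ (2 * (1 + ρ)) ^ k * (Real.exp ρ * (1 + ρ) ^ k))
    (hE : 4 * (4 ^ (2 * k) * 2 ^ (2 * k)) * L ^ (4 * k + 1) * Real.exp (L / 2) ≤ N) :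
    2 * L * S ^ 2 ≤ N / 2 := by
  have h2 : S ≤ (2 * (2 * L)) ^ k * (Real.exp ρ * (2 * L) ^ k) := by
    refine hS.trans ?_
    gcongr
  have h3 := pow_le_pow_left₀ hS0 h2 2
  have h4 : ((2 * (2 * L)) ^ k * (Real.exp ρ * (2 * L) ^ k)) ^ 2
      = 4 ^ (2 * k) * 2 ^ (2 * k) * L ^ (4 * k) * Real.exp (2 * ρ) := by
    have e1 : Real.exp (2 * ρ) = Real.exp ρ ^ 2 := by rw [← Real.exp_nat_mul]; norm_num
    have e2 : (2 * (2 * L)) ^ k = 4 ^ k * L ^ k := by rw [← mul_pow]; congr 1; ring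
    rw [e1, e2, mul_pow 2 L k]
    ring
  rw [h4] at h3
  have h5 : 4 ^ (2 * k) * 2 ^ (2 * k) * L ^ (4 * k) * Real.exp (2 * ρ)
      ≤ 4 ^ (2 * k) * 2 ^ (2 * k) * L ^ (4 * k) * Real.exp (L / 2) :=
    mul_le_mul_of_nonneg_left (Real.exp_le_exp.mpr hρL) (by positivity)
  have h6 := mul_le_mul_of_nonneg_left (h3.trans h5) (show 0 ≤ 2 * L by positivity)
  have h7 : 4 * (4 ^ (2 * k) * 2 ^ (2 * k)) * L ^ (4 * k + 1) * Real.exp (L / 2)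
      = 2 * (2 * L * (4 ^ (2 * k) * 2 ^ (2 * k) * L ^ (4 * k) * Real.exp (L / 2))) := by ring
  rw [h7] at hE
  linarith

theorem second_error_le {k K B : ℕ} {L ρ T N : ℝ} (hL0 : 0 < L) (h1 : 1 + ρ ≤ 2 * L)
    (h2 : 1 + 2 * ρ ≤ 3 * L) (hρ : 0 ≤ ρ) (hN : 1 ≤ N) (hlog : Real.log (2 * N) ≤ 2 * L)
    (hT : 0 ≤ T) :
    k * (((2 * (1 + ρ)) ^ k) ^ 2 * (L ^ B * T +
      5 * N * Real.log (2 * N) / L ^ B * (1 + 2 * ρ) ^ (2 * K ^ 2)))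
      ≤ k * 4 ^ (2 * k) * (10 * 3 ^ (2 * K ^ 2)) * L ^ (2 * k) *
        (L ^ B * T + N * L / L ^ B * L ^ (2 * K ^ 2)) := by
  have hlog0 : 0 ≤ Real.log (2 * N) := Real.log_nonneg (by linarith)
  have h3 : ((2 * (1 + ρ)) ^ k) ^ 2 ≤ 4 ^ (2 * k) * L ^ (2 * k) := by
    rw [← pow_mul, mul_comm k 2, ← mul_pow]
    exact pow_le_pow_left₀ (by positivity) (by linarith) _
  have h4 : (1 + 2 * ρ) ^ (2 * K ^ 2) ≤ 3 ^ (2 * K ^ 2) * L ^ (2 * K ^ 2) := by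
    rw [← mul_pow]
    exact pow_le_pow_left₀ (by positivity) (by linarith) _
  have h5 : 5 * N * Real.log (2 * N) / L ^ B * (1 + 2 * ρ) ^ (2 * K ^ 2)
      ≤ 5 * N * (2 * L) / L ^ B * (3 ^ (2 * K ^ 2) * L ^ (2 * K ^ 2)) := by
    refine mul_le_mul ?_ h4 (by positivity) (by positivity)
    gcongr
  have h6 : L ^ B * T ≤ 10 * 3 ^ (2 * K ^ 2) * (L ^ B * T) := by
    refine le_mul_of_one_le_left (by positivity) ?_
    have : (1 : ℝ) ≤ 3 ^ (2 * K ^ 2) := one_le_pow₀ (by norm_num)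
    linarith
  have h7 : L ^ B * T + 5 * N * Real.log (2 * N) / L ^ B * (1 + 2 * ρ) ^ (2 * K ^ 2)
      ≤ 10 * 3 ^ (2 * K ^ 2) * (L ^ B * T + N * L / L ^ B * L ^ (2 * K ^ 2)) := by
    refine (add_le_add h6 h5).trans (le_of_eq ?_)
    ring
  have h8 := mul_le_mul h3 h7 (by positivity) (by positivity)
  refine (mul_le_mul_of_nonneg_left h8 (Nat.cast_nonneg k)).trans (le_of_eq ?_)
  ring

/-- The moduli are at most `W e^(2ρ)`, while `N^θ = e^(4ρ)`; the spare factor `e^(2ρ)` absorbs `W`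
and the rounding. -/
theorem mul_exp_le_floor_rpow {θ N ρ W : ℝ} (hN : 0 < N) (hρ : ρ = θ / 4 * Real.log N)
    (hW : 0 ≤ W) (h : W + 1 ≤ Real.exp (2 * ρ)) :
    W * Real.exp (2 * ρ) ≤ (⌊N ^ θ⌋₊ : ℝ) := by
  have h1 : N ^ θ = Real.exp (2 * ρ) * Real.exp (2 * ρ) := by
    rw [Real.rpow_def_of_pos hN, ← Real.exp_add, hρ]
    congr 1
    ring
  have h2 := Nat.lt_floor_add_one (N ^ θ)
  have h3 := mul_le_mul_of_nonneg_right h (Real.exp_pos (2 * ρ)).le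
  linarith

theorem eventually_exists_two_primes_of_params {θ : ℝ} (hθ0 : 0 < θ) (hθ1 : θ < 1)
    (hθ : HasLevelOfDistribution θ) {J k D : ℕ} (hJθ : 4096000 ≤ J * θ) (hk : k = 2 ^ J)
    (hD : D = 100 * k ^ 2) :
    ∀ᶠ N : ℕ in atTop, ∃ p p' : ℕ, p.Prime ∧ p'.Prime ∧ N < p ∧ p < p' ∧
      p' ≤ p + k * D.factorial := by
  have hJ0 : 0 < J := by
    rcases Nat.eq_zero_or_pos J with h | h
    · rw [h] at hJθ; norm_num at hJθ
    · exact h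
  have hk0 : 0 < k := by rw [hk]; positivity
  have hkD : k ≤ D := by nlinarith
  set W := D.factorial with hW
  have hWpos : 0 < W := D.factorial_pos
  have hW1 : (1 : ℝ) ≤ W := by exact_mod_cast hWpos
  set κ : ℝ := W.totient / W with hκ
  have hκ0 : 0 < κ := by
    have : 0 < W.totient := Nat.totient_pos.mpr hWpos
    positivity
  set K := (k + 1) ^ 2 with hK
  have hJ1 : (1 : ℝ) ≤ J := by exact_mod_cast hJ0
  have hk1 : (1 : ℝ) ≤ k := by exact_mod_cast hk0
  filter_upwards [eventually_pow_log_mul_le (4 * (4 ^ (2 * k) * 2 ^ (2 * k))) (4 * k + 1),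
    eventually_sum_maxDiscrepancy_le hθ (2 * k) (2 * K ^ 2)
      (C := k * 4 ^ (2 * k) * (10 * 3 ^ (2 * K ^ 2))) (ε := 1 / 2) (by positivity) (by norm_num),
    tendsto_log_natCast.eventually_ge_atTop 1,
    tendsto_log_natCast.eventually_gt_atTop W,
    tendsto_log_natCast.eventually_ge_atTop ((W + 1) * 4 / κ * (200 * J * k) * (4 / θ)),
    tendsto_log_natCast.eventually_ge_atTop (2 / θ * W),
    eventually_ge_atTop (k * W), eventually_ge_atTop 2] with N hE1 hE2 hL1 hLW hLbig hLexp hkN hN2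
  have hN : 0 < N := by omega
  have hN0 : (0 : ℝ) < N := by exact_mod_cast hN
  have hN2' : (2 : ℝ) ≤ N := by exact_mod_cast hN2
  set L := Real.log N with hL
  have hL0 : 0 < L := by linarith
  set ρ := θ / 4 * L with hρ
  have hρ0 : 0 < ρ := by positivity
  set ℓ := ρ / (200 * J * k) with hℓ
  set R := ⌊Real.exp ρ⌋₊ with hR
  have hρL : 2 * ρ ≤ L / 2 := by rw [hρ]; nlinarith
  have hexpL : Real.exp L = N := Real.exp_log hN0
  have hRN : R ≤ N := by
    have h1 : Real.exp ρ ≤ N := by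
      rw [← hexpL]
      exact Real.exp_le_exp.mpr (by linarith)
    have h2 := Nat.floor_le_floor h1
    rwa [Nat.floor_natCast] at h2
  have hbig : (W : ℝ) + 1 ≤ κ * ℓ / 4 := by
    have h1 : (W + 1) * 4 / κ ≤ ℓ := by
      rw [hℓ, le_div_iff₀ (by positivity), hρ]
      rw [← div_le_iff₀' (by positivity)]
      refine le_trans (le_of_eq ?_) hLbig
      field_simp
    rw [div_le_iff₀ hκ0] at h1
    linarith
  obtain ⟨X, hX1, hQ1, hQ2⟩ := exists_form_bounds (D := D) (R := R) (k := k) (J := J) hk0 hJ0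
    hD.ge hκ hρ0 hℓ (by rw [← hk]; nlinarith) (Nat.lt_floor_add_one _) hbig
  have hGnn := stepWeight_nonneg J ℓ
  have hG2 := stepWeight_le_two J ℓ
  have h2L : Real.log (2 * N) ≤ 2 * L := by
    rw [two_mul L, hL, ← Real.log_mul (by positivity) (by positivity)]
    exact Real.log_le_log (by positivity) (by nlinarith)
  have h1ρ : 1 + ρ ≤ 2 * L := by linarith
  have h1ρ0 : 0 ≤ 1 + ρ := by linarith
  have hS1 := sum_abs_sieveWeight_le (D := D) (R := R) (k := k) hρ0.le hGnn hG2
  set S1 := ∑ c : sievePrimes D R → Option (Fin k),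
    |sieveWeight realPrime (diagVar realPrime ρ (stepWeight J ℓ)) c| with hS1def
  have hS10 : 0 ≤ S1 := Finset.sum_nonneg fun c _ => abs_nonneg _
  have hS1' : 2 * L * S1 ^ 2 ≤ N / 2 := first_error_le hL0 h1ρ0 h1ρ hρL hS10 hS1 hE1
  have hexp2 : (W : ℝ) + 1 ≤ Real.exp (2 * ρ) := by
    have h1 := Real.add_one_le_exp (2 * ρ)
    have h2 : (W : ℝ) ≤ 2 * ρ := by
      have h3 : 2 / θ * W * (θ / 2) = W := by field_simp
      have h4 := mul_le_mul_of_nonneg_right hLexp (show 0 ≤ θ / 2 by positivity)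
      rw [h3] at h4
      rw [hρ]
      linarith
    linarith
  have hQ : (W : ℝ) * Real.exp (2 * ρ) ≤ (⌊(N : ℝ) ^ θ⌋₊ : ℝ) :=
    mul_exp_le_floor_rpow hN0 hρ (Nat.cast_nonneg W) hexp2
  have hQN : ⌊(N : ℝ) ^ θ⌋₊ ≤ N := by
    have h1 : (N : ℝ) ^ θ ≤ N := by
      calc (N : ℝ) ^ θ ≤ (N : ℝ) ^ (1 : ℝ) :=
            Real.rpow_le_rpow_of_exponent_le (by linarith) hθ1.le
        _ = N := Real.rpow_one _
    have h2 := Nat.floor_le_floor h1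
    rwa [Nat.floor_natCast] at h2
  have hS2 := sum_abs_sieveWeight_mul_maxDiscrepancy_le (D := D) (R := R) (k := k) hN hρ0.le
    hGnn hG2
  -- This is the exponent `a + b + 2` of `eventually_sum_maxDiscrepancy_le` with `a = 2k` and `b =
  -- 2K²`; the splitting parameter is `H = L ^ B`.
  set B := 2 * k + 2 * K ^ 2 + 2 with hB
  have hLB : 0 < L ^ B := by positivity
  have hS3 := sum_pow_card_mul_maxDiscrepancy_le (D := D) (R := R) hN2 hQN K (v := 2 * ρ)
    (by positivity) hQ hLB
  set T := ∑ q ∈ Finset.Icc 1 ⌊(N : ℝ) ^ θ⌋₊, maxDiscrepancy N q with hT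
  have hT0 : 0 ≤ T := Finset.sum_nonneg fun q _ => maxDiscrepancy_nonneg hN0 q
  have hS4 := hS2.trans (mul_le_mul_of_nonneg_left hS3 (by positivity))
  have hE2' : k * (((2 * (1 + ρ)) ^ k) ^ 2 * (L ^ B * T +
      5 * N * Real.log (2 * N) / L ^ B * (1 + 2 * ρ) ^ (2 * K ^ 2))) ≤ N / 2 :=
    (second_error_le hL0 h1ρ (by linarith) hρ0.le (by linarith) h2L hT0).trans
      (hE2.trans (le_of_eq (by ring)))
  obtain ⟨m, i, i', hii, hp, hp', hNm⟩ := exists_two_primes hkD hN hRN hkN _ hQ1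
    (by positivity) hQ2 hS4
    (sieve_main_inequality hk0 hJθ hN0 hκ hρ hX1 hL1 hLW h2L (sq_nonneg _) hS1' hE2')
  refine ⟨_, _, hp, hp', hNm, ?_, ?_⟩
  · have : (i : ℕ) * W < i' * W := Nat.mul_lt_mul_of_pos_right hii hWpos
    exact Nat.add_lt_add_left this m
  · have : (i' : ℕ) * W ≤ k * W := Nat.mul_le_mul_right _ i'.2.le
    have h2 : m + (i' : ℕ) * W ≤ m + i * W + k * W := by omega
    exact h2

/-- Two primes among boundedly many shifts, for every positive level of distribution. -/
theorem eventually_exists_two_primes {θ : ℝ} (hθ0 : 0 < θ) (hθ1 : θ < 1)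
    (hθ : HasLevelOfDistribution θ) :
    ∃ B : ℕ, ∀ᶠ N : ℕ in atTop, ∃ p p' : ℕ, p.Prime ∧ p'.Prime ∧ N < p ∧ p < p' ∧ p' ≤ p + B := by
  obtain ⟨J, hJ⟩ := exists_nat_ge (4096000 / θ)
  rw [div_le_iff₀ hθ0] at hJ
  -- The parameters are `k = 2^J` and `D = 100k²`, and the bound found by unification is `k · D!`.
  exact ⟨_, eventually_exists_two_primes_of_params hθ0 hθ1 hθ hJ rfl rfl⟩

theorem frequently_nth_prime_gap_le {B : ℕ}
    (h : ∀ᶠ N : ℕ in atTop, ∃ p p' : ℕ, p.Prime ∧ p'.Prime ∧ N < p ∧ p < p' ∧ p' ≤ p + B) :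
    ∃ᶠ n : ℕ in atTop, Nat.nth Nat.Prime (n + 1) ≤ Nat.nth Nat.Prime n + B := by
  rw [frequently_atTop]
  intro n₀
  obtain ⟨N₀, hN₀⟩ := eventually_atTop.mp h
  obtain ⟨p, p', hp, hp', hNp, hpp, hB⟩ := hN₀ (max N₀ (Nat.nth Nat.Prime n₀)) (le_max_left _ _)
  -- The index of `p` in the zero-based enumeration. The next prime is at most `p'`, hence within
  -- `B` of `p`.
  refine ⟨Nat.count Nat.Prime p, ?_, ?_⟩
  · have h1 : Nat.nth Nat.Prime n₀ < p := (le_max_right _ _).trans_lt hNp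
    rw [← Nat.nth_count hp] at h1
    exact ((Nat.nth_strictMono Nat.infinite_setOfPred_prime).lt_iff_lt.mp h1).le
  · rw [Nat.nth_count hp]
    refine le_trans ?_ hB
    rw [← Nat.nth_count hp']
    refine (Nat.nth_strictMono Nat.infinite_setOfPred_prime).monotone ?_
    exact Nat.count_strict_mono hp hpp

theorem mainTheorem2 (θ : ℝ) (hθ0 : 0 < θ) (hθ1 : θ < 1) (hθ : HasLevelOfDistribution θ) :
    liminf (fun n : ℕ =>
        ((((Nat.nth Nat.Prime (n + 1) : ℝ) - (Nat.nth Nat.Prime n : ℝ)) /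
          Real.log (Nat.nth Nat.Prime n : ℝ) : ℝ) : EReal)) atTop
      ≤ ((max 0 (1 - 2 * θ) : ℝ) : EReal) := by
  obtain ⟨B, hB⟩ := eventually_exists_two_primes hθ0 hθ1 hθ
  have hfreq := frequently_nth_prime_gap_le hB
  have hlog : Tendsto (fun n : ℕ => Real.log (Nat.nth Nat.Prime n : ℝ)) atTop atTop :=
    tendsto_log_natCast.comp (Nat.nth_strictMono Nat.infinite_setOfPred_prime).tendsto_atTop
  -- Bounded gaps make the lower limit at most 0, so the term `1 - 2θ` plays no role.
  refine le_trans ?_ (EReal.coe_le_coe_iff.mpr (le_max_left 0 (1 - 2 * θ)))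
  rw [← EReal.le_of_forall_lt_iff_le]
  intro z hz
  have hz0 : 0 < z := by exact_mod_cast hz
  refine liminf_le_of_frequently_le' ?_
  refine (hfreq.and_eventually ((hlog.eventually_ge_atTop (B / z)).and
    (hlog.eventually_gt_atTop 0))).mono ?_
  rintro n ⟨h1, h2, h3⟩
  rw [EReal.coe_le_coe_iff, div_le_iff₀ h3]
  have h4 : (Nat.nth Nat.Prime (n + 1) : ℝ) ≤ Nat.nth Nat.Prime n + B := by exact_mod_cast h1
  rw [div_le_iff₀ hz0] at h2
  linarith

end BoundedGaps
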